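/- Fix an integer $\ell\ge 3$ and let $p=p(N)\in(0,1)$ satisfy $p\to 0$ as $N\to\infty$. Let $G(N,p)$ be the Erdős–Rényi random graph on the vertex set $[N]$, in which each pair of vertices is an edge independently with probability $p$. For the cycle $C_\ell$ on the vertices $v_1,\dots,v_\ell$ and a symmetric $N\times N$ matrix $X$ put $$\hom_{C_\ell}(X)=\sum_{f:V(C_\ell)\to[N]}\ \prod_{vw\in E(C_\ell)}X_{f(v)f(w)},$$ and let $\hom_{C_\ell}(G)=\hom_{C_\ell}(A_G)$ for a graph $G$ on $[N]$ with adjacency matrix $A_G$. Let $\mathcal X_N$ be the set of symmetric $N\times N$ matrices with entries in $[0,1]$ and zeros on the diagonal. For $x\in[0,1]$ let $I_p(x)=x\log\frac xp+(1-x)\log\frac{1-x}{1-p}$ (with $0\log 0=0$), for $X\in\mathcal X_N$ let $I_p(X)=\sum_{1\le i<j\le N}I_p(x_{ij})$, and for $t\in\mathbb R$ let $$\phi(C_\ell,N,p,t)=\inf\{I_p(X): X\in\mathcal X_N,\ \hom_{C_\ell}(X)\ge tN^\ell p^\ell\},$$ $$\psi(C_\ell,N,p,t)=\inf\{I_p(X):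 X\in\mathcal X_N,\ \hom_{C_\ell}(X)\le tN^\ell p^\ell\},$$ where $\inf\emptyset=+\infty$ and $e^{-\infty}=0$. Here $f\ll g$, $g\gg f$ and $f=o(g)$ all mean $f/g\to0$ as $N\to\infty$. (i) If $p\gg\max\big(N^{2/\ell-1},\,(\log N)^{\ell/(2\ell-4)}/\sqrt N\big)$, then for every fixed $t>1$ there are real sequences $\varepsilon_N=o(1)$ and $E_N=o\big(N^2p^2\log(1/p)\big)$ such that for all $N\ge2$ $$\mathbb P\big(\hom_{C_\ell}(G(N,p))\ge tN^\ell p^\ell\big)\le\exp\big(-\phi(C_\ell,N,p,t-\varepsilon_N)+E_N\big).$$ (ii) If $p\gg\big(\frac{\log N}{N}\big)^{(\ell-2)/(2\ell-2)}$, then for every fixed $0\le t<1$ there are real sequences $\varepsilon_N=o(1)$ and $E_N=o(N^2p)$ such that for all $N\ge2$ $$\mathbb P\big(\hom_{C_\ell}(G(N,p))\le tN^\ell p^\ell\big)\le\exp\big(-\psi(C_\ell,N,p,t+\varepsilon_N)+E_N\big).$$ -/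

import Mathlib

open Filter Topology Asymptotics MeasureTheory

namespace SubgraphLD

open Classical in
/-- The homomorphism counting function of a graph `H` on the vertex set `{0, …, n-1}`, extended to
symmetric matrices: the sum over all maps `f : [n] → [N]` of the product, over the edges `vw` of
`H` (each taken once, with `v < w`), of the entries `X_{f(v) f(w)}`. -/
noncomputable def homMatrix {n : ℕ} (H : SimpleGraph (Fin n)) {N : ℕ}
    (X : Matrix (Fin N) (Fin N) ℝ) : ℝ :=
  ∑ f : Fin n → Fin N,
    ∏ e : Fin n × Fin n with e.1 < e.2 ∧ H.Adj e.1 e.2, X (f e.1) (f e.2)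

open Classical in
/-- The number of homomorphisms from `H` to `G`, through the adjacency matrix of `G`. -/
noncomputable def homGraph {n : ℕ} (H : SimpleGraph (Fin n)) {N : ℕ}
    (G : SimpleGraph (Fin N)) : ℝ :=
  homMatrix H (G.adjMatrix ℝ)

/-- The symmetric `N × N` matrices with entries in `[0,1]` and zeros on the diagonal. -/
def weightedGraphs (N : ℕ) : Set (Matrix (Fin N) (Fin N) ℝ) :=
  {X | X.IsSymm ∧ (∀ i j, X i j ∈ Set.Icc (0 : ℝ) 1) ∧ ∀ i, X i i = 0}

/-- `I_p(x)`, the relative entropy of Bernoulli(`x`) with respect to Bernoulli(`p`), for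
`x ∈ [0,1]` and `p ∈ (0,1)`. The convention `0 log 0 = 0` is built into `Real.log`. -/
noncomputable def relEntropy (p x : ℝ) : ℝ :=
  x * Real.log (x / p) + (1 - x) * Real.log ((1 - x) / (1 - p))

/-- `I_p(X)`, the sum of `I_p(x_{ij})` over `i < j`. -/
noncomputable def relEntropyMatrix {N : ℕ} (p : ℝ) (X : Matrix (Fin N) (Fin N) ℝ) : ℝ :=
  ∑ e : Fin N × Fin N with e.1 < e.2, relEntropy p (X e.1 e.2)

/-- The upper-tail entropic variational problem. It is `+∞` if no matrix is admissible. -/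
noncomputable def upperRate {n : ℕ} (H : SimpleGraph (Fin n)) (N : ℕ) (p t : ℝ) : EReal :=
  ⨅ X ∈ {X | X ∈ weightedGraphs N ∧
      t * (N : ℝ) ^ n * p ^ H.edgeSet.ncard ≤ homMatrix H X},
    (relEntropyMatrix p X : EReal)

/-- The lower-tail entropic variational problem. It is `+∞` if no matrix is admissible. -/
noncomputable def lowerRate {n : ℕ} (H : SimpleGraph (Fin n)) (N : ℕ) (p t : ℝ) : EReal :=
  ⨅ X ∈ {X | X ∈ weightedGraphs N ∧
      homMatrix H X ≤ t * (N : ℝ) ^ n * p ^ H.edgeSet.ncard},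
    (relEntropyMatrix p X : EReal)

end SubgraphLD

/-! The engine is an entropy bound valid for every nonempty set S of graphs,
`cubeProb_le_exp_neg_relEntropy`: the probability of S is at most exp(-I_p(X)), where X is the mean
adjacency matrix conditioned on S. It therefore suffices to cut the tail event into few pieces such
that the barycentre of each piece has nearly the cycle count of its members. Each barycentre then
competes in the variational problem with t shifted by o(1), and the logarithm of the number of
pieces goes into the error term.

For a cycle the count is the trace of the ℓ-th power, so the cut is spectral. Graphs are sorted by
their R largest eigenvalues in absolute value and the corresponding eigenvectors, rounded to an
inverse power of N; this makes N^{O(NR)} pieces (`cubeProb_le_of_small_tail`). On a piece every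
adjacency matrix is B + Z with BZ = ZB = 0 and B almost constant, so the ℓ-th power of the mean is
B^ℓ plus the ℓ-th power of the mean of Z, up to a negligible error. Convexity of Schatten norms
(`abs_trace_pow_sum_le`) bounds the trace of the latter by the mean of the sums of |λ_k|^ℓ over the
discarded indices. What remains is to make this tail sum o(N^ℓ p^ℓ) outside an event of probability
at most 2 exp(-rate), while N R log N stays within the permitted error.

Upper tail: R is about δ N p² log(1/p) / log N. A planted clique shows that the rate is at most a
constant times N² p² log(1/p). Take h to be this bound. By Talagrand's convex distance inequality,
outside probability 2 exp(-h) a graph is within √(16h) of the convex hull of the graphs whose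
centred adjacency matrix M has tr M⁴ ≤ 8N³p². Testing against the leading rank r truncation gives
|λ_r| √r ≤ √(32h) + pN + (r · 8N³p²)^{1/4} (`exists_eigenvalue_bound`). After summing ℓ-th powers,
the first two terms are negligible because (log N)^ℓ ≪ (Np²)^{ℓ-2}; the last one needs p ≫ N^{-1/3}
if ℓ = 3 and log N ≪ Np² if ℓ ≥ 4.

Lower tail: R is about δ N p / log N. The empty graph shows that the rate is at most N²p once p ≤
1/2, and a graph has at least 2N²p edges with probability at most exp(-N²p). With fewer edges the
Frobenius norm alone controls the discarded eigenvalues (`sum_tail_le_of_few_edges`).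

These arguments give an error δ for each fixed δ > 0 and all large N; `exists_error_sequences` turns
this into vanishing sequences. -/

namespace SubgraphLD

/-! ### The biased product measure on the discrete cube -/

section Cube

variable {ι : Type*} [Fintype ι]

/-- The mass that the Bernoulli(`p`) law gives to `b`. -/
noncomputable def bernWeight (p : ℝ) (b : Bool) : ℝ := if b then p else 1 - p

/-- The real number `0` or `1` that a Boolean stands for. -/
noncomputable def boolVal (b : Bool) : ℝ := if b then 1 else 0

/-- The mass that the `p`-biased product measure gives to a point of the cube. -/
noncomputable def cubeWeight (p : ℝ) (ω : ι → Bool) : ℝ := ∏ i, bernWeight p (ω i)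

/-- The `p`-biased measure of a set of points of the cube. -/
noncomputable def cubeProb (p : ℝ) (S : Finset (ι → Bool)) : ℝ := ∑ ω ∈ S, cubeWeight p ω

lemma bernWeight_pos {p : ℝ} (hp : 0 < p) (hp1 : p < 1) (b : Bool) : 0 < bernWeight p b := by
  cases b <;> simp [bernWeight] <;> linarith

lemma bernWeight_nonneg {p : ℝ} (hp : 0 ≤ p) (hp1 : p ≤ 1) (b : Bool) : 0 ≤ bernWeight p b := by
  cases b <;> simp [bernWeight] <;> linarith

lemma cubeWeight_pos {p : ℝ} (hp : 0 < p) (hp1 : p < 1) (ω : ι → Bool) : 0 < cubeWeight p ω :=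
  Finset.prod_pos fun _ _ => bernWeight_pos hp hp1 _

lemma cubeProb_nonneg {p : ℝ} (hp : 0 < p) (hp1 : p < 1) (S : Finset (ι → Bool)) :
    0 ≤ cubeProb p S :=
  Finset.sum_nonneg fun ω _ => (cubeWeight_pos hp hp1 ω).le

lemma cubeProb_pos {p : ℝ} (hp : 0 < p) (hp1 : p < 1) {S : Finset (ι → Bool)} (hS : S.Nonempty) :
    0 < cubeProb p S :=
  Finset.sum_pos (fun ω _ => cubeWeight_pos hp hp1 ω) hS

lemma cubeProb_mono {p : ℝ} (hp : 0 < p) (hp1 : p < 1) {S T : Finset (ι → Bool)} (h : S ⊆ T) :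
    cubeProb p S ≤ cubeProb p T :=
  Finset.sum_le_sum_of_subset_of_nonneg h fun ω _ _ => (cubeWeight_pos hp hp1 ω).le

lemma boolVal_mem (b : Bool) : boolVal b ∈ Set.Icc (0 : ℝ) 1 := by
  cases b <;> simp [boolVal]

/-- The barycentre of a set of points of the cube under the `p`-biased measure. -/
noncomputable def cubeMean (p : ℝ) (S : Finset (ι → Bool)) (i : ι) : ℝ :=
  ∑ ω ∈ S, cubeWeight p ω / cubeProb p S * boolVal (ω i)

lemma sum_cubeWeight_div {p : ℝ} (hp : 0 < p) (hp1 : p < 1) {S : Finset (ι → Bool)}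
    (hS : S.Nonempty) : ∑ ω ∈ S, cubeWeight p ω / cubeProb p S = 1 := by
  rw [← Finset.sum_div]
  exact div_self (cubeProb_pos hp hp1 hS).ne'

lemma cubeMean_mem {p : ℝ} (hp : 0 < p) (hp1 : p < 1) {S : Finset (ι → Bool)}
    (hS : S.Nonempty) (i : ι) : cubeMean p S i ∈ Set.Icc (0 : ℝ) 1 := by
  have hw : ∀ ω ∈ S, 0 ≤ cubeWeight p ω / cubeProb p S := fun ω _ =>
    (div_pos (cubeWeight_pos hp hp1 ω) (cubeProb_pos hp hp1 hS)).le
  refine ⟨Finset.sum_nonneg fun ω h => mul_nonneg (hw ω h) (boolVal_mem _).1, ?_⟩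
  rw [← sum_cubeWeight_div hp hp1 hS]
  exact Finset.sum_le_sum fun ω h => mul_le_of_le_one_right (hw ω h) (boolVal_mem _).2

variable [DecidableEq ι]

lemma sum_prod_bernoulli (x : ι → ℝ) :
    ∑ ω : ι → Bool, ∏ i, bernWeight (x i) (ω i) = 1 := by
  have := (Finset.prod_univ_sum (fun _ : ι => (Finset.univ : Finset Bool))
    (fun i b => bernWeight (x i) b)).symm
  rw [Fintype.piFinset_univ] at this
  rw [this]
  exact Finset.prod_eq_one fun i _ => by simp [bernWeight]

lemma sum_cubeWeight (p : ℝ) : ∑ ω : ι → Bool, cubeWeight p ω = 1 :=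
  sum_prod_bernoulli fun _ => p

lemma cubeProb_le_one {p : ℝ} (hp : 0 < p) (hp1 : p < 1) (S : Finset (ι → Bool)) :
    cubeProb p S ≤ 1 := by
  rw [← sum_cubeWeight (ι := ι) p]
  exact cubeProb_mono hp hp1 (Finset.subset_univ S)

/-- Superadditivity of relative entropy with respect to a product measure: the probability of a set
is at most the exponential of minus the relative entropy of its barycentre. -/
theorem cubeProb_le_exp_neg_relEntropy {p : ℝ} (hp : 0 < p) (hp1 : p < 1)
    {S : Finset (ι → Bool)} (hS : S.Nonempty) :
    cubeProb p S ≤ Real.exp (-∑ i, relEntropy p (cubeMean p S i)) := by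
  set P := cubeProb p S with hP
  have hPpos : 0 < P := cubeProb_pos hp hp1 hS
  set q : (ι → Bool) → ℝ := fun ω => cubeWeight p ω / P with hq
  have hqpos : ∀ ω, 0 < q ω := fun ω => div_pos (cubeWeight_pos hp hp1 ω) hPpos
  have hqsum : ∑ ω ∈ S, q ω = 1 := sum_cubeWeight_div hp hp1 hS
  set x := cubeMean p S with hx
  have hxdef : ∀ i, x i = ∑ ω ∈ S, q ω * boolVal (ω i) := fun i => rfl
  have hx1 : ∀ i, 1 - x i = ∑ ω ∈ S, q ω * (1 - boolVal (ω i)) := fun i => by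
    simp_rw [mul_sub, mul_one]
    rw [Finset.sum_sub_distrib, hqsum, hxdef]
  -- A mean `x i` equal to 0 or 1 does no harm: it occurs only when all points of `S` share that
  -- coordinate, so the members of `S` keep positive mass.
  have hpos : ∀ ω ∈ S, ∀ i, 0 < bernWeight (x i) (ω i) := by
    intro ω hω i
    cases hb : ω i
    · simp only [bernWeight, Bool.false_eq_true, if_false]
      rw [hx1]
      refine Finset.sum_pos' (fun ω' _ => mul_nonneg (hqpos ω').le ?_) ⟨ω, hω, ?_⟩
      · linarith [(boolVal_mem (ω' i)).2]
      · simpa [boolVal, hb] using hqpos ω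
    · simp only [bernWeight, if_true]
      rw [hxdef]
      refine Finset.sum_pos' (fun ω' _ => mul_nonneg (hqpos ω').le (boolVal_mem (ω' i)).1)
        ⟨ω, hω, ?_⟩
      simpa [boolVal, hb] using hqpos ω
  -- `v` is the product law with the same marginals as the conditioned law `q`. Gibbs' inequality
  -- between the two gives the superadditivity of relative entropy.
  set v : (ι → Bool) → ℝ := fun ω => ∏ i, bernWeight (x i) (ω i) with hv
  have hvpos : ∀ ω ∈ S, 0 < v ω := fun ω hω => Finset.prod_pos fun i _ => hpos ω hω i
  have hvsum : ∑ ω ∈ S, v ω ≤ 1 := by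
    rw [← sum_prod_bernoulli x]
    refine Finset.sum_le_sum_of_subset_of_nonneg (Finset.subset_univ S) fun ω _ _ =>
      Finset.prod_nonneg fun i _ => ?_
    have := cubeMean_mem hp hp1 hS i
    exact bernWeight_nonneg this.1 this.2 _
  have hgibbs : ∑ ω ∈ S, q ω * Real.log (v ω / q ω) ≤ 0 := by
    calc ∑ ω ∈ S, q ω * Real.log (v ω / q ω)
        ≤ ∑ ω ∈ S, (v ω - q ω) := by
          refine Finset.sum_le_sum fun ω hω => ?_
          have h1 := Real.log_le_sub_one_of_pos (div_pos (hvpos ω hω) (hqpos ω))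
          have h2 := mul_le_mul_of_nonneg_left h1 (hqpos ω).le
          have h3 : q ω * (v ω / q ω - 1) = v ω - q ω := by
            have := (hqpos ω).ne'
            field_simp
          linarith
      _ ≤ 0 := by rw [Finset.sum_sub_distrib, hqsum]; linarith
  have hlog : ∀ ω ∈ S, Real.log (v ω / q ω) =
      Real.log P + ∑ i, (Real.log (bernWeight (x i) (ω i)) - Real.log (bernWeight p (ω i))) := by
    intro ω hω
    have h1 : Real.log (v ω) = ∑ i, Real.log (bernWeight (x i) (ω i)) :=
      Real.log_prod fun i _ => (hpos ω hω i).ne'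
    have h2 : Real.log (cubeWeight p ω) = ∑ i, Real.log (bernWeight p (ω i)) :=
      Real.log_prod fun i _ => (bernWeight_pos hp hp1 _).ne'
    rw [Real.log_div (hvpos ω hω).ne' (hqpos ω).ne', hq]
    simp only
    rw [Real.log_div (cubeWeight_pos hp hp1 ω).ne' hPpos.ne', h1, h2, Finset.sum_sub_distrib]
    ring
  -- The log ratio at a coordinate is affine in the bit, so its `q`-average depends only on the mean
  -- `x i`.
  have hcoord : ∀ i, ∑ ω ∈ S,
      q ω * (Real.log (bernWeight (x i) (ω i)) - Real.log (bernWeight p (ω i)))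
      = relEntropy p (x i) := by
    intro i
    have hsplit : ∀ ω, q ω * (Real.log (bernWeight (x i) (ω i)) - Real.log (bernWeight p (ω i)))
        = (q ω * boolVal (ω i)) * (Real.log (x i) - Real.log p)
          + (q ω * (1 - boolVal (ω i))) * (Real.log (1 - x i) - Real.log (1 - p)) := by
      intro ω
      cases ω i <;> simp [bernWeight, boolVal]
    simp_rw [hsplit]
    rw [Finset.sum_add_distrib, ← Finset.sum_mul, ← Finset.sum_mul, ← hxdef, ← hx1, relEntropy]
    congr 1
    · rcases eq_or_ne (x i) 0 with h | h
      · simp [h]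
      · rw [Real.log_div h hp.ne']
    · rcases eq_or_ne (1 - x i) 0 with h | h
      · simp [h]
      · rw [Real.log_div h (by linarith)]
  have hfin : Real.log P + ∑ i, relEntropy p (x i) ≤ 0 := by
    calc Real.log P + ∑ i, relEntropy p (x i)
        = ∑ ω ∈ S, q ω * Real.log (v ω / q ω) := by
          have h1 : ∑ ω ∈ S, q ω * Real.log (v ω / q ω) = ∑ ω ∈ S, q ω * (Real.log P +
              ∑ i, (Real.log (bernWeight (x i) (ω i)) - Real.log (bernWeight p (ω i)))) :=
            Finset.sum_congr rfl fun ω hω => by rw [hlog ω hω]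
          rw [h1]
          simp_rw [mul_add, Finset.mul_sum]
          rw [Finset.sum_add_distrib, ← Finset.sum_mul, hqsum, one_mul, Finset.sum_comm]
          simp_rw [hcoord]
      _ ≤ 0 := hgibbs
  rw [← Real.log_le_iff_le_exp hPpos]
  linarith

/-- Resampling one coordinate does not change an expectation. -/
lemma sum_cubeWeight_resample (p : ℝ) (i : ι) (F : (ι → Bool) → ℝ) :
    ∑ ω, cubeWeight p ω * F ω = ∑ ω, cubeWeight p ω *
      (p * F (Function.update ω i true) + (1 - p) * F (Function.update ω i false)) := by
  have hw : ∀ ω : ι → Bool, ∀ b, cubeWeight p (Function.update ω i b) =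
      bernWeight p b * ∏ j ∈ Finset.univ.erase i, bernWeight p (ω j) := by
    intro ω b
    rw [cubeWeight, ← Finset.mul_prod_erase _ _ (Finset.mem_univ i), Function.update_self]
    congr 1
    exact Finset.prod_congr rfl fun j hj => by
      rw [Function.update_of_ne (Finset.ne_of_mem_erase hj)]
  have key : ∀ g : (ι → Bool) → ℝ, ∑ ω, g ω =
      ∑ ω, (g (Function.update ω i true) + g (Function.update ω i false)) / 2 := by
    intro g
    -- Flipping coordinate `i` is an involution of the cube, so a sum may be averaged over the two
    -- values of that coordinate.
    have hflip : ∑ ω : ι → Bool, g (Function.update ω i (!(ω i))) = ∑ ω, g ω := by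
      refine Finset.sum_nbij' (fun ω => Function.update ω i (!(ω i)))
        (fun ω => Function.update ω i (!(ω i))) (by simp) (by simp) ?_ ?_ ?_
      · intro ω _; simp
      · intro ω _; simp
      · intro ω _; rfl
    have h2 : ∀ ω : ι → Bool, g (Function.update ω i true) + g (Function.update ω i false)
        = g ω + g (Function.update ω i (!(ω i))) := by
      intro ω
      cases hb : ω i
      · have : Function.update ω i false = ω := by rw [← hb]; simp
        rw [this, add_comm]; simp
      · have : Function.update ω i true = ω := by rw [← hb]; simp
        rw [this]; simp
    simp_rw [h2]
    rw [← Finset.sum_div, Finset.sum_add_distrib, hflip]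
    ring
  rw [key, key (fun ω => cubeWeight p ω * (p * F (Function.update ω i true) +
    (1 - p) * F (Function.update ω i false)))]
  refine Finset.sum_congr rfl fun ω _ => ?_
  simp only [hw, Function.update_idem, bernWeight, if_true, Bool.false_eq_true, if_false]
  ring

end Cube

/-! ### Convex distance concentration on the cube -/

/-- The one-dimensional optimisation behind the induction for the convex distance. -/
lemma exists_interpolation {u : ℝ} (hu : 0 ≤ u) :
    ∃ l ∈ Set.Icc (0 : ℝ) 1, Real.exp ((1 - l) * u + l ^ 2 / 16) ≤ 2 - Real.exp (-u) := by
  -- The exponent is minimal at l = 8u, which is admissible exactly when u ≤ 1/8; beyond that the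
  -- endpoint l = 1 is taken.
  by_cases h : u ≤ 1 / 8
  · refine ⟨8 * u, ⟨by linarith, by linarith⟩, ?_⟩
    have h1 : (1 - 8 * u) * u + (8 * u) ^ 2 / 16 = u - 4 * u ^ 2 := by ring
    rw [h1]
    have h2 : Real.exp (u - 4 * u ^ 2) ≤ 1 + (u - 4 * u ^ 2) + (u - 4 * u ^ 2) ^ 2 := by
      have := Real.abs_exp_sub_one_sub_id_le (x := u - 4 * u ^ 2)
        (abs_le.2 ⟨by nlinarith, by nlinarith⟩)
      linarith [(abs_le.1 this).2]
    have h3 : Real.exp (-u) ≤ 1 + (-u) + (-u) ^ 2 := by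
      have := Real.abs_exp_sub_one_sub_id_le (x := -u) (abs_le.2 ⟨by linarith, by linarith⟩)
      linarith [(abs_le.1 this).2]
    have h4 : (u - 4 * u ^ 2) ^ 2 ≤ u ^ 2 :=
      pow_le_pow_left₀ (by nlinarith) (by nlinarith) 2
    nlinarith [sq_nonneg u]
  · push Not at h
    refine ⟨1, ⟨zero_le_one, le_rfl⟩, ?_⟩
    have h2 : Real.exp ((1 - 1) * u + 1 ^ 2 / 16) ≤ 1 + 1 / 16 + (1 / 16) ^ 2 := by
      have := Real.abs_exp_sub_one_sub_id_le (x := 1 / 16) (by rw [abs_of_pos] <;> norm_num)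
      have e : ((1 : ℝ) - 1) * u + 1 ^ 2 / 16 = 1 / 16 := by ring
      rw [e]
      linarith [(abs_le.1 this).2]
    have h3 : Real.exp (-u) ≤ Real.exp (-(1 / 8)) := Real.exp_le_exp.2 (by linarith)
    have h4 : Real.exp (-(1 / 8)) ≤ 1 + (-(1 / 8)) + (-(1 / 8)) ^ 2 := by
      have := Real.abs_exp_sub_one_sub_id_le (x := -(1 / 8))
        (by rw [abs_neg, abs_of_pos] <;> norm_num)
      linarith [(abs_le.1 this).2]
    norm_num at h2 h4 ⊢
    linarith

/-- The points of the cube as real vectors. -/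
noncomputable def cubePoint {ι : Type*} (ω : ι → Bool) : ι → ℝ := fun i => boolVal (ω i)

/-- The square of the Euclidean distance. -/
noncomputable def sqDist {ι : Type*} [Fintype ι] (x y : ι → ℝ) : ℝ := ∑ i, (x i - y i) ^ 2

lemma sqDist_convex {ι : Type*} [Fintype ι] (x y z : ι → ℝ) {l : ℝ} (h0 : 0 ≤ l) (h1 : l ≤ 1) :
    sqDist x (l • y + (1 - l) • z) ≤ l * sqDist x y + (1 - l) * sqDist x z := by
  unfold sqDist
  rw [Finset.mul_sum, Finset.mul_sum, ← Finset.sum_add_distrib]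
  refine Finset.sum_le_sum fun i _ => ?_
  simp only [Pi.add_apply, Pi.smul_apply, smul_eq_mul]
  nlinarith [mul_nonneg (mul_nonneg h0 (sub_nonneg.2 h1)) (sq_nonneg (y i - z i))]

lemma sqDist_cons {n : ℕ} (a b : ℝ) (x y : Fin n → ℝ) :
    sqDist (Fin.cons a x : Fin (n + 1) → ℝ) (Fin.cons b y) = (a - b) ^ 2 + sqDist x y := by
  simp [sqDist, Fin.sum_univ_succ]

lemma cubePoint_cons {n : ℕ} (b : Bool) (ω : Fin n → Bool) :
    cubePoint (Fin.cons b ω : Fin (n + 1) → Bool) = Fin.cons (boolVal b) (cubePoint ω) := by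
  funext i
  refine Fin.cases ?_ (fun j => ?_) i <;> simp [cubePoint]

lemma cubeWeight_cons {n : ℕ} (p : ℝ) (b : Bool) (ω : Fin n → Bool) :
    cubeWeight p (Fin.cons b ω : Fin (n + 1) → Bool) = bernWeight p b * cubeWeight p ω := by
  simp [cubeWeight, Fin.prod_univ_succ]

lemma sum_cube_succ {n : ℕ} (a : Bool) (F : (Fin (n + 1) → Bool) → ℝ) :
    ∑ ω, F ω = ∑ ω, F (Fin.cons a ω) + ∑ ω, F (Fin.cons (!a) ω) := by
  rw [← (Fin.consEquiv fun _ : Fin (n + 1) => Bool).sum_comp, Fintype.sum_prod_type]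
  cases a <;> simp [Fin.consEquiv, add_comm]

/-- The section of a subset of the cube over a value of the first coordinate. -/
def cubeSection {n : ℕ} (S : Finset (Fin (n + 1) → Bool)) (b : Bool) : Finset (Fin n → Bool) :=
  Finset.univ.filter fun ω => (Fin.cons b ω : Fin (n + 1) → Bool) ∈ S

lemma cubeProb_succ {n : ℕ} (p : ℝ) (S : Finset (Fin (n + 1) → Bool)) (a : Bool) :
    cubeProb p S = bernWeight p a * cubeProb p (cubeSection S a)
      + bernWeight p (!a) * cubeProb p (cubeSection S (!a)) := by
  have h : ∀ {m : ℕ} (T : Finset (Fin m → Bool)),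
      cubeProb p T = ∑ ω, if ω ∈ T then cubeWeight p ω else 0 := by
    intro m T
    simp [cubeProb]
  rw [h, sum_cube_succ a, h, h, Finset.mul_sum, Finset.mul_sum]
  simp [cubeSection, cubeWeight_cons]

/-- The set of admissible `z` is convex, being the preimage of a convex set under an affine map, and
it contains the points of the section. -/
lemma cons_mem_convexHull {n : ℕ} (S : Finset (Fin (n + 1) → Bool)) (b : Bool) {z : Fin n → ℝ}
    (hz : z ∈ convexHull ℝ (cubePoint '' (cubeSection S b : Set (Fin n → Bool)))) :
    (Fin.cons (boolVal b) z : Fin (n + 1) → ℝ) ∈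
      convexHull ℝ (cubePoint '' (S : Set (Fin (n + 1) → Bool))) := by
  have hsub : convexHull ℝ (cubePoint '' (cubeSection S b : Set (Fin n → Bool))) ⊆
      {z | (Fin.cons (boolVal b) z : Fin (n + 1) → ℝ) ∈
        convexHull ℝ (cubePoint '' (S : Set (Fin (n + 1) → Bool)))} := by
    refine convexHull_min ?_ ?_
    · rintro _ ⟨ω, hω, rfl⟩
      refine subset_convexHull ℝ _ ⟨Fin.cons b ω, ?_, cubePoint_cons b ω⟩
      simpa [cubeSection] using hω
    · intro x hx y hy s t hs ht hst
      have := convex_convexHull ℝ _ hx hy hs ht hst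
      have e : (Fin.cons (boolVal b) (s • x + t • y) : Fin (n + 1) → ℝ) =
          s • (Fin.cons (boolVal b) x : Fin (n + 1) → ℝ) + t • Fin.cons (boolVal b) y := by
        funext i
        refine Fin.cases ?_ (fun j => ?_) i
        · simp [← add_mul, hst]
        · simp
      simpa [e] using this
  exact hsub hz

/-- Talagrand's inequality for the Euclidean distance from a point of the cube to the convex hull of
a set of points of the cube. -/
theorem exists_convexHull_sqDist_fin {p : ℝ} (hp : 0 < p) (hp1 : p < 1) (n : ℕ)
    (S : Finset (Fin n → Bool)) (hS : S.Nonempty) :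
    ∃ z : (Fin n → Bool) → (Fin n → ℝ),
      (∀ ω, z ω ∈ convexHull ℝ (cubePoint '' (S : Set (Fin n → Bool)))) ∧
      cubeProb p S * ∑ ω, cubeWeight p ω * Real.exp (sqDist (cubePoint ω) (z ω) / 16) ≤ 1 := by
  induction n with
  | zero =>
    obtain ⟨ω₀, hω₀⟩ := hS
    refine ⟨fun _ => cubePoint ω₀, fun ω => subset_convexHull ℝ _ ⟨ω₀, hω₀, rfl⟩, ?_⟩
    have h : ∑ ω : Fin 0 → Bool, cubeWeight p ω *
        Real.exp (sqDist (cubePoint ω) (cubePoint ω₀) / 16) = 1 := by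
      simp [sqDist, cubeWeight]
    rw [h, mul_one]
    exact cubeProb_le_one hp hp1 S
  | succ n ih =>
    -- `a` labels the heavier section. Points over `a` use that section alone; points over `!a`
    -- interpolate between both sections.
    obtain ⟨a, ha⟩ : ∃ a, cubeProb p (cubeSection S (!a)) ≤ cubeProb p (cubeSection S a) := by
      rcases le_total (cubeProb p (cubeSection S true)) (cubeProb p (cubeSection S false)) with h | h
      · exact ⟨false, h⟩
      · exact ⟨true, h⟩
    set Sa := cubeSection S a
    set Sb := cubeSection S (!a)
    have hPS := cubeProb_succ p S a
    have hma := bernWeight_pos hp hp1 a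
    have hmb := bernWeight_pos hp hp1 (!a)
    have hmab : bernWeight p a + bernWeight p (!a) = 1 := by cases a <;> simp [bernWeight]
    have hSpos := cubeProb_pos hp hp1 hS
    have hPb0 := cubeProb_nonneg hp hp1 Sb
    have hPa : 0 < cubeProb p Sa := by
      by_contra hcon
      push Not at hcon
      change cubeProb p Sb ≤ cubeProb p Sa at ha
      have h1 : cubeProb p Sb = 0 := by linarith
      have h2 : cubeProb p Sa = 0 := by linarith
      change cubeProb p S = bernWeight p a * cubeProb p Sa + bernWeight p (!a) * cubeProb p Sb at hPS
      rw [h1, h2] at hPS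
      simp at hPS
      linarith
    have hSa : Sa.Nonempty := by
      rw [Finset.nonempty_iff_ne_empty]
      intro h
      rw [h] at hPa
      simp [cubeProb] at hPa
    have hval : (boolVal (!a) - boolVal a) ^ 2 = 1 := by cases a <;> simp [boolVal]
    obtain ⟨za, hza, hEa⟩ := ih Sa hSa
    set Pa := cubeProb p Sa
    set Pb := cubeProb p Sb
    set Ea := ∑ ω, cubeWeight p ω * Real.exp (sqDist (cubePoint ω) (za ω) / 16) with hEadef
    have hr1 : Pb / Pa ≤ 1 := (div_le_one hPa).2 ha
    have hr0 : 0 ≤ Pb / Pa := div_nonneg hPb0 hPa.le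
    have hEa' : Ea ≤ 1 / Pa := by rw [le_div_iff₀ hPa]; linarith
    -- it suffices to handle the points of the smaller section
    suffices hmain : ∃ zb : (Fin n → Bool) → (Fin (n + 1) → ℝ),
        (∀ ω, zb ω ∈ convexHull ℝ (cubePoint '' (S : Set (Fin (n + 1) → Bool)))) ∧
        ∑ ω, cubeWeight p ω * Real.exp
          (sqDist (cubePoint (Fin.cons (!a) ω : Fin (n + 1) → Bool)) (zb ω) / 16) ≤
          (2 - Pb / Pa) / Pa by
      obtain ⟨zb, hzb, hEb⟩ := hmain
      refine ⟨fun ω => if ω 0 = a then Fin.cons (boolVal a) (za (Fin.tail ω))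
        else zb (Fin.tail ω), fun ω => ?_, ?_⟩
      · by_cases h : ω 0 = a
        · simp only [h, if_true]
          exact cons_mem_convexHull S a (hza _)
        · simp only [h, if_false]
          exact hzb _
      · rw [sum_cube_succ a]
        have hne : ((!a) = a) = False := by cases a <;> simp
        simp only [Fin.cons_zero, if_true, Fin.tail_cons, hne, if_false, cubeWeight_cons]
        have e1 : ∑ ω : Fin n → Bool, bernWeight p a * cubeWeight p ω *
            Real.exp (sqDist (cubePoint (Fin.cons a ω : Fin (n + 1) → Bool))
              (Fin.cons (boolVal a) (za ω)) / 16) = bernWeight p a * Ea := by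
          rw [hEadef, Finset.mul_sum]
          refine Finset.sum_congr rfl fun ω _ => ?_
          rw [cubePoint_cons, sqDist_cons, sub_self, mul_assoc]
          simp
        rw [e1]
        simp only [mul_assoc]
        rw [← Finset.mul_sum, hPS]
        have h1 : bernWeight p a * Ea + bernWeight p (!a) * ∑ ω : Fin n → Bool, cubeWeight p ω *
            Real.exp (sqDist (cubePoint (Fin.cons (!a) ω : Fin (n + 1) → Bool)) (zb ω) / 16)
            ≤ (bernWeight p a + bernWeight p (!a) * (2 - Pb / Pa)) / Pa := by
          calc _ ≤ bernWeight p a * (1 / Pa) + bernWeight p (!a) * ((2 - Pb / Pa) / Pa) := by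
                gcongr
            _ = _ := by field_simp
        have h2 : bernWeight p a * Pa + bernWeight p (!a) * Pb
            = Pa * (bernWeight p a + bernWeight p (!a) * (Pb / Pa)) := by
          field_simp
        calc _ ≤ (bernWeight p a * Pa + bernWeight p (!a) * Pb) *
              ((bernWeight p a + bernWeight p (!a) * (2 - Pb / Pa)) / Pa) := by
              refine mul_le_mul_of_nonneg_left h1 ?_
              positivity
          _ = (bernWeight p a + bernWeight p (!a) * (Pb / Pa)) *
              (bernWeight p a + bernWeight p (!a) * (2 - Pb / Pa)) := by
              rw [h2]; field_simp
          _ ≤ 1 := by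
              -- With m the mass of the lighter value and r = Pb / Pa, the product is (1 - m(1 -
              -- r))(1 + m(1 - r)) ≤ 1.
              have e : bernWeight p a = 1 - bernWeight p (!a) := by linarith
              rw [e]
              nlinarith [sq_nonneg (bernWeight p (!a) * (1 - Pb / Pa))]
    -- If the lighter section is empty there is nothing to interpolate with: one moves wholly to the
    -- heavier section, at the cost of a factor exp(1/16) ≤ 2.
    rcases Finset.eq_empty_or_nonempty Sb with hSb | hSb
    · have hPb : Pb = 0 := by simp [Pb, hSb, cubeProb]
      refine ⟨fun ω => Fin.cons (boolVal a) (za ω), fun ω => cons_mem_convexHull S a (hza _), ?_⟩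
      have e : ∀ ω : Fin n → Bool, cubeWeight p ω * Real.exp
          (sqDist (cubePoint (Fin.cons (!a) ω : Fin (n + 1) → Bool))
            (Fin.cons (boolVal a) (za ω)) / 16) =
          Real.exp (1 / 16) * (cubeWeight p ω * Real.exp (sqDist (cubePoint ω) (za ω) / 16)) := by
        intro ω
        rw [cubePoint_cons, sqDist_cons, hval, add_div, Real.exp_add]
        ring
      simp_rw [e]
      rw [← Finset.mul_sum, hPb]
      have h16 : Real.exp (1 / 16) ≤ 2 := by
        have := Real.abs_exp_sub_one_sub_id_le (x := 1 / 16) (by rw [abs_of_pos] <;> norm_num)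
        have := (abs_le.1 this).2
        norm_num at this ⊢
        linarith
      calc Real.exp (1 / 16) * Ea ≤ 2 * (1 / Pa) := by
            refine mul_le_mul h16 hEa' ?_ (by norm_num)
            exact Finset.sum_nonneg fun ω _ =>
              mul_nonneg (cubeWeight_pos hp hp1 ω).le (Real.exp_pos _).le
        _ = _ := by simp; ring
    · have hPbpos : 0 < Pb := cubeProb_pos hp hp1 hSb
      obtain ⟨zb, hzb, hEb⟩ := ih Sb hSb
      have hu : 0 ≤ Real.log (Pa / Pb) := Real.log_nonneg ((one_le_div hPbpos).2 ha)
      obtain ⟨l, ⟨hl0, hl1⟩, hl⟩ := exists_interpolation hu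
      refine ⟨fun ω => l • (Fin.cons (boolVal a) (za ω) : Fin (n + 1) → ℝ) +
        (1 - l) • Fin.cons (boolVal (!a)) (zb ω), fun ω => ?_, ?_⟩
      · exact convex_convexHull ℝ _ (cons_mem_convexHull S a (hza ω))
          (cons_mem_convexHull S (!a) (hzb ω)) hl0 (by linarith) (by ring)
      · have hdist : ∀ ω : Fin n → Bool,
            sqDist (cubePoint (Fin.cons (!a) ω : Fin (n + 1) → Bool))
              (l • (Fin.cons (boolVal a) (za ω) : Fin (n + 1) → ℝ) +
                (1 - l) • Fin.cons (boolVal (!a)) (zb ω)) ≤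
            l ^ 2 + (l * sqDist (cubePoint ω) (za ω) + (1 - l) * sqDist (cubePoint ω) (zb ω)) := by
          intro ω
          have e : l • (Fin.cons (boolVal a) (za ω) : Fin (n + 1) → ℝ) +
                (1 - l) • (Fin.cons (boolVal (!a)) (zb ω) : Fin (n + 1) → ℝ) =
              Fin.cons (l * boolVal a + (1 - l) * boolVal (!a)) (l • za ω + (1 - l) • zb ω) := by
            funext i
            refine Fin.cases ?_ (fun j => ?_) i <;> simp
          rw [e, cubePoint_cons, sqDist_cons]
          have h1 := sqDist_convex (cubePoint ω) (za ω) (zb ω) hl0 hl1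
          have h2 : (boolVal (!a) - (l * boolVal a + (1 - l) * boolVal (!a))) ^ 2 = l ^ 2 := by
            calc _ = l ^ 2 * (boolVal (!a) - boolVal a) ^ 2 := by ring
              _ = _ := by rw [hval, mul_one]
          rw [h2]
          linarith
        set c := (1 - l) * Real.log (Pa / Pb) + l ^ 2 / 16 with hc
        have hterm : ∀ ω : Fin n → Bool,
            Real.exp (sqDist (cubePoint (Fin.cons (!a) ω : Fin (n + 1) → Bool))
              (l • (Fin.cons (boolVal a) (za ω) : Fin (n + 1) → ℝ) +
                (1 - l) • Fin.cons (boolVal (!a)) (zb ω)) / 16) ≤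
            Real.exp c / Pa * (l * (Pa * Real.exp (sqDist (cubePoint ω) (za ω) / 16)) +
              (1 - l) * (Pb * Real.exp (sqDist (cubePoint ω) (zb ω) / 16))) := by
          intro ω
          set A := sqDist (cubePoint ω) (za ω) / 16
          set B := sqDist (cubePoint ω) (zb ω) / 16
          -- Shifting the exponents by log Pa and log Pb before using convexity normalises the two
          -- induction hypotheses: both weighted sums become at most 1.
          have hconv : Real.exp (l * (Real.log Pa + A) + (1 - l) * (Real.log Pb + B)) ≤
              l * (Pa * Real.exp A) + (1 - l) * (Pb * Real.exp B) := by
            have := convexOn_exp.2 (Set.mem_univ (Real.log Pa + A)) (Set.mem_univ (Real.log Pb + B))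
              hl0 (sub_nonneg.2 hl1) (by ring)
            simpa [Real.exp_add, Real.exp_log hPa, Real.exp_log hPbpos] using this
          have hexp : Real.exp c / Pa *
              Real.exp (l * (Real.log Pa + A) + (1 - l) * (Real.log Pb + B)) =
              Real.exp (l ^ 2 / 16 + (l * A + (1 - l) * B)) := by
            have hPae : Pa = Real.exp (Real.log Pa) := (Real.exp_log hPa).symm
            have hdiv : Real.exp c / Pa = Real.exp (c - Real.log Pa) := by
              rw [Real.exp_sub, Real.exp_log hPa]
            rw [hdiv, ← Real.exp_add]
            congr 1
            rw [hc, Real.log_div hPa.ne' hPbpos.ne']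
            ring
          calc _ ≤ Real.exp (l ^ 2 / 16 + (l * A + (1 - l) * B)) := by
                refine Real.exp_le_exp.2 ?_
                have := hdist ω
                simp only [A, B]
                linarith
            _ = _ := hexp.symm
            _ ≤ _ := mul_le_mul_of_nonneg_left hconv (by positivity)
        have hexpc : Real.exp c ≤ 2 - Pb / Pa := by
          refine hl.trans_eq ?_
          rw [← Real.log_inv, inv_div, Real.exp_log (div_pos hPbpos hPa)]
        calc _ ≤ ∑ ω : Fin n → Bool, cubeWeight p ω *
              (Real.exp c / Pa * (l * (Pa * Real.exp (sqDist (cubePoint ω) (za ω) / 16)) +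
              (1 - l) * (Pb * Real.exp (sqDist (cubePoint ω) (zb ω) / 16)))) :=
              Finset.sum_le_sum fun ω _ =>
                mul_le_mul_of_nonneg_left (hterm ω) (cubeWeight_pos hp hp1 ω).le
          _ = Real.exp c / Pa * (l * (Pa * Ea) + (1 - l) * (Pb *
              ∑ ω, cubeWeight p ω * Real.exp (sqDist (cubePoint ω) (zb ω) / 16))) := by
              rw [hEadef]
              simp only [Finset.mul_sum]
              rw [← Finset.sum_add_distrib, Finset.mul_sum]
              exact Finset.sum_congr rfl fun ω _ => by ring
          _ ≤ Real.exp c / Pa * (l * 1 + (1 - l) * 1) := by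
              have := sub_nonneg.2 hl1
              gcongr
          _ = Real.exp c / Pa := by ring
          _ ≤ _ := by gcongr

/-- Talagrand's inequality for the cube over an arbitrary finite index set. -/
theorem exists_convexHull_sqDist {ι : Type*} [Fintype ι] [DecidableEq ι] {p : ℝ} (hp : 0 < p)
    (hp1 : p < 1) (S : Finset (ι → Bool)) (hS : S.Nonempty) :
    ∃ z : (ι → Bool) → (ι → ℝ),
      (∀ ω, z ω ∈ convexHull ℝ (cubePoint '' (S : Set (ι → Bool)))) ∧
      cubeProb p S * ∑ ω, cubeWeight p ω * Real.exp (sqDist (cubePoint ω) (z ω) / 16) ≤ 1 := by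
  let e := Fintype.equivFin ι
  let E : (Fin (Fintype.card ι) → Bool) ≃ (ι → Bool) := Equiv.arrowCongr e.symm (Equiv.refl Bool)
  have hE : ∀ ω i, E ω i = ω (e i) := fun ω i => rfl
  have hw : ∀ ω, cubeWeight p (E ω) = cubeWeight p ω := by
    intro ω
    simp only [cubeWeight, hE]
    exact e.prod_comp fun i => bernWeight p (ω i)
  let S' := S.map E.symm.toEmbedding
  have hS' : S'.Nonempty := hS.map
  obtain ⟨z, hz, hbound⟩ := exists_convexHull_sqDist_fin hp hp1 _ S' hS'
  refine ⟨fun ω i => z (E.symm ω) (e i), fun ω => ?_, ?_⟩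
  · have hsub : convexHull ℝ (cubePoint '' (S' : Set (Fin (Fintype.card ι) → Bool))) ⊆
        {y | (fun i => y (e i)) ∈ convexHull ℝ (cubePoint '' (S : Set (ι → Bool)))} := by
      refine convexHull_min ?_ ?_
      · rintro _ ⟨ω', hω', rfl⟩
        refine subset_convexHull ℝ _ ⟨E ω', ?_, rfl⟩
        simpa [S'] using hω'
      · intro x hx y hy s t hs ht hst
        exact convex_convexHull ℝ _ hx hy hs ht hst
    exact hsub (hz _)
  · have h1 : cubeProb p S = cubeProb p S' := by
      simp only [cubeProb, S', Finset.sum_map]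
      refine Finset.sum_congr rfl fun ω _ => ?_
      rw [← hw]
      simp
    have h2 : ∑ ω : ι → Bool, cubeWeight p ω *
        Real.exp (sqDist (cubePoint ω) (fun i => z (E.symm ω) (e i)) / 16) =
        ∑ ω, cubeWeight p ω * Real.exp (sqDist (cubePoint ω) (z ω) / 16) := by
      rw [← E.sum_comp]
      refine Finset.sum_congr rfl fun ω _ => ?_
      rw [hw, E.symm_apply_apply]
      congr 3
      exact e.sum_comp fun i => (cubePoint ω i - z ω i) ^ 2
    rw [h1, h2]
    exact hbound

/-- All points outside a set of small measure are close to the convex hull of a set of measure at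
least one half. -/
theorem cubeProb_far_from_convexHull {ι : Type*} [Fintype ι] [DecidableEq ι] {p : ℝ} (hp : 0 < p)
    (hp1 : p < 1) (S : Finset (ι → Bool)) (hS : 1 / 2 ≤ cubeProb p S) (h : ℝ) :
    ∃ B : Finset (ι → Bool), cubeProb p B ≤ 2 * Real.exp (-h) ∧
      ∀ ω ∉ B, ∃ z ∈ convexHull ℝ (cubePoint '' (S : Set (ι → Bool))),
        sqDist (cubePoint ω) z ≤ 16 * h := by
  have hne : S.Nonempty := by
    rw [Finset.nonempty_iff_ne_empty]
    rintro rfl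
    simp [cubeProb] at hS
    linarith
  obtain ⟨z, hz, hbound⟩ := exists_convexHull_sqDist hp hp1 S hne
  set T := ∑ ω, cubeWeight p ω * Real.exp (sqDist (cubePoint ω) (z ω) / 16) with hT
  have hT0 : 0 ≤ T := Finset.sum_nonneg fun ω _ =>
    mul_nonneg (cubeWeight_pos hp hp1 ω).le (Real.exp_pos _).le
  have hT2 : T ≤ 2 := by nlinarith
  refine ⟨Finset.univ.filter fun ω => 16 * h < sqDist (cubePoint ω) (z ω), ?_, fun ω hω =>
    ⟨z ω, hz ω, by simpa using hω⟩⟩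
  rw [Real.exp_neg, ← div_eq_mul_inv, le_div_iff₀ (Real.exp_pos h)]
  refine le_trans ?_ hT2
  rw [cubeProb, Finset.sum_mul]
  refine (Finset.sum_le_sum fun ω hω => ?_).trans (Finset.sum_le_sum_of_subset_of_nonneg
    (Finset.filter_subset _ _) fun ω _ _ =>
      mul_nonneg (cubeWeight_pos hp hp1 ω).le (Real.exp_pos _).le)
  refine mul_le_mul_of_nonneg_left (Real.exp_le_exp.2 ?_) (cubeWeight_pos hp hp1 ω).le
  have := (Finset.mem_filter.1 hω).2
  linarith

/-! ### Random graphs as points of the cube -/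

/-- The pairs of vertices. -/
abbrev Edge (N : ℕ) := {e : Fin N × Fin N // e.1 < e.2}

/-- The symmetric matrix with zero diagonal and given entries above the diagonal. -/
noncomputable def symMat {N : ℕ} (x : Edge N → ℝ) : Matrix (Fin N) (Fin N) ℝ :=
  fun i j => if h : i < j then x ⟨(i, j), h⟩ else if h : j < i then x ⟨(j, i), h⟩ else 0

/-- The graph with given edge indicators. -/
def cubeGraph {N : ℕ} (ω : Edge N → Bool) : SimpleGraph (Fin N) where
  Adj i j := (∃ h : i < j, ω ⟨(i, j), h⟩ = true) ∨ ∃ h : j < i, ω ⟨(j, i), h⟩ = true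
  symm := ⟨fun _ _ h => h.symm⟩
  loopless := ⟨fun i h => by rcases h with ⟨h, _⟩ | ⟨h, _⟩ <;> exact lt_irrefl _ h⟩

lemma cubeGraph_surjective {N : ℕ} (G : SimpleGraph (Fin N)) : ∃ ω, cubeGraph ω = G := by
  classical
  refine ⟨fun e => decide (G.Adj e.1.1 e.1.2), ?_⟩
  ext i j
  simp only [cubeGraph, decide_eq_true_eq, exists_prop]
  constructor
  · rintro (h | h)
    · exact h.2
    · exact h.2.symm
  · intro h
    rcases lt_or_gt_of_ne h.ne with h' | h'
    · exact Or.inl ⟨h', h⟩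
    · exact Or.inr ⟨h', h.symm⟩

lemma symMat_comm {N : ℕ} (x : Edge N → ℝ) (i j : Fin N) : symMat x i j = symMat x j i := by
  unfold symMat
  rcases lt_trichotomy i j with h | h | h
  · simp [h, h.not_gt]
  · simp [h]
  · simp [h, h.not_gt]

lemma symMat_isSymm {N : ℕ} (x : Edge N → ℝ) : (symMat x).IsSymm := by
  ext i j
  exact symMat_comm x j i

lemma symMat_self {N : ℕ} (x : Edge N → ℝ) (i : Fin N) : symMat x i i = 0 := by
  simp [symMat]

lemma symMat_edge {N : ℕ} (x : Edge N → ℝ) (e : Edge N) : symMat x e.1.1 e.1.2 = x e := by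
  have h : e.1.1 < e.1.2 := e.2
  simp [symMat, h]

lemma symMat_mem {N : ℕ} {x : Edge N → ℝ} (hx : ∀ e, x e ∈ Set.Icc (0 : ℝ) 1) :
    symMat x ∈ weightedGraphs N := by
  refine ⟨symMat_isSymm x, fun i j => ?_, symMat_self x⟩
  unfold symMat
  split_ifs with h1 h2
  · exact hx _
  · exact hx _
  · simp

lemma symMat_sum {N : ℕ} {α : Type*} (s : Finset α) (w : α → ℝ) (x : α → Edge N → ℝ) :
    symMat (fun e => ∑ a ∈ s, w a * x a e) = ∑ a ∈ s, w a • symMat (x a) := by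
  ext i j
  simp only [Matrix.sum_apply, Matrix.smul_apply, smul_eq_mul]
  unfold symMat
  split_ifs <;> simp

lemma homGraph_cubeGraph {n N : ℕ} (H : SimpleGraph (Fin n)) (ω : Edge N → Bool) :
    homGraph H (cubeGraph ω) = homMatrix H (symMat (cubePoint ω)) := by
  classical
  unfold homGraph
  congr 1
  ext i j
  rw [SimpleGraph.adjMatrix_apply]
  unfold symMat cubeGraph cubePoint boolVal
  rcases lt_trichotomy i j with h | h | h
  · simp [h, h.not_gt]
  · simp [h]
  · simp [h, h.not_gt]

lemma relEntropyMatrix_symMat {N : ℕ} (p : ℝ) (x : Edge N → ℝ) :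
    relEntropyMatrix p (symMat x) = ∑ e, relEntropy p (x e) := by
  unfold relEntropyMatrix
  rw [← Finset.sum_subtype_eq_sum_filter]
  simp only [Finset.subtype_univ]
  exact Finset.sum_congr rfl fun e _ => by rw [symMat_edge]

lemma ncard_edgeSet_cubeGraph {N : ℕ} (ω : Edge N → Bool) :
    (cubeGraph ω).edgeSet.ncard = (Finset.univ.filter fun e => ω e = true).card := by
  have hinj : Function.Injective fun e : Edge N => s(e.1.1, e.1.2) := by
    rintro ⟨⟨a, b⟩, h⟩ ⟨⟨c, d⟩, h'⟩ heq
    simp only [Sym2.eq_iff] at heq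
    rcases heq with ⟨h1, h2⟩ | ⟨h1, h2⟩
    · simp [h1, h2]
    · simp only at h h' h1 h2
      subst h1 h2
      exact absurd h h'.not_gt
  have : (cubeGraph ω).edgeSet =
      ((Finset.univ.filter fun e => ω e = true).map ⟨_, hinj⟩ : Finset (Sym2 (Fin N))) := by
    ext e
    induction e using Sym2.inductionOn with
    | hf i j =>
      simp only [SimpleGraph.mem_edgeSet, cubeGraph, Finset.coe_map, Function.Embedding.coeFn_mk,
        Finset.coe_filter, Finset.mem_univ, true_and, Set.mem_image, Set.mem_ofPred_eq]
      constructor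
      · rintro (⟨h, hω⟩ | ⟨h, hω⟩)
        · exact ⟨_, hω, rfl⟩
        · exact ⟨_, hω, Sym2.eq_swap⟩
      · rintro ⟨⟨⟨a, b⟩, h⟩, hω, heq⟩
        rcases Sym2.eq_iff.1 heq with ⟨h1, h2⟩ | ⟨h1, h2⟩
        · subst h1 h2; exact Or.inl ⟨h, hω⟩
        · subst h1 h2; exact Or.inr ⟨h, hω⟩
  rw [this, Set.ncard_coe_finset, Finset.card_map]

lemma card_edge (N : ℕ) : Fintype.card (Edge N) = N.choose 2 := by
  classical
  have h := ncard_edgeSet_cubeGraph (N := N) fun _ => true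
  have htop : cubeGraph (N := N) (fun _ => true) = ⊤ := by
    ext i j
    simp only [cubeGraph, exists_prop, and_true, SimpleGraph.top_adj]
    exact lt_or_lt_iff_ne
  rw [htop, ← SimpleGraph.coe_edgeFinset, Set.ncard_coe_finset,
    SimpleGraph.card_edgeFinset_top_eq_card_choose_two] at h
  simpa using h.symm

lemma binomialRandom_cubeGraph {N : ℕ} (q : unitInterval) (ω : Edge N → Bool) :
    SimpleGraph.binomialRandom (Fin N) q {cubeGraph ω} = ENNReal.ofReal (cubeWeight (q : ℝ) ω) := by
  rw [SimpleGraph.binomialRandom_singleton, ncard_edgeSet_cubeGraph]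
  have hw : cubeWeight (q : ℝ) ω = (q : ℝ) ^ (Finset.univ.filter fun e => ω e = true).card *
      (1 - q : ℝ) ^ ((N.choose 2) - (Finset.univ.filter fun e => ω e = true).card) := by
    have hc : (Finset.univ.filter fun e => ¬ ω e = true).card =
        N.choose 2 - (Finset.univ.filter fun e => ω e = true).card := by
      have := Finset.card_filter_add_card_filter_not (s := (Finset.univ : Finset (Edge N)))
        (fun e => ω e = true)
      rw [Finset.card_univ, card_edge] at this
      omega
    unfold cubeWeight bernWeight
    rw [Finset.prod_ite, Finset.prod_const, Finset.prod_const, hc]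
  have h1 : ((unitInterval.toNNReal q : NNReal) : ENNReal) = ENNReal.ofReal (q : ℝ) := by
    rw [← ENNReal.ofReal_coe_nnreal]; rfl
  have h2 : ((unitInterval.toNNReal (unitInterval.symm q) : NNReal) : ENNReal)
      = ENNReal.ofReal (1 - q : ℝ) := by
    rw [← ENNReal.ofReal_coe_nnreal]; rfl
  have hq0 : (0 : ℝ) ≤ q := q.2.1
  have hq1 : (0 : ℝ) ≤ 1 - q := by linarith [q.2.2]
  rw [hw, h1, h2, ENNReal.ofReal_mul (by positivity), ENNReal.ofReal_pow hq0,
    ENNReal.ofReal_pow hq1]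
  simp

open Classical in
lemma binomialRandom_le {N : ℕ} (q : unitInterval) (hq : 0 < (q : ℝ)) (hq1 : (q : ℝ) < 1)
    (S : Set (SimpleGraph (Fin N))) :
    SimpleGraph.binomialRandom (Fin N) q S ≤
      ENNReal.ofReal (cubeProb (q : ℝ) (Finset.univ.filter fun ω => cubeGraph ω ∈ S)) := by
  have hsub : S ⊆ ⋃ ω ∈ (Finset.univ.filter fun ω : Edge N → Bool => cubeGraph ω ∈ S),
      {cubeGraph ω} := by
    intro G hG
    obtain ⟨ω, rfl⟩ := cubeGraph_surjective G
    simp only [Set.mem_iUnion]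
    exact ⟨ω, by simpa using hG, rfl⟩
  refine (measure_mono hsub).trans ((measure_biUnion_finset_le _ _).trans_eq ?_)
  rw [cubeProb, ENNReal.ofReal_sum_of_nonneg fun ω _ => (cubeWeight_pos hq hq1 ω).le]
  exact Finset.sum_congr rfl fun ω _ => binomialRandom_cubeGraph q ω

/-! ### Cycle counts as traces -/

/-- The weight `F` on the endpoints is arbitrary so that the induction closes: removing the first
vertex absorbs the first edge into `F`. For cycles `F` is the closing edge. -/
lemma sum_path_eq_sum_pow {V : Type*} [Fintype V] [DecidableEq V] (X : Matrix V V ℝ) (m : ℕ)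
    (F : V → V → ℝ) :
    ∑ f : Fin (m + 1) → V, (∏ i : Fin m, X (f i.castSucc) (f i.succ)) * F (f 0) (f (Fin.last m))
      = ∑ a, ∑ b, (X ^ m) a b * F a b := by
  induction m generalizing F with
  | zero =>
    simp only [Finset.univ_eq_empty, Finset.prod_empty, one_mul, pow_zero, Matrix.one_apply,
      ite_mul, zero_mul, Finset.sum_ite_eq, Finset.mem_univ, if_true]
    exact (Equiv.funUnique (Fin 1) V).sum_comp fun a => F a a
  | succ m ih =>
    rw [← (Fin.consEquiv fun _ : Fin (m + 2) => V).sum_comp, Fintype.sum_prod_type]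
    simp only [Fin.consEquiv, Equiv.coe_fn_mk, Fin.prod_univ_succ, Fin.cons_zero,
      Fin.castSucc_zero, Fin.cons_succ, ← Fin.succ_castSucc, ← Fin.succ_last]
    have h := ih fun c b => ∑ a, X a c * F a b
    rw [Finset.sum_comm]
    calc _ = ∑ f : Fin (m + 1) → V, (∏ i : Fin m, X (f i.castSucc) (f i.succ)) *
          ∑ a, X a (f 0) * F a (f (Fin.last m)) := by
          refine Finset.sum_congr rfl fun f _ => ?_
          rw [Finset.mul_sum]
          exact Finset.sum_congr rfl fun a _ => by ring
      _ = _ := h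
      _ = _ := by
        simp only [pow_succ', Matrix.mul_apply, Finset.mul_sum, Finset.sum_mul]
        rw [Finset.sum_comm_cycle]
        refine Finset.sum_congr rfl fun a _ => ?_
        rw [Finset.sum_comm]
        exact Finset.sum_congr rfl fun b _ => Finset.sum_congr rfl fun c _ => by ring

lemma cycleGraph_adj_of_lt {n : ℕ} {u v : Fin (n + 3)} (h : u < v) :
    (SimpleGraph.cycleGraph (n + 3)).Adj u v ↔
      v.val = u.val + 1 ∨ (u.val = 0 ∧ v.val = n + 2) := by
  rw [SimpleGraph.cycleGraph_adj']
  have h1 : (v - u).val = v.val - u.val := Fin.sub_val_of_le h.le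
  have h2 : (u - v).val = n + 3 + u.val - v.val := Fin.coe_sub_iff_lt.2 h
  rw [h1, h2]
  have := v.2
  have := u.2
  have h3 : u.val < v.val := h
  omega

-- The edges of the path together with one closing edge, in the shape needed for
-- `sum_path_eq_sum_pow`.
open Classical in
lemma cycleGraph_filter (n : ℕ) :
    (Finset.univ.filter fun e : Fin (n + 3) × Fin (n + 3) =>
      e.1 < e.2 ∧ (SimpleGraph.cycleGraph (n + 3)).Adj e.1 e.2) =
    insert (0, Fin.last (n + 2)) (Finset.univ.image fun i : Fin (n + 2) => (i.castSucc, i.succ)) := by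
  ext ⟨u, v⟩
  simp only [Finset.mem_filter, Finset.mem_univ, true_and, Finset.mem_insert, Finset.mem_image,
    Prod.mk.injEq]
  constructor
  · rintro ⟨h, hadj⟩
    rcases (cycleGraph_adj_of_lt h).1 hadj with h' | ⟨h1, h2⟩
    · right
      have := v.2
      exact ⟨⟨u.val, by omega⟩, Fin.ext rfl, Fin.ext (by simp [h'])⟩
    · left
      exact ⟨Fin.ext h1, Fin.ext h2⟩
  · rintro (⟨rfl, rfl⟩ | ⟨i, rfl, rfl⟩)
    · have h : (0 : Fin (n + 3)) < Fin.last (n + 2) := Fin.last_pos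
      exact ⟨h, (cycleGraph_adj_of_lt h).2 (Or.inr ⟨rfl, rfl⟩)⟩
    · have h : i.castSucc < i.succ := Fin.castSucc_lt_succ
      exact ⟨h, (cycleGraph_adj_of_lt h).2 (Or.inl (by simp))⟩

/-- Symmetry enters only through the closing edge, which `homMatrix` reads from the smaller vertex
to the larger one and the trace in the opposite direction. -/
theorem homMatrix_cycleGraph {ℓ : ℕ} (hℓ : 3 ≤ ℓ) {N : ℕ} {X : Matrix (Fin N) (Fin N) ℝ}
    (hX : X.IsSymm) : homMatrix (SimpleGraph.cycleGraph ℓ) X = (X ^ ℓ).trace := by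
  classical
  obtain ⟨n, rfl⟩ : ∃ n, ℓ = n + 3 := ⟨ℓ - 3, by omega⟩
  have hprod : ∀ f : Fin (n + 3) → Fin N,
      ∏ e : Fin (n + 3) × Fin (n + 3) with
        e.1 < e.2 ∧ (SimpleGraph.cycleGraph (n + 3)).Adj e.1 e.2, X (f e.1) (f e.2) =
      (∏ i : Fin (n + 2), X (f i.castSucc) (f i.succ)) * X (f (Fin.last (n + 2))) (f 0) := by
    intro f
    rw [cycleGraph_filter, Finset.prod_insert, Finset.prod_image, mul_comm, hX.apply]
    · intro i _ j _ h
      exact Fin.succ_injective _ (Prod.ext_iff.1 h).2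
    · simp only [Finset.mem_image, Finset.mem_univ, true_and, not_exists, Prod.mk.injEq, not_and]
      intro i h1 h2
      have h3 : i.val = 0 := congrArg Fin.val h1
      have h4 : i.val + 1 = n + 2 := congrArg Fin.val h2
      omega
  have h := sum_path_eq_sum_pow X (n + 2) fun a b => X b a
  unfold homMatrix
  calc _ = _ := Finset.sum_congr rfl fun f _ => by convert hprod f
    _ = _ := h
    _ = _ := by
      have e : X ^ (n + 3) = X ^ (n + 2) * X := pow_succ _ _
      simp [e, Matrix.trace, Matrix.mul_apply]

lemma ncard_edgeSet_cycleGraph {ℓ : ℕ} (hℓ : 3 ≤ ℓ) :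
    (SimpleGraph.cycleGraph ℓ).edgeSet.ncard = ℓ := by
  classical
  obtain ⟨n, rfl⟩ : ∃ n, ℓ = n + 3 := ⟨ℓ - 3, by omega⟩
  have h := (SimpleGraph.cycleGraph (n + 3)).sum_degrees_eq_twice_card_edges
  rw [← SimpleGraph.coe_edgeFinset, Set.ncard_coe_finset]
  have h2 : ∀ v, (SimpleGraph.cycleGraph (n + 3)).degree v = 2 := fun v => by
    convert SimpleGraph.cycleGraph_degree_three_le (n := n) (v := v)
  simp only [h2, Finset.sum_const, Finset.card_univ, Fintype.card_fin, smul_eq_mul] at h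
  omega

/-! ### Spectral decompositions -/

/-- The symmetric matrix with eigenvalues `d` and with the rows of `U` as eigenvectors. -/
noncomputable def specMat {N : ℕ} (U : Matrix (Fin N) (Fin N) ℝ) (d : Fin N → ℝ) :
    Matrix (Fin N) (Fin N) ℝ :=
  U.transpose * Matrix.diagonal d * U

section specMat

variable {N : ℕ} {U : Matrix (Fin N) (Fin N) ℝ}

lemma specMat_apply (U : Matrix (Fin N) (Fin N) ℝ) (d : Fin N → ℝ) (i j : Fin N) :
    specMat U d i j = ∑ k, d k * (U k i * U k j) := by
  rw [specMat, Matrix.mul_apply]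
  simp only [Matrix.mul_diagonal, Matrix.transpose_apply]
  exact Finset.sum_congr rfl fun k _ => by ring

lemma specMat_isSymm (U : Matrix (Fin N) (Fin N) ℝ) (d : Fin N → ℝ) : (specMat U d).IsSymm := by
  ext i j
  simp only [Matrix.transpose_apply, specMat_apply]
  exact Finset.sum_congr rfl fun k _ => by ring

lemma specMat_add (U : Matrix (Fin N) (Fin N) ℝ) (d e : Fin N → ℝ) :
    specMat U d + specMat U e = specMat U (d + e) := by
  ext i j
  simp only [Matrix.add_apply, specMat_apply, Pi.add_apply, ← Finset.sum_add_distrib]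
  exact Finset.sum_congr rfl fun k _ => by ring

lemma specMat_mul (hU : U * U.transpose = 1) (d e : Fin N → ℝ) :
    specMat U d * specMat U e = specMat U (d * e) := by
  unfold specMat
  calc _ = U.transpose * Matrix.diagonal d * (U * U.transpose) * Matrix.diagonal e * U := by
        simp only [Matrix.mul_assoc]
    _ = _ := by
        rw [hU, Matrix.mul_one, Matrix.mul_assoc U.transpose, Matrix.diagonal_mul_diagonal]
        rfl

lemma specMat_one (hU : U * U.transpose = 1) : specMat U 1 = 1 := by
  have : Matrix.diagonal (1 : Fin N → ℝ) = 1 := Matrix.diagonal_one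
  rw [specMat, this, Matrix.mul_one, mul_eq_one_comm.1 hU]

lemma specMat_pow (hU : U * U.transpose = 1) (d : Fin N → ℝ) (n : ℕ) :
    specMat U d ^ n = specMat U (d ^ n) := by
  induction n with
  | zero => rw [pow_zero, pow_zero, specMat_one hU]
  | succ n ih => rw [pow_succ, ih, specMat_mul hU, pow_succ]

lemma trace_specMat (hU : U * U.transpose = 1) (d : Fin N → ℝ) :
    (specMat U d).trace = ∑ k, d k := by
  rw [specMat, Matrix.trace_mul_comm, ← Matrix.mul_assoc, hU, Matrix.one_mul,
    Matrix.trace_diagonal]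

lemma trace_specMat_pow (hU : U * U.transpose = 1) (d : Fin N → ℝ) (n : ℕ) :
    (specMat U d ^ n).trace = ∑ k, d k ^ n := by
  rw [specMat_pow hU, trace_specMat hU]
  rfl

lemma row_sq_sum (hU : U * U.transpose = 1) (k : Fin N) : ∑ i, U k i ^ 2 = 1 := by
  have := congrFun (congrFun hU k) k
  simpa [Matrix.mul_apply, sq] using this

lemma col_sq_sum (hU : U * U.transpose = 1) (i : Fin N) : ∑ k, U k i ^ 2 = 1 := by
  have h : U.transpose * U = 1 := mul_eq_one_comm.1 hU
  have := congrFun (congrFun h i) i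
  simpa [Matrix.mul_apply, sq] using this

lemma abs_entry_le_one (hU : U * U.transpose = 1) (k i : Fin N) : |U k i| ≤ 1 := by
  rw [← sq_le_one_iff_abs_le_one, ← row_sq_sum hU k]
  exact Finset.single_le_sum (f := fun i => U k i ^ 2) (fun _ _ => sq_nonneg _) (Finset.mem_univ i)

/-- Each product of two entries of `U` is at most the mean of their squares in absolute value, and
the columns of `U` are unit vectors. -/
lemma abs_specMat_le (hU : U * U.transpose = 1) {d : Fin N → ℝ} {D : ℝ} (hd : ∀ k, |d k| ≤ D)
    (i j : Fin N) : |specMat U d i j| ≤ D := by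
  rw [specMat_apply]
  have hD : ∀ _ : Fin N, 0 ≤ D := fun k => (abs_nonneg _).trans (hd k)
  calc |∑ k, d k * (U k i * U k j)| ≤ ∑ k, |d k * (U k i * U k j)| :=
        Finset.abs_sum_le_sum_abs _ _
    _ ≤ ∑ k, D * ((U k i ^ 2 + U k j ^ 2) / 2) := by
        refine Finset.sum_le_sum fun k _ => ?_
        rw [abs_mul, abs_mul]
        refine mul_le_mul (hd k) ?_ (by positivity) (hD k)
        nlinarith [sq_nonneg (|U k i| - |U k j|), sq_abs (U k i), sq_abs (U k j)]
    _ = D := by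
        rw [← Finset.mul_sum, ← Finset.sum_div, Finset.sum_add_distrib, col_sq_sum hU,
          col_sq_sum hU]
        ring

/-- Every real symmetric matrix has a spectral decomposition with the eigenvalues ordered by
decreasing absolute value. -/
theorem exists_specMat {A : Matrix (Fin N) (Fin N) ℝ} (hA : A.IsSymm) :
    ∃ (U : Matrix (Fin N) (Fin N) ℝ) (d : Fin N → ℝ),
      U * U.transpose = 1 ∧ A = specMat U d ∧ Antitone fun k => |d k| := by
  have hH : A.IsHermitian := by
    rw [Matrix.IsHermitian, Matrix.conjTranspose_eq_transpose_of_trivial]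
    exact hA
  set V : Matrix (Fin N) (Fin N) ℝ := (hH.eigenvectorUnitary : Matrix (Fin N) (Fin N) ℝ) with hV
  have hVs : V.transpose * V = 1 := by
    have := Unitary.coe_star_mul_self hH.eigenvectorUnitary
    rwa [Matrix.star_eq_conjTranspose, Matrix.conjTranspose_eq_transpose_of_trivial] at this
  have hspec : A = V * Matrix.diagonal hH.eigenvalues * V.transpose := by
    have := hH.spectral_theorem
    rw [Unitary.conjStarAlgAut_apply] at this
    rw [Matrix.star_eq_conjTranspose, Matrix.conjTranspose_eq_transpose_of_trivial] at this
    exact this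
  set σ : Equiv.Perm (Fin N) := Tuple.sort fun k => -|hH.eigenvalues k| with hσ
  have hmono : Monotone ((fun k => -|hH.eigenvalues k|) ∘ σ) := Tuple.monotone_sort _
  refine ⟨Matrix.of fun k i => V i (σ k), fun k => hH.eigenvalues (σ k), ?_, ?_, ?_⟩
  · ext k l
    have := congrFun (congrFun hVs (σ k)) (σ l)
    simp only [Matrix.mul_apply, Matrix.transpose_apply, Matrix.one_apply, Matrix.of_apply] at this ⊢
    rw [this]
    simp
  · ext i j
    rw [specMat_apply]
    refine (congrFun (congrFun hspec i) j).trans ?_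
    rw [Matrix.mul_apply]
    simp only [Matrix.mul_diagonal, Matrix.transpose_apply, Matrix.of_apply]
    rw [← Equiv.sum_comp σ]
    exact Finset.sum_congr rfl fun k _ => by ring
  · intro k l hkl
    have := hmono hkl
    simp only [Function.comp] at this
    linarith

/-- Convexity of the Schatten norms, in the form of a bound on traces of powers of averages. -/
theorem abs_trace_pow_sum_le {α : Type*} (s : Finset α) (w : α → ℝ) (hw : ∀ a ∈ s, 0 ≤ w a)
    (hw1 : ∑ a ∈ s, w a = 1) (U : α → Matrix (Fin N) (Fin N) ℝ)
    (hU : ∀ a ∈ s, U a * (U a).transpose = 1) (d : α → Fin N → ℝ) (n : ℕ) :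
    |((∑ a ∈ s, w a • specMat (U a) (d a)) ^ n).trace| ≤ ∑ a ∈ s, w a * ∑ k, |d a k| ^ n := by
  set Z := ∑ a ∈ s, w a • specMat (U a) (d a) with hZ
  have hsymm : Z.IsSymm := by
    rw [hZ, Matrix.IsSymm, Matrix.transpose_sum]
    refine Finset.sum_congr rfl fun a _ => ?_
    rw [Matrix.transpose_smul, (specMat_isSymm _ _).eq]
  obtain ⟨V, μ, hV, hZV, -⟩ := exists_specMat hsymm
  -- In an eigenbasis of the average, each eigenvalue μ i is a mean of the d a k with weights w a ·
  -- (Q a i k)². The squared entries of an orthogonal matrix are doubly stochastic: row sums allow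
  -- Jensen's inequality, column sums then collapse the double sum.
  set Q : α → Matrix (Fin N) (Fin N) ℝ := fun a => V * (U a).transpose with hQ
  have hQo : ∀ a ∈ s, Q a * (Q a).transpose = 1 := by
    intro a ha
    have h1 := mul_eq_one_comm.1 (hU a ha)
    calc Q a * (Q a).transpose = V * ((U a).transpose * U a) * V.transpose := by
          simp [hQ, Matrix.transpose_mul, Matrix.mul_assoc]
      _ = 1 := by rw [h1, Matrix.mul_one, hV]
  have hμ : ∀ i, μ i = ∑ a ∈ s, ∑ k, (w a * Q a i k ^ 2) * d a k := by
    intro i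
    have e1 : V * Z * V.transpose = Matrix.diagonal μ := by
      rw [hZV, specMat]
      calc _ = (V * V.transpose) * Matrix.diagonal μ * (V * V.transpose) := by
            simp only [Matrix.mul_assoc]
        _ = _ := by rw [hV, Matrix.one_mul, Matrix.mul_one]
    have e2 : V * Z * V.transpose =
        ∑ a ∈ s, w a • (Q a * Matrix.diagonal (d a) * (Q a).transpose) := by
      rw [hZ, Matrix.mul_sum, Matrix.sum_mul]
      refine Finset.sum_congr rfl fun a _ => ?_
      rw [Matrix.mul_smul, Matrix.smul_mul]
      simp [hQ, specMat, Matrix.transpose_mul, Matrix.mul_assoc]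
    have e3 := congrFun (congrFun (e1.symm.trans e2) i) i
    rw [Matrix.diagonal_apply_eq, Matrix.sum_apply] at e3
    rw [e3]
    refine Finset.sum_congr rfl fun a _ => ?_
    rw [Matrix.smul_apply, smul_eq_mul, Matrix.mul_apply, Finset.mul_sum]
    refine Finset.sum_congr rfl fun k _ => ?_
    rw [Matrix.mul_diagonal, Matrix.transpose_apply]
    ring
  have hwt : ∀ i, ∑ x ∈ s ×ˢ (Finset.univ : Finset (Fin N)), w x.1 * Q x.1 i x.2 ^ 2 = 1 := by
    intro i
    rw [Finset.sum_product, ← hw1]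
    refine Finset.sum_congr rfl fun a ha => ?_
    simp only
    rw [← Finset.mul_sum, row_sq_sum (hQo a ha), mul_one]
  have hjensen : ∀ i, |μ i| ^ n ≤ ∑ a ∈ s, ∑ k, (w a * Q a i k ^ 2) * |d a k| ^ n := by
    intro i
    have h1 : |μ i| ≤ ∑ x ∈ s ×ˢ (Finset.univ : Finset (Fin N)),
        (w x.1 * Q x.1 i x.2 ^ 2) * |d x.1 x.2| := by
      rw [hμ i, ← Finset.sum_product' (f := fun a k => (w a * Q a i k ^ 2) * d a k)]
      refine (Finset.abs_sum_le_sum_abs _ _).trans (Finset.sum_le_sum fun x hx => ?_)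
      rw [abs_mul, abs_of_nonneg (mul_nonneg (hw _ (Finset.mem_product.1 hx).1) (sq_nonneg _))]
    have h2 := Real.pow_arith_mean_le_arith_mean_pow (s ×ˢ (Finset.univ : Finset (Fin N)))
      (fun x => w x.1 * Q x.1 i x.2 ^ 2) (fun x => |d x.1 x.2|)
      (fun x hx => mul_nonneg (hw _ (Finset.mem_product.1 hx).1) (sq_nonneg _)) (hwt i)
      (fun _ _ => abs_nonneg _) n
    calc |μ i| ^ n ≤ _ := pow_le_pow_left₀ (abs_nonneg _) h1 n
      _ ≤ _ := h2
      _ = _ := Finset.sum_product' (f := fun a k => (w a * Q a i k ^ 2) * |d a k| ^ n) _ _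
  rw [hZV, trace_specMat_pow hV]
  calc |∑ k, μ k ^ n| ≤ ∑ i, |μ i| ^ n := by
        refine (Finset.abs_sum_le_sum_abs _ _).trans_eq ?_
        simp [abs_pow]
    _ ≤ ∑ i, ∑ a ∈ s, ∑ k, (w a * Q a i k ^ 2) * |d a k| ^ n :=
        Finset.sum_le_sum fun i _ => hjensen i
    _ = ∑ a ∈ s, w a * ∑ k, |d a k| ^ n := by
        rw [Finset.sum_comm]
        refine Finset.sum_congr rfl fun a ha => ?_
        rw [Finset.sum_comm, Finset.mul_sum]
        refine Finset.sum_congr rfl fun k _ => ?_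
        rw [← Finset.sum_mul, ← Finset.mul_sum, col_sq_sum (hQo a ha), mul_one]

end specMat

/-! ### Powers of almost orthogonal sums -/

section NormedRing

variable {𝓡 : Type*} [NormedRing 𝓡] [NormOneClass 𝓡]

/-- Every mixed word in the expansion contains BZ or ZB as a factor and is therefore small. The
induction multiplies the previous difference by B + Z, which creates only two new mixed words. -/
lemma norm_add_pow_sub_le {B Z : 𝓡} {K η : ℝ} (hK : 1 ≤ K) (hη : 0 ≤ η) (hB : ‖B‖ ≤ K)
    (hZ : ‖Z‖ ≤ K) (hBZ : ‖B * Z‖ ≤ η) (hZB : ‖Z * B‖ ≤ η) (n : ℕ) :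
    ‖(B + Z) ^ (n + 1) - B ^ (n + 1) - Z ^ (n + 1)‖ ≤ (3 * K) ^ (n + 1) * η := by
  induction n with
  | zero =>
    have : (B + Z) ^ (0 + 1) - B ^ (0 + 1) - Z ^ (0 + 1) = 0 := by
      simp only [zero_add, pow_one]; abel
    rw [this, norm_zero]
    positivity
  | succ n ih =>
    have e : (B + Z) ^ (n + 1 + 1) - B ^ (n + 1 + 1) - Z ^ (n + 1 + 1) =
        ((B + Z) ^ (n + 1) - B ^ (n + 1) - Z ^ (n + 1)) * (B + Z)
          + (B ^ n * (B * Z) + Z ^ n * (Z * B)) := by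
      rw [← mul_assoc, ← mul_assoc, ← pow_succ, ← pow_succ, pow_succ (B + Z) (n + 1),
        pow_succ B (n + 1), pow_succ Z (n + 1)]
      noncomm_ring
    have hBn : ‖B ^ n‖ ≤ K ^ n := (norm_pow_le B n).trans (pow_le_pow_left₀ (norm_nonneg _) hB n)
    have hZn : ‖Z ^ n‖ ≤ K ^ n := (norm_pow_le Z n).trans (pow_le_pow_left₀ (norm_nonneg _) hZ n)
    have h3 : (1 : ℝ) ≤ 3 ^ (n + 1) := one_le_pow₀ (by norm_num)
    rw [e]
    calc _ ≤ ‖((B + Z) ^ (n + 1) - B ^ (n + 1) - Z ^ (n + 1)) * (B + Z)‖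
          + (‖B ^ n * (B * Z)‖ + ‖Z ^ n * (Z * B)‖) :=
          (norm_add_le _ _).trans (add_le_add_right (norm_add_le _ _) _)
      _ ≤ ((3 * K) ^ (n + 1) * η) * (K + K) + (K ^ n * η + K ^ n * η) := by
          refine add_le_add ((norm_mul_le _ _).trans (mul_le_mul ih ((norm_add_le _ _).trans
            (add_le_add hB hZ)) (norm_nonneg _) (by positivity))) (add_le_add ?_ ?_)
          · exact (norm_mul_le _ _).trans (mul_le_mul hBn hBZ (norm_nonneg _) (by positivity))
          · exact (norm_mul_le _ _).trans (mul_le_mul hZn hZB (norm_nonneg _) (by positivity))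
      _ ≤ (3 * K) ^ (n + 1 + 1) * η := by
          have h4 : K ^ n ≤ K ^ (n + 2) := pow_le_pow_right₀ hK (by omega)
          have h5 : (2 : ℝ) ≤ 3 ^ (n + 1) := by
            calc (2 : ℝ) ≤ 3 ^ 1 := by norm_num
              _ ≤ 3 ^ (n + 1) := pow_le_pow_right₀ (by norm_num) (by omega)
          have h6 : 2 * K ^ n ≤ 3 ^ (n + 1) * K ^ (n + 2) := mul_le_mul h5 h4 (by positivity)
            (by positivity)
          have h7 := mul_le_mul_of_nonneg_right h6 hη
          have e1 : (3 * K) ^ (n + 1 + 1) * η = 3 * (3 ^ (n + 1) * K ^ (n + 2) * η) := by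
            rw [mul_pow]; ring
          have e2 : ((3 * K) ^ (n + 1) * η) * (K + K) = 2 * (3 ^ (n + 1) * K ^ (n + 2) * η) := by
            rw [mul_pow]; ring
          rw [e1, e2]
          linarith

lemma norm_pow_sub_pow_le {x y : 𝓡} {K : ℝ} (hK : 1 ≤ K) (hx : ‖x‖ ≤ K) (hy : ‖y‖ ≤ K) (n : ℕ) :
    ‖x ^ n - y ^ n‖ ≤ (2 * K) ^ n * ‖x - y‖ := by
  induction n with
  | zero => simp
  | succ n ih =>
    have e : x ^ (n + 1) - y ^ (n + 1) = (x ^ n - y ^ n) * x + y ^ n * (x - y) := by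
      rw [pow_succ, pow_succ]; noncomm_ring
    have hyn : ‖y ^ n‖ ≤ K ^ n := (norm_pow_le y n).trans (pow_le_pow_left₀ (norm_nonneg _) hy n)
    have h2 : K ^ n ≤ (2 * K) ^ n := pow_le_pow_left₀ (by linarith) (by linarith) n
    rw [e]
    calc _ ≤ ‖(x ^ n - y ^ n) * x‖ + ‖y ^ n * (x - y)‖ := norm_add_le _ _
      _ ≤ (2 * K) ^ n * ‖x - y‖ * K + (2 * K) ^ n * K * ‖x - y‖ := by
          refine add_le_add ((norm_mul_le _ _).trans (mul_le_mul ih hx (norm_nonneg _)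
            (by positivity))) ((norm_mul_le _ _).trans ?_)
          refine mul_le_mul_of_nonneg_right (hyn.trans (h2.trans ?_)) (norm_nonneg _)
          exact le_mul_of_one_le_right (by positivity) hK
      _ = _ := by ring

/-- If the summands `B a` are close to one another and orthogonal to the corresponding `Z a`, then
the powers of the average of `B a + Z a` almost split. -/
lemma norm_average_pow_sub_le [NormedAlgebra ℝ 𝓡] {α : Type*} (s : Finset α) (w : α → ℝ)
    (hw : ∀ a ∈ s, 0 ≤ w a) (hw1 : ∑ a ∈ s, w a = 1) (B Z : α → 𝓡) {K η : ℝ} (hK : 1 ≤ K)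
    (hB : ∀ a ∈ s, ‖B a‖ ≤ K) (hZ : ∀ a ∈ s, ‖Z a‖ ≤ K)
    (hBZ : ∀ a ∈ s, B a * Z a = 0) (hZB : ∀ a ∈ s, Z a * B a = 0)
    (hBB : ∀ a ∈ s, ∀ b ∈ s, ‖B a - B b‖ ≤ η) {b : α} (hb : b ∈ s) (n : ℕ) :
    ‖(∑ a ∈ s, w a • (B a + Z a)) ^ (n + 1) - B b ^ (n + 1) - (∑ a ∈ s, w a • Z a) ^ (n + 1)‖ ≤
      2 * (3 * K) ^ (n + 2) * η := by
  have hη : 0 ≤ η := (norm_nonneg _).trans (hBB b hb b hb)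
  have avg : ∀ (f : α → 𝓡) (c : ℝ), (∀ a ∈ s, ‖f a‖ ≤ c) → ‖∑ a ∈ s, w a • f a‖ ≤ c := by
    intro f c hf
    calc ‖∑ a ∈ s, w a • f a‖ ≤ ∑ a ∈ s, w a * c := by
          refine (norm_sum_le _ _).trans (Finset.sum_le_sum fun a ha => ?_)
          rw [norm_smul, Real.norm_of_nonneg (hw a ha)]
          exact mul_le_mul_of_nonneg_left (hf a ha) (hw a ha)
      _ = c := by rw [← Finset.sum_mul, hw1, one_mul]
  set B' := ∑ a ∈ s, w a • B a with hB'
  set Z' := ∑ a ∈ s, w a • Z a with hZ'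
  have hconst : ∀ x : 𝓡, ∑ a ∈ s, w a • x = x := fun x => by
    rw [← Finset.sum_smul, hw1, one_smul]
  have hdiff : ∀ b ∈ s, ‖B' - B b‖ ≤ η := by
    intro b hb
    have : B' - B b = ∑ a ∈ s, w a • (B a - B b) := by
      simp_rw [smul_sub]
      rw [Finset.sum_sub_distrib, hconst]
    rw [this]
    exact avg _ _ fun a ha => hBB a ha b hb
  have h1 : ‖B' * Z'‖ ≤ K * η := by
    -- Since B a * Z a = 0, one may subtract B a from B' inside each summand, and B' is close to
    -- every B a.
    have : B' * Z' = ∑ a ∈ s, w a • ((B' - B a) * Z a) := by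
      rw [hZ', Finset.mul_sum]
      refine Finset.sum_congr rfl fun a ha => ?_
      rw [sub_mul, hBZ a ha, sub_zero, mul_smul_comm]
    rw [this]
    refine avg _ _ fun a ha => (norm_mul_le _ _).trans ?_
    rw [mul_comm]
    exact mul_le_mul (hZ a ha) (hdiff a ha) (norm_nonneg _) (by linarith)
  have h2 : ‖Z' * B'‖ ≤ K * η := by
    have : Z' * B' = ∑ a ∈ s, w a • (Z a * (B' - B a)) := by
      rw [hZ', Finset.sum_mul]
      refine Finset.sum_congr rfl fun a ha => ?_
      rw [mul_sub, hZB a ha, sub_zero, smul_mul_assoc]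
    rw [this]
    refine avg _ _ fun a ha => (norm_mul_le _ _).trans ?_
    exact mul_le_mul (hZ a ha) (hdiff a ha) (norm_nonneg _) (by linarith)
  have h3 := norm_add_pow_sub_le hK (by positivity) (avg B K hB) (avg Z K hZ) h1 h2 n
  have h4 := norm_pow_sub_pow_le hK (avg B K hB) (hB b hb) (n + 1)
  have h5 : ∑ a ∈ s, w a • (B a + Z a) = B' + Z' := by
    simp_rw [smul_add]
    rw [Finset.sum_add_distrib]
  rw [h5]
  have e : (B' + Z') ^ (n + 1) - B b ^ (n + 1) - Z' ^ (n + 1) =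
      ((B' + Z') ^ (n + 1) - B' ^ (n + 1) - Z' ^ (n + 1)) + (B' ^ (n + 1) - B b ^ (n + 1)) := by
    abel
  rw [e]
  refine (norm_add_le _ _).trans ((add_le_add h3 h4).trans ?_)
  have h6 : (2 * K) ^ (n + 1) * ‖B' - B b‖ ≤ (3 * K) ^ (n + 2) * η := by
    refine mul_le_mul ?_ (hdiff b hb) (norm_nonneg _) (by positivity)
    calc (2 * K) ^ (n + 1) ≤ (3 * K) ^ (n + 1) := pow_le_pow_left₀ (by linarith) (by linarith) _
      _ ≤ (3 * K) ^ (n + 2) := pow_le_pow_right₀ (by linarith) (by omega)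
  have h7 : (3 * K) ^ (n + 1) * (K * η) ≤ (3 * K) ^ (n + 2) * η := by
    rw [pow_succ (3 * K) (n + 1)]
    have : 0 ≤ (3 * K) ^ (n + 1) * (K * η) := by positivity
    nlinarith
  linarith

end NormedRing

/-! ### Partition of a set of graphs according to the leading eigenspaces -/

section Partition

attribute [local instance] Matrix.linftyOpNormedRing Matrix.linftyOpNormedAlgebra

/-- The row-sum norm is chosen because it is submultiplicative and easy to bound by entries. Losses
polynomial in N are harmless, as the mesh of the rounding is a high inverse power of N. -/
lemma linfty_norm_le {N : ℕ} {A : Matrix (Fin N) (Fin N) ℝ} {c : ℝ} (hc : 0 ≤ c)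
    (h : ∀ i j, |A i j| ≤ c) : ‖A‖ ≤ N * c := by
  rw [Matrix.linfty_opNorm_def]
  have h0 : (0 : ℝ) ≤ N * c := by positivity
  have : (Finset.univ.sup fun i => ∑ j, ‖A i j‖₊) ≤ (⟨N * c, h0⟩ : NNReal) := by
    refine Finset.sup_le fun i _ => ?_
    refine NNReal.coe_le_coe.1 ?_
    rw [NNReal.coe_sum]
    calc ∑ j, ‖A i j‖ ≤ ∑ _j : Fin N, c := Finset.sum_le_sum fun j _ => h i j
      _ = N * c := by simp
  exact_mod_cast this

lemma abs_trace_le {N : ℕ} (A : Matrix (Fin N) (Fin N) ℝ) : |A.trace| ≤ N * ‖A‖ := by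
  have hd : ∀ i, |A i i| ≤ ‖A‖ := by
    intro i
    rw [Matrix.linfty_opNorm_def]
    have h1 : ‖A i i‖₊ ≤ ∑ j, ‖A i j‖₊ :=
      Finset.single_le_sum (f := fun j => ‖A i j‖₊) (fun _ _ => zero_le) (Finset.mem_univ i)
    have h2 : (∑ j, ‖A i j‖₊) ≤ Finset.univ.sup fun i => ∑ j, ‖A i j‖₊ :=
      Finset.le_sup (f := fun i => ∑ j, ‖A i j‖₊) (Finset.mem_univ i)
    exact_mod_cast h1.trans h2
  calc |A.trace| ≤ ∑ i, |A i i| := Finset.abs_sum_le_sum_abs _ _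
    _ ≤ ∑ _i : Fin N, ‖A‖ := Finset.sum_le_sum fun i _ => hd i
    _ = N * ‖A‖ := by simp

/-- The sum of the squares of the eigenvalues is the square of the Frobenius norm. -/
lemma sum_sq_eq_sum_entries {N : ℕ} {U : Matrix (Fin N) (Fin N) ℝ} (hU : U * U.transpose = 1)
    (d : Fin N → ℝ) : ∑ k, d k ^ 2 = ∑ i, ∑ j, specMat U d i j ^ 2 := by
  rw [← trace_specMat_pow hU, sq (specMat U d), Matrix.trace]
  refine Finset.sum_congr rfl fun i _ => ?_
  rw [Matrix.diag_apply, Matrix.mul_apply]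
  refine Finset.sum_congr rfl fun j _ => ?_
  rw [sq, (specMat_isSymm U d).apply i j]

lemma abs_eigenvalue_le {N : ℕ} {U : Matrix (Fin N) (Fin N) ℝ} (hU : U * U.transpose = 1)
    {d : Fin N → ℝ} (h : ∀ i j, |specMat U d i j| ≤ 1) (k : Fin N) : |d k| ≤ N := by
  refine abs_le_of_sq_le_sq ?_ (by positivity)
  calc d k ^ 2 ≤ ∑ k, d k ^ 2 :=
        Finset.single_le_sum (f := fun k => d k ^ 2) (fun _ _ => sq_nonneg _) (Finset.mem_univ k)
    _ = ∑ i, ∑ j, specMat U d i j ^ 2 := sum_sq_eq_sum_entries hU d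
    _ ≤ ∑ _i : Fin N, ∑ _j : Fin N, (1 : ℝ) := by
        refine Finset.sum_le_sum fun i _ => Finset.sum_le_sum fun j _ => ?_
        rw [sq_le_one_iff_abs_le_one]
        exact h i j
    _ = (N : ℝ) ^ 2 := by simp [sq]

lemma abs_symMat_cubePoint_le {N : ℕ} (ω : Edge N → Bool) (i j : Fin N) :
    |symMat (cubePoint ω) i j| ≤ 1 := by
  have := (symMat_mem (x := cubePoint ω) fun e => boolVal_mem _).2.1 i j
  exact abs_le.2 ⟨by linarith [this.1], this.2⟩

/-- The eigenvalues of index less than `R`. -/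
noncomputable def headPart {N : ℕ} (R : ℕ) (d : Fin N → ℝ) : Fin N → ℝ :=
  fun k => if k.val < R then d k else 0

/-- The eigenvalues of index at least `R`. -/
noncomputable def tailPart {N : ℕ} (R : ℕ) (d : Fin N → ℝ) : Fin N → ℝ :=
  fun k => if k.val < R then 0 else d k

lemma head_add_tail {N : ℕ} (R : ℕ) (d : Fin N → ℝ) : headPart R d + tailPart R d = d := by
  ext k
  simp only [headPart, tailPart, Pi.add_apply]
  split_ifs <;> simp

lemma head_mul_tail {N : ℕ} (R : ℕ) (d : Fin N → ℝ) : headPart R d * tailPart R d = 0 := by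
  ext k
  simp only [headPart, tailPart, Pi.mul_apply, Pi.zero_apply]
  split_ifs <;> simp

lemma specMat_zero {N : ℕ} (U : Matrix (Fin N) (Fin N) ℝ) : specMat U 0 = 0 := by
  ext i j
  simp [specMat_apply]

lemma sum_pow_head_add_tail {N : ℕ} (R : ℕ) (d : Fin N → ℝ) {n : ℕ} (hn : n ≠ 0) :
    ∑ k, d k ^ n = ∑ k, headPart R d k ^ n + ∑ k, tailPart R d k ^ n := by
  rw [← Finset.sum_add_distrib]
  refine Finset.sum_congr rfl fun k _ => ?_
  simp only [headPart, tailPart]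
  split_ifs <;> simp [hn]

lemma floor_close {x y c : ℝ} (hc : 0 < c) (h : ⌊x * c⌋ = ⌊y * c⌋) : |x - y| ≤ 1 / c := by
  have h1 := Int.abs_sub_lt_one_of_floor_eq_floor h
  rw [← sub_mul, abs_mul, abs_of_pos hc] at h1
  rw [le_div_iff₀ hc]
  exact h1.le

/-- If the first `R` eigenvalues and eigenvectors are close, then so are the spectral
truncations. -/
lemma norm_head_sub_le {N R : ℕ} {U V : Matrix (Fin N) (Fin N) ℝ}
    {d e : Fin N → ℝ} (hU : U * U.transpose = 1) (hV : V * V.transpose = 1)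
    (hd : ∀ k, |d k| ≤ N) {c : ℝ} (hc : 0 ≤ c)
    (hUV : ∀ k : Fin N, k.val < R → ∀ i, |U k i - V k i| ≤ c)
    (hde : ∀ k : Fin N, k.val < R → |d k - e k| ≤ c) (hN : 1 ≤ N) :
    ‖specMat U (headPart R d) - specMat V (headPart R e)‖ ≤ N * (3 * N ^ 2 * c) := by
  have hN' : (1 : ℝ) ≤ N := by exact_mod_cast hN
  refine linfty_norm_le (by positivity) fun i j => ?_
  rw [Matrix.sub_apply, specMat_apply, specMat_apply, ← Finset.sum_sub_distrib]
  calc _ ≤ ∑ k : Fin N, |headPart R d k * (U k i * U k j) - headPart R e k * (V k i * V k j)| :=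
        Finset.abs_sum_le_sum_abs _ _
    _ ≤ ∑ _k : Fin N, 3 * N * c := by
        refine Finset.sum_le_sum fun k _ => ?_
        simp only [headPart]
        split_ifs with hk
        · have h1 := hUV k hk i
          have h2 := hUV k hk j
          have h3 := hde k hk
          have a1 := abs_entry_le_one hU k j
          have a2 := abs_entry_le_one hV k i
          have a3 := abs_entry_le_one hV k j
          have e1 : d k * (U k i * U k j) - e k * (V k i * V k j) =
              d k * ((U k i - V k i) * U k j) + d k * (V k i * (U k j - V k j))
                + (d k - e k) * (V k i * V k j) := by ring
          rw [e1]
          refine (abs_add_three _ _ _).trans ?_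
          simp only [abs_mul]
          have b1 : |d k| * (|U k i - V k i| * |U k j|) ≤ N * (c * 1) :=
            mul_le_mul (hd k) (mul_le_mul h1 a1 (abs_nonneg _) hc) (by positivity) (by positivity)
          have b2 : |d k| * (|V k i| * |U k j - V k j|) ≤ N * (1 * c) :=
            mul_le_mul (hd k) (mul_le_mul a2 h2 (abs_nonneg _) zero_le_one) (by positivity)
              (by positivity)
          have b3 : |d k - e k| * (|V k i| * |V k j|) ≤ c * (1 * 1) :=
            mul_le_mul h3 (mul_le_mul a2 a3 (abs_nonneg _) zero_le_one) (by positivity) hc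
          nlinarith
        · simp
          positivity
    _ = 3 * N ^ 2 * c := by simp; ring

/-- The exponent of the mesh of the rounding of eigenvalues and eigenvectors. -/
def meshExp (ℓ : ℕ) : ℕ := 4 * ℓ + 11

/-- On a set of graphs on which the leading eigenvalues and eigenvectors are almost constant and the
other eigenvalues are small, the cycle count of the barycentre is close to the cycle counts of the
graphs. -/
theorem abs_trace_mean_sub_le {ℓ N R : ℕ} (hℓ : 1 ≤ ℓ) (hN : 2 ≤ N) {τ p : ℝ}
    (hp : 0 < p) (hp1 : p < 1)
    (T : Finset (Edge N → Bool)) (U : (Edge N → Bool) → Matrix (Fin N) (Fin N) ℝ)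
    (d : (Edge N → Bool) → Fin N → ℝ)
    (hU : ∀ ω ∈ T, U ω * (U ω).transpose = 1)
    (hd : ∀ ω ∈ T, symMat (cubePoint ω) = specMat (U ω) (d ω))
    (hτ : ∀ ω ∈ T, ∑ k, |tailPart R (d ω) k| ^ ℓ ≤ τ)
    (hUU : ∀ ω ∈ T, ∀ ω' ∈ T, ∀ k : Fin N, k.val < R → ∀ i,
      |U ω k i - U ω' k i| ≤ 1 / (N : ℝ) ^ meshExp ℓ)
    (hdd : ∀ ω ∈ T, ∀ ω' ∈ T, ∀ k : Fin N, k.val < R →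
      |d ω k - d ω' k| ≤ 1 / (N : ℝ) ^ meshExp ℓ) {ω : Edge N → Bool} (hω : ω ∈ T) :
    |(symMat (cubeMean p T) ^ ℓ).trace - (symMat (cubePoint ω) ^ ℓ).trace| ≤ 2 * τ + 1 := by
  have hT : T.Nonempty := ⟨ω, hω⟩
  have hN2 : (2 : ℝ) ≤ N := by exact_mod_cast hN
  have : Nonempty (Fin N) := ⟨⟨0, by omega⟩⟩
  obtain ⟨n, rfl⟩ : ∃ n, ℓ = n + 1 := ⟨ℓ - 1, by omega⟩
  set w : (Edge N → Bool) → ℝ := fun ω => cubeWeight p ω / cubeProb p T with hw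
  have hw0 : ∀ ω ∈ T, 0 ≤ w ω := fun ω _ =>
    (div_pos (cubeWeight_pos hp hp1 ω) (cubeProb_pos hp hp1 hT)).le
  have hw1 : ∑ ω ∈ T, w ω = 1 := sum_cubeWeight_div hp hp1 hT
  set B := fun ω => specMat (U ω) (headPart R (d ω)) with hB
  set Z := fun ω => specMat (U ω) (tailPart R (d ω)) with hZ
  have hdN : ∀ ω ∈ T, ∀ k, |d ω k| ≤ N := fun ω hω k =>
    abs_eigenvalue_le (hU ω hω) (fun i j => by
      rw [← hd ω hω]; exact abs_symMat_cubePoint_le ω i j) k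
  have hmean : symMat (cubeMean p T) = ∑ ω ∈ T, w ω • (B ω + Z ω) := by
    have : cubeMean p T = fun e => ∑ ω ∈ T, w ω * cubePoint ω e := rfl
    rw [this, symMat_sum]
    refine Finset.sum_congr rfl fun ω hω => ?_
    rw [hd ω hω, hB, hZ]
    simp only
    rw [specMat_add, head_add_tail]
  have hBn : ∀ ω ∈ T, ‖B ω‖ ≤ (N : ℝ) ^ 2 := fun ω hω => by
    rw [sq]
    refine linfty_norm_le (by positivity) (abs_specMat_le (hU ω hω) fun k => ?_)
    simp only [headPart]
    split_ifs
    · exact hdN ω hω k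
    · simp
  have hZn : ∀ ω ∈ T, ‖Z ω‖ ≤ (N : ℝ) ^ 2 := fun ω hω => by
    rw [sq]
    refine linfty_norm_le (by positivity) (abs_specMat_le (hU ω hω) fun k => ?_)
    simp only [tailPart]
    split_ifs
    · simp
    · exact hdN ω hω k
  have hsplit := norm_average_pow_sub_le T w hw0 hw1 B Z (K := (N : ℝ) ^ 2)
    (η := N * (3 * N ^ 2 * (1 / (N : ℝ) ^ meshExp (n + 1)))) (by nlinarith) hBn hZn
    (fun ω hω => by
      simp only [hB, hZ]; rw [specMat_mul (hU ω hω), head_mul_tail, specMat_zero])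
    (fun ω hω => by
      simp only [hB, hZ]; rw [specMat_mul (hU ω hω), mul_comm, head_mul_tail, specMat_zero])
    (fun a ha b hb => norm_head_sub_le (hU a ha) (hU b hb) (hdN a ha) (by positivity)
      (hUU a ha b hb) (hdd a ha b hb) (by omega)) hω n
  rw [← hmean] at hsplit
  set Zm := ∑ ω ∈ T, w ω • Z ω with hZm
  have herr := abs_trace_le (symMat (cubeMean p T) ^ (n + 1) - B ω ^ (n + 1) - Zm ^ (n + 1))
  -- This inequality dictates `meshExp`: with ℓ = n + 1, 2 ≤ N and 3 ≤ N², the numerator is at most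
  -- N^(1 + 2(n+3) + (2n+8)) = N^(4ℓ + 11).
  have hsmall : (N : ℝ) * (2 * (3 * (N : ℝ) ^ 2) ^ (n + 2) *
      (N * (3 * N ^ 2 * (1 / (N : ℝ) ^ meshExp (n + 1))))) ≤ 1 := by
    have h3 : (3 : ℝ) ≤ (N : ℝ) ^ 2 := by nlinarith
    have e1 : (N : ℝ) * (2 * (3 * (N : ℝ) ^ 2) ^ (n + 2) *
        (N * (3 * N ^ 2 * (1 / (N : ℝ) ^ meshExp (n + 1))))) =
        2 * 3 ^ (n + 3) * (N : ℝ) ^ (2 * n + 8) / (N : ℝ) ^ meshExp (n + 1) := by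
      rw [mul_pow]
      field_simp
      ring
    rw [e1, div_le_one (by positivity)]
    calc 2 * 3 ^ (n + 3) * (N : ℝ) ^ (2 * n + 8)
        ≤ (N : ℝ) * ((N : ℝ) ^ 2) ^ (n + 3) * (N : ℝ) ^ (2 * n + 8) := by gcongr
      _ = (N : ℝ) ^ meshExp (n + 1) := by
          rw [← pow_mul, meshExp, ← pow_succ', ← pow_add]
          congr 1
          ring
  have herr1 : |(symMat (cubeMean p T) ^ (n + 1) - B ω ^ (n + 1) - Zm ^ (n + 1)).trace| ≤ 1 :=
    herr.trans ((mul_le_mul_of_nonneg_left hsplit (by positivity)).trans hsmall)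
  rw [Matrix.trace_sub, Matrix.trace_sub] at herr1
  have hZtr : |(Zm ^ (n + 1)).trace| ≤ τ := by
    refine (abs_trace_pow_sum_le T w hw0 hw1 U hU (fun ω => tailPart R (d ω)) (n + 1)).trans ?_
    calc _ ≤ ∑ ω ∈ T, w ω * τ := Finset.sum_le_sum fun ω hω =>
          mul_le_mul_of_nonneg_left (hτ ω hω) (hw0 ω hω)
      _ = τ := by rw [← Finset.sum_mul, hw1, one_mul]
  -- For ω itself the splitting is exact, so the leading parts cancel. The two tails contribute τ
  -- each and the splitting error contributes 1.
  have hωtr : (symMat (cubePoint ω) ^ (n + 1)).trace =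
      (B ω ^ (n + 1)).trace + ∑ k, tailPart R (d ω) k ^ (n + 1) := by
    rw [hd ω hω, trace_specMat_pow (hU ω hω), hB]
    simp only
    rw [trace_specMat_pow (hU ω hω), ← sum_pow_head_add_tail R (d ω) (by omega)]
  have htail : |∑ k, tailPart R (d ω) k ^ (n + 1)| ≤ τ := by
    refine (Finset.abs_sum_le_sum_abs _ _).trans (le_trans (le_of_eq ?_) (hτ ω hω))
    simp [abs_pow]
  rw [hωtr]
  rw [abs_le] at *
  constructor <;> linarith [herr1.1, herr1.2, hZtr.1, hZtr.2, htail.1, htail.2]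

/-- If all graphs in `S` have small eigenvalues beyond the first `R`, then the probability of `S` is
controlled, up to a factor for the rank `R` approximation, by the largest of the exponential rates at
matrices with almost the same cycle count as a member of `S`. -/
theorem cubeProb_le_of_small_tail {ℓ N R : ℕ} (hℓ : 1 ≤ ℓ) (hN : 2 ≤ N) (hR : R ≤ N) {τ p b : ℝ}
    (hp : 0 < p) (hp1 : p < 1) (hb : 0 ≤ b) (S : Finset (Edge N → Bool))
    (hS : ∀ ω ∈ S, ∃ (U : Matrix (Fin N) (Fin N) ℝ) (d : Fin N → ℝ), U * U.transpose = 1 ∧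
      symMat (cubePoint ω) = specMat U d ∧ ∑ k, |tailPart R d k| ^ ℓ ≤ τ)
    (hX : ∀ X ∈ weightedGraphs N, ∀ ω ∈ S,
      |(X ^ ℓ).trace - (symMat (cubePoint ω) ^ ℓ).trace| ≤ 2 * τ + 1 →
      Real.exp (-relEntropyMatrix p X) ≤ b) :
    cubeProb p S ≤ (N : ℝ) ^ ((meshExp ℓ + 3) * (N + 1) * R) * b := by
  choose! U d hU hd hτ using hS
  set c : ℝ := (N : ℝ) ^ meshExp ℓ with hc
  have hN2 : (2 : ℝ) ≤ N := by exact_mod_cast hN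
  have hcpos : 0 < c := by positivity
  -- For each of the R leading indices the code records N rounded eigenvector entries and one
  -- rounded eigenvalue, hence the factor (N + 1) * R in the exponent.
  set code : (Edge N → Bool) → (Fin R → (Fin N → ℤ) × ℤ) := fun ω k =>
    (fun i => ⌊U ω (Fin.castLE hR k) i * c⌋, ⌊d ω (Fin.castLE hR k) * c⌋) with hcode
  -- All recorded numbers are at most N in absolute value before scaling by N^meshExp.
  set I : Finset ℤ := Finset.Icc (-(N : ℤ) ^ (meshExp ℓ + 1)) ((N : ℤ) ^ (meshExp ℓ + 1)) with hI
  set codes : Finset (Fin R → (Fin N → ℤ) × ℤ) :=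
    Fintype.piFinset fun _ => (Fintype.piFinset fun _ => I) ×ˢ I with hcodes
  have hmemI : ∀ x : ℝ, |x| ≤ N → ⌊x * c⌋ ∈ I := by
    intro x hx
    rw [abs_le] at hx
    have h1 : -(N : ℝ) ^ (meshExp ℓ + 1) ≤ x * c := by
      rw [pow_succ', ← hc]; nlinarith
    have h2 : x * c ≤ (N : ℝ) ^ (meshExp ℓ + 1) := by
      rw [pow_succ', ← hc]; nlinarith
    rw [hI, Finset.mem_Icc]
    constructor
    · rw [Int.le_floor]
      push_cast
      exact h1
    · have := (Int.floor_le (x * c)).trans h2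
      exact_mod_cast this
  have hmaps : ∀ ω ∈ S, code ω ∈ codes := by
    intro ω hω
    rw [hcodes, Fintype.mem_piFinset]
    intro k
    rw [Finset.mem_product, Fintype.mem_piFinset]
    refine ⟨fun i => hmemI _ ?_, hmemI _ ?_⟩
    · exact (abs_entry_le_one (hU ω hω) _ _).trans (by linarith)
    · exact abs_eigenvalue_le (hU ω hω) (fun i j => by
        rw [← hd ω hω]; exact abs_symMat_cubePoint_le ω i j) _
  have hcardI : (I.card : ℝ) ≤ (N : ℝ) ^ (meshExp ℓ + 3) := by
    have hnat : I.card = 2 * N ^ (meshExp ℓ + 1) + 1 := by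
      rw [hI, Int.card_Icc]
      have : (N : ℤ) ^ (meshExp ℓ + 1) + 1 - -(N : ℤ) ^ (meshExp ℓ + 1) =
          ((2 * N ^ (meshExp ℓ + 1) + 1 : ℕ) : ℤ) := by push_cast; ring
      rw [this, Int.toNat_natCast]
    rw [hnat]
    push_cast
    have h1 : (1 : ℝ) ≤ (N : ℝ) ^ (meshExp ℓ + 1) := one_le_pow₀ (by linarith)
    have h2 : (N : ℝ) ^ (meshExp ℓ + 3) = (N : ℝ) ^ (meshExp ℓ + 1) * (N : ℝ) ^ 2 := by
      rw [← pow_add]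
    have h4 : (4 : ℝ) ≤ (N : ℝ) ^ 2 := by nlinarith
    have := mul_le_mul_of_nonneg_left h4 (zero_le_one.trans h1)
    rw [h2]
    linarith
  have hcard : (codes.card : ℝ) ≤ (N : ℝ) ^ ((meshExp ℓ + 3) * (N + 1) * R) := by
    have : (codes.card : ℝ) = ((I.card : ℝ) ^ (N + 1)) ^ R := by
      rw [hcodes, Fintype.card_piFinset]
      simp [pow_succ, Fintype.card_piFinset]
    rw [this, pow_mul, pow_mul]
    gcongr
  have hpiece : ∀ y ∈ codes, cubeProb p (S.filter fun ω => code ω = y) ≤ b := by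
    intro y _
    rcases Finset.eq_empty_or_nonempty (S.filter fun ω => code ω = y) with h | ⟨ω, hω⟩
    · rw [h]
      simpa [cubeProb] using hb
    · have hsub : ∀ ω ∈ S.filter fun ω => code ω = y, ω ∈ S := fun ω h => (Finset.mem_filter.1 h).1
      have hcd : ∀ ω ∈ S.filter (fun ω => code ω = y), ∀ ω' ∈ S.filter (fun ω => code ω = y),
          code ω = code ω' := fun ω h ω' h' =>
        (Finset.mem_filter.1 h).2.trans (Finset.mem_filter.1 h').2.symm
      have hclose := abs_trace_mean_sub_le hℓ hN (R := R) (τ := τ) hp hp1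
        (S.filter fun ω => code ω = y) U d (fun ω h => hU ω (hsub ω h)) (fun ω h => hd ω (hsub ω h))
        (fun ω h => hτ ω (hsub ω h))
        (fun ω h ω' h' k hk i => by
          have h1 := congrFun (congrArg Prod.fst (congrFun (hcd ω h ω' h') ⟨k.val, hk⟩)) i
          exact floor_close hcpos h1)
        (fun ω h ω' h' k hk => by
          have h1 := congrArg Prod.snd (congrFun (hcd ω h ω' h') ⟨k.val, hk⟩)
          exact floor_close hcpos h1) hω
      refine (cubeProb_le_exp_neg_relEntropy hp hp1 ⟨ω, hω⟩).trans ?_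
      rw [← relEntropyMatrix_symMat]
      exact hX _ (symMat_mem (cubeMean_mem hp hp1 ⟨ω, hω⟩)) ω (hsub ω hω) hclose
  calc cubeProb p S = ∑ y ∈ codes, cubeProb p (S.filter fun ω => code ω = y) :=
        (Finset.sum_fiberwise_of_maps_to hmaps _).symm
    _ ≤ ∑ _y ∈ codes, b := Finset.sum_le_sum hpiece
    _ = codes.card * b := by simp
    _ ≤ _ := by gcongr

end Partition

/-! ### The fourth moment of the centred adjacency matrix -/

section FourthMoment

variable {N : ℕ}

/-- The centred adjacency matrix. -/
noncomputable def centred (p : ℝ) (ω : Edge N → Bool) : Matrix (Fin N) (Fin N) ℝ :=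
  symMat fun e => cubePoint ω e - p

/-- The edge between two distinct vertices. -/
def mkEdge (i j : Fin N) (h : i ≠ j) : Edge N :=
  if h' : i < j then ⟨(i, j), h'⟩ else ⟨(j, i), lt_of_le_of_ne (not_lt.1 h') h.symm⟩

lemma symMat_of_ne (x : Edge N → ℝ) {i j : Fin N} (h : i ≠ j) :
    symMat x i j = x (mkEdge i j h) := by
  unfold symMat mkEdge
  rcases lt_or_gt_of_ne h with h' | h'
  · simp [h']
  · simp [h', h'.not_gt]

lemma mkEdge_ne {i j k l : Fin N} (h : i ≠ j) (h' : k ≠ l) (hne : s(k, l) ≠ s(i, j)) :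
    mkEdge k l h' ≠ mkEdge i j h := by
  intro heq
  apply hne
  have key : ∀ (a b : Fin N) (h : a ≠ b), s((mkEdge a b h).1.1, (mkEdge a b h).1.2) = s(a, b) := by
    intro a b h
    unfold mkEdge
    split_ifs
    · rfl
    · exact Sym2.eq_swap
  rw [← key k l h', ← key i j h, heq]

lemma centred_update_self (p : ℝ) (ω : Edge N → Bool) {i j : Fin N} (h : i ≠ j) (b : Bool) :
    centred p (Function.update ω (mkEdge i j h) b) i j = boolVal b - p := by
  simp [centred, symMat_of_ne _ h, cubePoint]

lemma centred_update_of_ne (p : ℝ) (ω : Edge N → Bool) {i j k l : Fin N} (h : i ≠ j) (b : Bool)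
    (hne : s(k, l) ≠ s(i, j)) :
    centred p (Function.update ω (mkEdge i j h) b) k l = centred p ω k l := by
  rcases eq_or_ne k l with rfl | h'
  · simp [centred, symMat_self]
  · simp [centred, symMat_of_ne _ h', cubePoint, Function.update_of_ne (mkEdge_ne h h' hne)]

lemma centred_self (p : ℝ) (ω : Edge N → Bool) (i : Fin N) : centred p ω i i = 0 := symMat_self _ i

/-- Expectation with respect to the `p`-biased measure on the cube. -/
noncomputable def cubeExp {ι : Type*} [Fintype ι] [DecidableEq ι] (p : ℝ) (F : (ι → Bool) → ℝ) :
    ℝ := ∑ ω, cubeWeight p ω * F ω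

lemma cubeExp_mono {p : ℝ} (hp : 0 < p) (hp1 : p < 1) {F G : (Edge N → Bool) → ℝ}
    (h : ∀ ω, F ω ≤ G ω) : cubeExp p F ≤ cubeExp p G :=
  Finset.sum_le_sum fun ω _ => mul_le_mul_of_nonneg_left (h ω) (cubeWeight_pos hp hp1 ω).le

lemma cubeExp_sum {α : Type*} (p : ℝ) (s : Finset α) (F : α → (Edge N → Bool) → ℝ) :
    cubeExp p (fun ω => ∑ a ∈ s, F a ω) = ∑ a ∈ s, cubeExp p (F a) := by
  unfold cubeExp
  simp_rw [Finset.mul_sum]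
  exact Finset.sum_comm

lemma cubeExp_const (p c : ℝ) : cubeExp p (fun _ : Edge N → Bool => c) = c := by
  rw [cubeExp, ← Finset.sum_mul, sum_cubeWeight, one_mul]

/-- Resampling the edge ij averages the centred entry to zero while `F` does not move. This is how
independence of edges is used. -/
lemma cubeExp_centred_mul (p : ℝ) {i j : Fin N} (h : i ≠ j) {F : (Edge N → Bool) → ℝ}
    (hF : ∀ ω b, F (Function.update ω (mkEdge i j h) b) = F ω) :
    cubeExp p (fun ω => centred p ω i j * F ω) = 0 := by
  rw [cubeExp, sum_cubeWeight_resample p (mkEdge i j h)]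
  refine Finset.sum_eq_zero fun ω _ => ?_
  simp only [centred_update_self, hF, boolVal, if_true, Bool.false_eq_true, if_false]
  ring

lemma cubeExp_centred_sq_mul (p : ℝ) {i j : Fin N} (h : i ≠ j) {F : (Edge N → Bool) → ℝ}
    (hF : ∀ ω b, F (Function.update ω (mkEdge i j h) b) = F ω) :
    cubeExp p (fun ω => centred p ω i j ^ 2 * F ω) = p * (1 - p) * cubeExp p F := by
  rw [cubeExp, sum_cubeWeight_resample p (mkEdge i j h), cubeExp, Finset.mul_sum]
  refine Finset.sum_congr rfl fun ω _ => ?_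
  simp only [centred_update_self, hF, boolVal, if_true, Bool.false_eq_true, if_false]
  ring

lemma cubeExp_centred_sq_le {p : ℝ} (hp : 0 < p) (i j : Fin N) :
    cubeExp p (fun ω => centred p ω i j ^ 2) ≤ p := by
  rcases eq_or_ne i j with rfl | h
  · simp only [centred_self]
    simpa [cubeExp] using hp.le
  · have := cubeExp_centred_sq_mul p h (F := fun _ => 1) (fun _ _ => rfl)
    simp only [mul_one, cubeExp_const] at this
    rw [this]
    nlinarith

lemma cubeExp_centred_sq_sq_le {p : ℝ} (hp : 0 < p) (hp1 : p < 1) {i j k l : Fin N}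
    (hne : s(k, l) ≠ s(i, j)) :
    cubeExp p (fun ω => centred p ω i j ^ 2 * centred p ω k l ^ 2) ≤ p ^ 2 := by
  rcases eq_or_ne i j with rfl | h
  · simp only [centred_self]
    simp [cubeExp]
    positivity
  · rw [cubeExp_centred_sq_mul p h (F := fun ω => centred p ω k l ^ 2)
      (fun ω b => by simp only [centred_update_of_ne p ω h b hne])]
    have h1 := cubeExp_centred_sq_le hp k l
    have h2 : 0 ≤ cubeExp p (fun ω => centred p ω k l ^ 2) :=
      Finset.sum_nonneg fun ω _ => mul_nonneg (cubeWeight_pos hp hp1 ω).le (sq_nonneg _)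
    calc p * (1 - p) * cubeExp p (fun ω => centred p ω k l ^ 2) ≤ p * 1 * p := by
          gcongr
          linarith
      _ = p ^ 2 := by ring

lemma centred_sq_le_one {p : ℝ} (hp : 0 < p) (hp1 : p < 1) (ω : Edge N → Bool) (i j : Fin N) :
    centred p ω i j ^ 2 ≤ 1 := by
  rcases eq_or_ne i j with rfl | h
  · simp [centred_self]
  · rw [centred, symMat_of_ne _ h]
    have := boolVal_mem (ω (mkEdge i j h))
    simp only [cubePoint]
    nlinarith [this.1, this.2]

/-- The trace of the fourth power of the centred adjacency matrix. -/
noncomputable def fourthTrace (p : ℝ) (ω : Edge N → Bool) : ℝ :=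
  ∑ i, ∑ k, (∑ j, centred p ω i j * centred p ω k j) ^ 2

/-- Distinct columns give independent squares, at most p² per pair; on the N diagonal pairs the
fourth moment is at most the second, hence at most p. -/
lemma cubeExp_row_le {p : ℝ} (hp : 0 < p) (hp1 : p < 1) (i : Fin N) :
    cubeExp p (fun ω => (∑ j, centred p ω i j * centred p ω i j) ^ 2) ≤ N ^ 2 * p ^ 2 + N * p := by
  have e : (fun ω => (∑ j, centred p ω i j * centred p ω i j) ^ 2) =
      fun ω => ∑ j, ∑ j', centred p ω i j ^ 2 * centred p ω i j' ^ 2 := by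
    funext ω
    rw [sq, Finset.sum_mul_sum]
    exact Finset.sum_congr rfl fun j _ => Finset.sum_congr rfl fun j' _ => by ring
  rw [e, cubeExp_sum]
  simp_rw [cubeExp_sum]
  have hterm : ∀ j j', cubeExp p (fun ω => centred p ω i j ^ 2 * centred p ω i j' ^ 2) ≤
      p ^ 2 + if j = j' then p else 0 := by
    intro j j'
    split_ifs with h
    · subst h
      have h1 : cubeExp p (fun ω => centred p ω i j ^ 2 * centred p ω i j ^ 2) ≤
          cubeExp p (fun ω => centred p ω i j ^ 2) := cubeExp_mono hp hp1 fun ω =>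
        mul_le_of_le_one_right (sq_nonneg _) (centred_sq_le_one hp hp1 ω i j)
      have := cubeExp_centred_sq_le hp i j
      nlinarith
    · rw [add_zero]
      refine cubeExp_centred_sq_sq_le hp hp1 ?_
      rw [Ne, Sym2.eq_iff]
      rintro (⟨-, h'⟩ | ⟨h1, h2⟩)
      · exact h h'.symm
      · exact h (h1.symm.trans h2.symm)
  calc _ ≤ ∑ j : Fin N, ∑ j' : Fin N, (p ^ 2 + if j = j' then p else 0) :=
        Finset.sum_le_sum fun j _ => Finset.sum_le_sum fun j' _ => hterm j j'
    _ = _ := by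
        simp [Finset.sum_add_distrib]
        ring

/-- For j ≠ j' the edge ij occurs exactly once in the product, unless some factor lies on the
diagonal and vanishes, so the expectation is zero. Only the N terms with j = j' survive. -/
lemma cubeExp_rows_le {p : ℝ} (hp : 0 < p) (hp1 : p < 1) {i k : Fin N} (hik : i ≠ k) :
    cubeExp p (fun ω => (∑ j, centred p ω i j * centred p ω k j) ^ 2) ≤ N * p ^ 2 := by
  have e : (fun ω => (∑ j, centred p ω i j * centred p ω k j) ^ 2) =
      fun ω => ∑ j, ∑ j', centred p ω i j * (centred p ω k j * centred p ω i j' *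
        centred p ω k j') := by
    funext ω
    rw [sq, Finset.sum_mul_sum]
    exact Finset.sum_congr rfl fun j _ => Finset.sum_congr rfl fun j' _ => by ring
  rw [e, cubeExp_sum]
  simp_rw [cubeExp_sum]
  have hterm : ∀ j j', cubeExp p (fun ω => centred p ω i j * (centred p ω k j * centred p ω i j' *
        centred p ω k j')) ≤ if j = j' then p ^ 2 else 0 := by
    intro j j'
    split_ifs with h
    · subst h
      have e2 : (fun ω => centred p ω i j * (centred p ω k j * centred p ω i j *
          centred p ω k j)) = fun ω => centred p ω i j ^ 2 * centred p ω k j ^ 2 := by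
        funext ω; ring
      rw [e2]
      refine cubeExp_centred_sq_sq_le hp hp1 ?_
      rw [Ne, Sym2.eq_iff]
      rintro (⟨h', -⟩ | ⟨h1, h2⟩)
      · exact hik h'.symm
      · exact hik (h2.symm.trans h1.symm)
    · rcases eq_or_ne k j with rfl | hkj
      · simp [centred_self, cubeExp]
      · rcases eq_or_ne i j with rfl | hij
        · simp [centred_self, cubeExp]
        · refine (cubeExp_centred_mul p hij fun ω b => ?_).le
          rw [centred_update_of_ne, centred_update_of_ne, centred_update_of_ne]
          · rw [Ne, Sym2.eq_iff]
            rintro (⟨h', -⟩ | ⟨h', -⟩)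
            · exact hik h'.symm
            · exact hkj h'
          · rw [Ne, Sym2.eq_iff]
            rintro (⟨-, h'⟩ | ⟨h', -⟩)
            · exact h h'.symm
            · exact hij h'
          · rw [Ne, Sym2.eq_iff]
            rintro (⟨h', -⟩ | ⟨h', -⟩)
            · exact hik h'.symm
            · exact hkj h'
  calc _ ≤ ∑ j : Fin N, ∑ j' : Fin N, (if j = j' then p ^ 2 else 0) :=
        Finset.sum_le_sum fun j _ => Finset.sum_le_sum fun j' _ => hterm j j'
    _ = _ := by simp

lemma cubeExp_fourthTrace_le {p : ℝ} (hp : 0 < p) (hp1 : p < 1) :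
    cubeExp p (fourthTrace (N := N) p) ≤ 2 * N ^ 3 * p ^ 2 + N ^ 2 * p := by
  have e : cubeExp p (fourthTrace (N := N) p) = ∑ i, ∑ k, cubeExp p (fun ω : Edge N → Bool =>
      (∑ j, centred p ω i j * centred p ω k j) ^ 2) := by
    unfold fourthTrace
    rw [cubeExp_sum]
    simp_rw [cubeExp_sum]
  rw [e]
  have hterm : ∀ i k : Fin N, cubeExp p (fun ω =>
      (∑ j, centred p ω i j * centred p ω k j) ^ 2) ≤
      N * p ^ 2 + if i = k then (N : ℝ) ^ 2 * p ^ 2 + N * p else 0 := by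
    intro i k
    split_ifs with h
    · subst h
      have := cubeExp_row_le hp hp1 i
      have : 0 ≤ (N : ℝ) * p ^ 2 := by positivity
      linarith
    · rw [add_zero]
      exact cubeExp_rows_le hp hp1 h
  calc _ ≤ ∑ i : Fin N, ∑ k : Fin N,
        ((N : ℝ) * p ^ 2 + if i = k then (N : ℝ) ^ 2 * p ^ 2 + N * p else 0) :=
        Finset.sum_le_sum fun i _ => Finset.sum_le_sum fun k _ => hterm i k
    _ = _ := by
        simp [Finset.sum_add_distrib]
        ring

/-- Markov's inequality: as Np ≥ 1, the expected fourth trace is at most 3N³p², less than half of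
8N³p². -/
lemma half_le_cubeProb_fourthTrace {p : ℝ} (hp : 0 < p) (hp1 : p < 1) (hNp : 1 ≤ N * p) :
    1 / 2 ≤ cubeProb p (Finset.univ.filter fun ω : Edge N → Bool =>
      fourthTrace p ω ≤ 8 * N ^ 3 * p ^ 2) := by
  set c : ℝ := 8 * N ^ 3 * p ^ 2 with hc
  have hNpos : (0 : ℝ) < N := by
    by_contra h
    push Not at h
    nlinarith
  have hcpos : 0 < c := by positivity
  have hE := cubeExp_fourthTrace_le (N := N) hp hp1
  have hsplit := Finset.sum_filter_add_sum_filter_not (Finset.univ : Finset (Edge N → Bool))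
    (fun ω => fourthTrace p ω ≤ c) (cubeWeight p)
  rw [sum_cubeWeight] at hsplit
  have hmarkov : c * ∑ ω ∈ Finset.univ.filter (fun ω : Edge N → Bool => ¬ fourthTrace p ω ≤ c),
      cubeWeight p ω ≤ cubeExp p (fourthTrace (N := N) p) := by
    rw [Finset.mul_sum, cubeExp]
    refine (Finset.sum_le_sum fun ω hω => ?_).trans (Finset.sum_le_sum_of_subset_of_nonneg
      (Finset.filter_subset _ _) fun ω _ _ => mul_nonneg (cubeWeight_pos hp hp1 ω).le ?_)
    · have := (Finset.mem_filter.1 hω).2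
      push Not at this
      rw [mul_comm]
      exact mul_le_mul_of_nonneg_left this.le (cubeWeight_pos hp hp1 ω).le
    · exact Finset.sum_nonneg fun i _ => Finset.sum_nonneg fun k _ => sq_nonneg _
  have h1 : (N : ℝ) ^ 2 * p ≤ N ^ 3 * p ^ 2 := by
    have : (N : ℝ) ^ 3 * p ^ 2 = N ^ 2 * p * (N * p) := by ring
    rw [this]
    exact le_mul_of_one_le_right (by positivity) hNp
  have h2 : c * ∑ ω ∈ Finset.univ.filter (fun ω : Edge N → Bool => ¬ fourthTrace p ω ≤ c),
      cubeWeight p ω ≤ c * (1 / 2) := by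
    refine hmarkov.trans (hE.trans ?_)
    rw [hc]
    nlinarith
  have h3 := le_of_mul_le_mul_left h2 hcpos
  unfold cubeProb
  linarith

end FourthMoment

/-! ### Eigenvalue bounds outside a set of small probability -/

section Eigenvalues

variable {N : ℕ}

/-- The Frobenius inner product. -/
noncomputable def frob (A B : Matrix (Fin N) (Fin N) ℝ) : ℝ := ∑ i, ∑ j, A i j * B i j

lemma frob_le (A B : Matrix (Fin N) (Fin N) ℝ) : frob A B ≤ √(frob A A) * √(frob B B) := by
  have h := Real.sum_mul_le_sqrt_mul_sqrt (Finset.univ : Finset (Fin N × Fin N))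
    (fun x => A x.1 x.2) (fun x => B x.1 x.2)
  simp only [Fintype.sum_prod_type, sq] at h
  exact h

lemma frob_eq_trace (A B : Matrix (Fin N) (Fin N) ℝ) : frob A B = (A * B.transpose).trace := by
  simp [frob, Matrix.trace, Matrix.mul_apply]

lemma frob_specMat {U : Matrix (Fin N) (Fin N) ℝ} (hU : U * U.transpose = 1) (d e : Fin N → ℝ) :
    frob (specMat U d) (specMat U e) = ∑ k, d k * e k := by
  rw [frob_eq_trace, (specMat_isSymm U e).eq, specMat_mul hU, trace_specMat hU]
  rfl

lemma frob_add_left (A B C : Matrix (Fin N) (Fin N) ℝ) : frob (A + B) C = frob A C + frob B C := by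
  simp [frob, add_mul, Finset.sum_add_distrib]

lemma frob_symMat_self (x : Edge N → ℝ) : frob (symMat x) (symMat x) = 2 * ∑ e, x e ^ 2 := by
  have h1 : ∀ i j, symMat x i j * symMat x i j =
      (if i < j then symMat x i j ^ 2 else 0) + (if j < i then symMat x j i ^ 2 else 0) := by
    intro i j
    rcases lt_trichotomy i j with h | h | h
    · simp [h, h.not_gt, sq]
    · simp [h, symMat_self]
    · simp [h, h.not_gt, sq, symMat_comm x j i]
  have h2 : ∑ i, ∑ j, (if i < j then symMat x i j ^ 2 else 0) = ∑ e, x e ^ 2 := by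
    rw [← Fintype.sum_prod_type' (f := fun i j => if i < j then symMat x i j ^ 2 else 0),
      ← Finset.sum_filter, ← Finset.sum_subtype_eq_sum_filter]
    simp only [Finset.subtype_univ]
    exact Finset.sum_congr rfl fun e _ => by rw [symMat_edge]
  unfold frob
  simp_rw [h1, Finset.sum_add_distrib]
  rw [h2, Finset.sum_comm, h2]
  ring

/-- A Schatten norm comparison: the diagonal of a symmetric matrix in any orthonormal basis has
fourth moment at most the trace of the fourth power. -/
lemma sum_diag_pow_four_le {U M : Matrix (Fin N) (Fin N) ℝ} (hU : U * U.transpose = 1)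
    (hM : M.IsSymm) :
    ∑ l, ((U * M * U.transpose) l l) ^ 4 ≤ ∑ i, ∑ k, (∑ j, M i j * M k j) ^ 2 := by
  set Q := U * M * U.transpose with hQ
  have hQs : Q.transpose = Q := by
    rw [hQ, Matrix.transpose_mul, Matrix.transpose_mul, Matrix.transpose_transpose, hM.eq,
      Matrix.mul_assoc]
  have hU' : U.transpose * U = 1 := mul_eq_one_comm.1 hU
  have hQ2 : Q * Q = U * (M * M) * U.transpose := by
    calc Q * Q = U * M * (U.transpose * U) * M * U.transpose := by
          rw [hQ]; simp only [Matrix.mul_assoc]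
      _ = _ := by rw [hU', Matrix.mul_one]; simp only [Matrix.mul_assoc]
  have hrow : ∀ (C : Matrix (Fin N) (Fin N) ℝ) l, C l l ^ 2 ≤ (C * C.transpose) l l := by
    intro C l
    rw [Matrix.mul_apply]
    simp only [Matrix.transpose_apply, ← sq]
    exact Finset.single_le_sum (f := fun j => C l j ^ 2) (fun _ _ => sq_nonneg _)
      (Finset.mem_univ l)
  have hsymm2 : (Q * Q).transpose = Q * Q := by rw [Matrix.transpose_mul, hQs]
  -- The square of a diagonal entry is at most the sum of squares of its row; this is applied to Q
  -- and then to Q².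
  calc ∑ l, Q l l ^ 4 ≤ ∑ l, ((Q * Q) * (Q * Q).transpose) l l := by
        refine Finset.sum_le_sum fun l _ => ?_
        have h1 := hrow Q l
        rw [hQs] at h1
        have h2 := hrow (Q * Q) l
        calc Q l l ^ 4 = (Q l l ^ 2) ^ 2 := by ring
          _ ≤ ((Q * Q) l l) ^ 2 := pow_le_pow_left₀ (sq_nonneg _) h1 2
          _ ≤ _ := h2
    _ = ((Q * Q) * (Q * Q)).trace := by rw [hsymm2]; rfl
    _ = ((M * M) * (M * M)).trace := by
        rw [hQ2]
        calc _ = (U * ((M * M) * (U.transpose * U) * (M * M) * U.transpose)).trace := by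
              simp only [Matrix.mul_assoc]
          _ = _ := by
              rw [hU', Matrix.mul_one, Matrix.trace_mul_comm, Matrix.mul_assoc, hU', Matrix.mul_one]
    _ = ((M * M.transpose) * (M * M.transpose).transpose).trace := by
        rw [Matrix.transpose_mul, Matrix.transpose_transpose, hM.eq]
    _ = _ := by
        rw [← frob_eq_trace, frob]
        simp [Matrix.mul_apply, sq]

lemma frob_specMat_right (M U : Matrix (Fin N) (Fin N) ℝ) (d : Fin N → ℝ) :
    frob M (specMat U d) = ∑ k, d k * (U * M * U.transpose) k k := by
  rw [frob_eq_trace, (specMat_isSymm U d).eq, specMat]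
  calc _ = (M * U.transpose * Matrix.diagonal d * U).trace := by simp only [Matrix.mul_assoc]
    _ = (U * M * U.transpose * Matrix.diagonal d).trace := by
        rw [Matrix.trace_mul_comm]; simp only [Matrix.mul_assoc]
    _ = _ := by
        simp [Matrix.trace, Matrix.mul_diagonal, mul_comm]

/-- A graph with small centred fourth trace has small inner product with matrices of rank `r`. -/
lemma frob_head_le {p : ℝ} (hp : 0 < p) {U : Matrix (Fin N) (Fin N) ℝ} (hU : U * U.transpose = 1)
    (d : Fin N → ℝ) (r : ℕ) (ω : Edge N → Bool) {T : ℝ} (hT : fourthTrace p ω ≤ T) :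
    frob (symMat (cubePoint ω)) (specMat U (headPart r d)) ≤
      (p * N + √(√r) * √(√T)) * √(∑ k, headPart r d k ^ 2) := by
  have hT0 : 0 ≤ T := le_trans
    (Finset.sum_nonneg fun i _ => Finset.sum_nonneg fun k _ => sq_nonneg _) hT
  have e1 : symMat (cubePoint ω) = centred p ω + symMat fun _ => p := by
    ext i j
    rw [Matrix.add_apply, centred]
    unfold symMat
    split_ifs <;> simp
  have hYY : frob (specMat U (headPart r d)) (specMat U (headPart r d)) =
      ∑ k, headPart r d k ^ 2 := by
    rw [frob_specMat hU]
    simp [sq]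
  set s := √(∑ k, headPart r d k ^ 2) with hs
  have h1 : frob (symMat fun _ : Edge N => p) (specMat U (headPart r d)) ≤ p * N * s := by
    refine (frob_le _ _).trans ?_
    rw [hYY, ← hs]
    refine mul_le_mul_of_nonneg_right ?_ (Real.sqrt_nonneg _)
    rw [Real.sqrt_le_left (by positivity)]
    calc frob (symMat fun _ : Edge N => p) (symMat fun _ : Edge N => p)
        ≤ ∑ _i : Fin N, ∑ _j : Fin N, p ^ 2 := by
          refine Finset.sum_le_sum fun i _ => Finset.sum_le_sum fun j _ => ?_
          rcases eq_or_ne i j with rfl | h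
          · rw [symMat_self]; simp; positivity
          · rw [symMat_of_ne _ h, sq]
      _ = (p * N) ^ 2 := by simp; ring
  have h2 : frob (centred p ω) (specMat U (headPart r d)) ≤ √(√r) * √(√T) * s := by
    set m := fun k => (U * centred p ω * U.transpose) k k with hm
    set F := Finset.univ.filter fun k : Fin N => k.val < r with hF
    have hFc : (F.card : ℝ) ≤ r := by
      have : F.card ≤ r := by
        calc F.card = (F.map Fin.valEmbedding).card := (Finset.card_map _).symm
          _ ≤ (Finset.range r).card := by
              refine Finset.card_le_card fun x hx => ?_
              simp only [hF, Finset.mem_map, Finset.mem_filter] at hx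
              obtain ⟨k, ⟨-, hk⟩, rfl⟩ := hx
              exact Finset.mem_range.2 hk
          _ = r := Finset.card_range r
      exact_mod_cast this
    have h4 : ∑ k, m k ^ 4 ≤ T := (sum_diag_pow_four_le hU (symMat_isSymm _)).trans hT
    -- Cauchy–Schwarz over at most r indices converts the fourth moment bound into a second moment
    -- bound, whence the fourth roots of r and T.
    have hm2 : ∑ k ∈ F, m k ^ 2 ≤ √r * √T := by
      have hcs := Real.sum_mul_le_sqrt_mul_sqrt F (fun _ => (1 : ℝ)) (fun k => m k ^ 2)
      simp only [one_mul, one_pow, Finset.sum_const, nsmul_eq_mul, mul_one] at hcs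
      refine hcs.trans (mul_le_mul (Real.sqrt_le_sqrt hFc) (Real.sqrt_le_sqrt ?_)
        (Real.sqrt_nonneg _) (Real.sqrt_nonneg _))
      calc ∑ k ∈ F, (m k ^ 2) ^ 2 = ∑ k ∈ F, m k ^ 4 := Finset.sum_congr rfl fun k _ => by ring
        _ ≤ ∑ k, m k ^ 4 := Finset.sum_le_sum_of_subset_of_nonneg (Finset.subset_univ F)
            fun k _ _ => by positivity
        _ ≤ T := h4
    rw [frob_specMat_right]
    have e2 : ∑ k, headPart r d k * (U * centred p ω * U.transpose) k k =
        ∑ k ∈ F, headPart r d k * m k := by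
      rw [hF, Finset.sum_filter]
      refine Finset.sum_congr rfl fun k _ => ?_
      simp only [headPart]
      split_ifs <;> simp [hm]
    rw [e2]
    refine (Real.sum_mul_le_sqrt_mul_sqrt F _ _).trans ?_
    rw [mul_comm]
    refine mul_le_mul ?_ (Real.sqrt_le_sqrt ?_) (Real.sqrt_nonneg _) (by positivity)
    · rw [← Real.sqrt_mul (Real.sqrt_nonneg _)]
      exact Real.sqrt_le_sqrt hm2
    · exact Finset.sum_le_sum_of_subset_of_nonneg (Finset.filter_subset _ _)
        fun k _ _ => sq_nonneg _
  rw [e1, frob_add_left]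
  nlinarith

/-- Outside a set of probability `2 exp (-h)`, all eigenvalues of the adjacency matrix are
controlled. -/
theorem exists_eigenvalue_bound {p : ℝ} (hp : 0 < p) (hp1 : p < 1) (hNp : 1 ≤ N * p) {h : ℝ} :
    ∃ B : Finset (Edge N → Bool), cubeProb p B ≤ 2 * Real.exp (-h) ∧
      ∀ ω ∉ B, ∀ (U : Matrix (Fin N) (Fin N) ℝ) (d : Fin N → ℝ), U * U.transpose = 1 →
        symMat (cubePoint ω) = specMat U d → (Antitone fun k => |d k|) → ∀ k : Fin N,
        |d k| * √(k.val + 1 : ℝ) ≤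
          √(32 * h) + p * N + √(√(k.val + 1 : ℝ)) * √(√(8 * N ^ 3 * p ^ 2)) := by
  set T : ℝ := 8 * N ^ 3 * p ^ 2 with hT
  obtain ⟨B, hB, hfar⟩ := cubeProb_far_from_convexHull hp hp1 _
    (half_le_cubeProb_fourthTrace (N := N) hp hp1 hNp) h
  refine ⟨B, hB, fun ω hω U d hU hA hd k => ?_⟩
  obtain ⟨z, hz, hdist⟩ := hfar ω hω
  set r := k.val + 1 with hr
  set Y := specMat U (headPart r d) with hY
  set s := √(∑ k, headPart r d k ^ 2) with hs
  have hs0 : 0 ≤ s := Real.sqrt_nonneg _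
  have hss : s * s = ∑ k, headPart r d k ^ 2 :=
    Real.mul_self_sqrt (Finset.sum_nonneg fun _ _ => sq_nonneg _)
  have hYY : frob Y Y = ∑ k, headPart r d k ^ 2 := by
    rw [hY, frob_specMat hU]
    simp [sq]
  have hAY : frob (symMat (cubePoint ω)) Y = s * s := by
    rw [hA, hY, frob_specMat hU, hss]
    refine Finset.sum_congr rfl fun k _ => ?_
    simp only [headPart]
    split_ifs <;> simp [sq]
  -- The inner product with the fixed matrix Y is linear in z, so the bound passes from typical
  -- graphs to their convex hull. Y depends on the atypical graph ω, which is allowed because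
  -- `frob_head_le` holds for all Y of this form.
  have hzY : frob (symMat z) Y ≤ (p * N + √(√r) * √(√T)) * s := by
    have hsub : convexHull ℝ (cubePoint '' ((Finset.univ.filter fun ω : Edge N → Bool =>
        fourthTrace p ω ≤ T : Finset (Edge N → Bool)) : Set (Edge N → Bool))) ⊆
        {z | frob (symMat z) Y ≤ (p * N + √(√r) * √(√T)) * s} := by
      refine convexHull_min ?_ ?_
      · rintro _ ⟨ω', hω', rfl⟩
        refine frob_head_le hp hU d r ω' ?_
        simpa using hω'
      · refine convex_halfSpace_le ⟨fun x y => ?_, fun c x => ?_⟩ _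
        · rw [← frob_add_left]
          congr 1
          ext i j
          rw [Matrix.add_apply]
          unfold symMat
          split_ifs <;> simp
        · rw [frob, frob, Finset.smul_sum]
          refine Finset.sum_congr rfl fun i _ => ?_
          rw [Finset.smul_sum]
          refine Finset.sum_congr rfl fun j _ => ?_
          rw [smul_eq_mul, ← mul_assoc]
          congr 1
          unfold symMat
          split_ifs <;> simp
    exact hsub hz
  -- 32 is twice 16: the Frobenius norm counts every edge twice.
  have hdiff : frob (symMat fun e => cubePoint ω e - z e) Y ≤ √(32 * h) * s := by
    refine (frob_le _ _).trans ?_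
    rw [hYY, ← hs]
    refine mul_le_mul_of_nonneg_right (Real.sqrt_le_sqrt ?_) hs0
    rw [frob_symMat_self]
    unfold sqDist at hdist
    linarith
  have hsplit : symMat (cubePoint ω) = (symMat fun e => cubePoint ω e - z e) + symMat z := by
    ext i j
    rw [Matrix.add_apply]
    unfold symMat
    split_ifs <;> simp
  have hmain : s * s ≤ (√(32 * h) + p * N + √(√r) * √(√T)) * s := by
    rw [← hAY, hsplit, frob_add_left]
    linarith
  have hsle : s ≤ √(32 * h) + p * N + √(√r) * √(√T) := by
    rcases hs0.eq_or_lt with h0 | h0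
    · rw [← h0]; positivity
    · exact le_of_mul_le_mul_right hmain h0
  -- The r = k + 1 leading eigenvalues are all at least |d k| in absolute value.
  have hlow : |d k| * √(r : ℝ) ≤ s := by
    refine Real.le_sqrt_of_sq_le ?_
    rw [mul_pow, Real.sq_sqrt (by positivity), sq_abs]
    have hcard : ((Finset.univ.filter fun l : Fin N => l.val < r).card : ℝ) = r := by
      have : (Finset.univ.filter fun l : Fin N => l.val < r).card = r := by
        have e : (Finset.univ.filter fun l : Fin N => l.val < r) = Finset.Iic k := by
          ext l
          rw [Finset.mem_filter, Finset.mem_Iic, Fin.le_def]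
          simp only [Finset.mem_univ, true_and]
          omega
        rw [e, Fin.card_Iic]
      exact_mod_cast this
    calc d k ^ 2 * r = ∑ l ∈ Finset.univ.filter (fun l : Fin N => l.val < r), d k ^ 2 := by
          rw [Finset.sum_const, nsmul_eq_mul, hcard, mul_comm]
      _ ≤ ∑ l ∈ Finset.univ.filter (fun l : Fin N => l.val < r), headPart r d l ^ 2 := by
          refine Finset.sum_le_sum fun l hl => ?_
          have hl' := (Finset.mem_filter.1 hl).2
          simp only [headPart, hl', if_true]
          rw [sq_le_sq]
          exact hd (by rw [Fin.le_def]; omega)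
      _ ≤ _ := Finset.sum_le_sum_of_subset_of_nonneg (Finset.filter_subset _ _)
          fun _ _ _ => sq_nonneg _
  have := hlow.trans hsle
  rw [hr] at this
  push_cast at this
  exact this

end Eigenvalues

/-! ### Tail bounds for a fixed number of vertices -/

/-- The probability of an event, given a small exceptional set, a bound for the tails of the spectra
outside of it, and a lower bound `φ` for the relative entropy of all matrices with almost the same
cycle count as a graph in the event. -/
theorem binomialRandom_le_exp {ℓ N R : ℕ} (hℓ : 1 ≤ ℓ) (hN : 2 ≤ N) (hR : R ≤ N) {τ E h : ℝ}
    {q : unitInterval} (hq : 0 < (q : ℝ)) (hq1 : (q : ℝ) < 1) (S : Set (SimpleGraph (Fin N)))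
    (φ : EReal) (B : Finset (Edge N → Bool)) (hB : cubeProb (q : ℝ) B ≤ 2 * Real.exp (-h))
    (hφ : φ ≤ h)
    (hS : ∀ ω ∉ B, ∃ (U : Matrix (Fin N) (Fin N) ℝ) (d : Fin N → ℝ), U * U.transpose = 1 ∧
      symMat (cubePoint ω) = specMat U d ∧ ∑ k, |tailPart R d k| ^ ℓ ≤ τ)
    (hX : ∀ X ∈ weightedGraphs N, ∀ ω : Edge N → Bool, cubeGraph ω ∈ S →
      |(X ^ ℓ).trace - (symMat (cubePoint ω) ^ ℓ).trace| ≤ 2 * τ + 1 →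
      φ ≤ (relEntropyMatrix (q : ℝ) X : EReal))
    (hE : (N : ℝ) ^ ((meshExp ℓ + 3) * (N + 1) * R) + 2 ≤ Real.exp E) :
    SimpleGraph.binomialRandom (Fin N) q S ≤ EReal.exp (-φ + (E : EReal)) := by
  classical
  rw [EReal.exp_add, EReal.exp_coe]
  -- An infinite right-hand side makes the bound trivial; otherwise one works with real numbers.
  rcases eq_or_ne (EReal.exp (-φ)) ⊤ with htop | htop
  · rw [htop, ENNReal.top_mul]
    · exact le_top
    · simpa using Real.exp_pos E
  set b := (EReal.exp (-φ)).toReal with hb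
  have hb0 : 0 ≤ b := ENNReal.toReal_nonneg
  have hofb : ENNReal.ofReal b = EReal.exp (-φ) := ENNReal.ofReal_toReal htop
  have hle : ∀ x : ℝ, φ ≤ (x : EReal) → Real.exp (-x) ≤ b := by
    intro x hx
    rw [← ENNReal.ofReal_le_ofReal_iff hb0, hofb]
    have : EReal.exp ((-x : ℝ) : EReal) ≤ EReal.exp (-φ) := by
      refine EReal.exp_monotone ?_
      rw [EReal.coe_neg]
      exact EReal.neg_le_neg_iff.2 hx
    rwa [EReal.exp_coe] at this
  set F := Finset.univ.filter fun ω : Edge N → Bool => cubeGraph ω ∈ S with hF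
  have hgood : cubeProb (q : ℝ) (F \ B) ≤
      (N : ℝ) ^ ((meshExp ℓ + 3) * (N + 1) * R) * b := by
    refine cubeProb_le_of_small_tail hℓ hN hR hq hq1 hb0 (F \ B)
      (fun ω hω => hS ω (Finset.mem_sdiff.1 hω).2) fun X hXw ω hω hdist => hle _ ?_
    exact hX X hXw ω (by simpa [hF] using (Finset.mem_sdiff.1 hω).1) hdist
  have htotal : cubeProb (q : ℝ) F ≤ Real.exp E * b := by
    have h1 : cubeProb (q : ℝ) F ≤ cubeProb (q : ℝ) (F \ B) + cubeProb (q : ℝ) B := by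
      have h2 : F ⊆ (F \ B) ∪ B := by
        intro ω hω
        by_cases h : ω ∈ B <;> simp [h, hω]
      refine (cubeProb_mono hq hq1 h2).trans_eq ?_
      exact Finset.sum_union Finset.sdiff_disjoint
    -- Since φ ≤ h, the exceptional set costs at most twice exp(-φ), which is the summand 2 in `hE`.
    have h3 : cubeProb (q : ℝ) B ≤ 2 * b := hB.trans (by linarith [hle h hφ])
    calc _ ≤ (N : ℝ) ^ ((meshExp ℓ + 3) * (N + 1) * R) * b + 2 * b := by linarith
      _ = ((N : ℝ) ^ ((meshExp ℓ + 3) * (N + 1) * R) + 2) * b := by ring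
      _ ≤ _ := mul_le_mul_of_nonneg_right hE hb0
  refine (binomialRandom_le q hq hq1 S).trans ?_
  rw [← hofb, mul_comm, ← ENNReal.ofReal_mul (Real.exp_pos E).le]
  exact ENNReal.ofReal_le_ofReal htotal

/-! ### Upper bounds for the rate functions -/

lemma relEntropy_self {p : ℝ} (hp : 0 < p) (hp1 : p < 1) : relEntropy p p = 0 := by
  rw [relEntropy, div_self hp.ne', div_self (by linarith)]
  simp

lemma relEntropy_one (p : ℝ) : relEntropy p 1 = Real.log (1 / p) := by simp [relEntropy]

lemma relEntropy_zero (p : ℝ) : relEntropy p 0 = Real.log (1 / (1 - p)) := by simp [relEntropy]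

lemma card_edge_le (N : ℕ) : (Fintype.card (Edge N) : ℝ) ≤ (N : ℝ) ^ 2 / 2 := by
  rw [card_edge, Nat.cast_choose_two]
  have : (0 : ℝ) ≤ N := by positivity
  nlinarith

/-- The edge weights of a clique on the first `m` vertices in a graph of density `p`. -/
noncomputable def cliqueWeight (N m : ℕ) (p : ℝ) (e : Edge N) : ℝ := if e.1.2.val < m then 1 else p

/-- Only pairs inside the clique cost entropy, log(1/p) each; the pair is inside as soon as its
larger endpoint is below m. -/
lemma relEntropyMatrix_clique_le {N m : ℕ} {p : ℝ} (hp : 0 < p) (hp1 : p < 1) :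
    relEntropyMatrix p (symMat (cliqueWeight N m p)) ≤ (m : ℝ) ^ 2 * Real.log (1 / p) := by
  have hL : 0 ≤ Real.log (1 / p) := Real.log_nonneg (by rw [le_div_iff₀ hp]; linarith)
  rw [relEntropyMatrix_symMat]
  have h1 : ∀ e : Edge N, relEntropy p (cliqueWeight N m p e) =
      if e.1.2.val < m then Real.log (1 / p) else 0 := by
    intro e
    unfold cliqueWeight
    split_ifs
    · exact relEntropy_one p
    · exact relEntropy_self hp hp1
  simp_rw [h1]
  rw [← Finset.sum_filter, Finset.sum_const, nsmul_eq_mul]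
  refine mul_le_mul_of_nonneg_right ?_ hL
  have hcard : (Finset.univ.filter fun e : Edge N => e.1.2.val < m).card ≤ m ^ 2 := by
    have : (Finset.univ.filter fun e : Edge N => e.1.2.val < m).card ≤
        (Finset.range m ×ˢ Finset.range m).card := by
      refine Finset.card_le_card_of_injOn (fun e => (e.1.1.val, e.1.2.val)) ?_ ?_
      · intro e he
        have h2 : e.1.2.val < m := (Finset.mem_filter.1 he).2
        have h3 : e.1.1.val < e.1.2.val := e.2
        simp only [Finset.coe_product, Finset.coe_range, Set.mem_prod, Set.mem_Iio]
        omega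
      · intro e _ e' _ h
        rw [Prod.mk.injEq] at h
        exact Subtype.ext (Prod.ext (Fin.ext h.1) (Fin.ext h.2))
    simpa [sq] using this
  exact_mod_cast hcard

lemma cliqueWeight_mem {N m : ℕ} {p : ℝ} (hp : 0 < p) (hp1 : p < 1) (e : Edge N) :
    cliqueWeight N m p e ∈ Set.Icc (0 : ℝ) 1 := by
  unfold cliqueWeight
  split_ifs
  · simp
  · exact ⟨hp.le, hp1.le⟩

/-- Each injective map into the clique contributes exactly 1, and all other maps contribute
nonnegatively. Injectivity keeps the images of edges off the zero diagonal. -/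
lemma descFactorial_le_homMatrix_clique {n N m : ℕ} (H : SimpleGraph (Fin n)) (hm : m ≤ N) {p : ℝ}
    (hp : 0 < p) (hp1 : p < 1) :
    (m.descFactorial n : ℝ) ≤ homMatrix H (symMat (cliqueWeight N m p)) := by
  classical
  have hnn : ∀ i j, 0 ≤ symMat (cliqueWeight N m p) i j := fun i j =>
    ((symMat_mem (cliqueWeight_mem (m := m) hp hp1)).2.1 i j).1
  have hone : ∀ i j : Fin N, i ≠ j → i.val < m → j.val < m →
      symMat (cliqueWeight N m p) i j = 1 := by
    intro i j hij hi hj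
    rw [symMat_of_ne _ hij, cliqueWeight, mkEdge]
    split_ifs <;> simp_all
  let g : (Fin n ↪ Fin m) ↪ (Fin n → Fin N) :=
    ⟨fun f v => Fin.castLE hm (f v), fun f f' h => by
      ext v
      have := congrArg Fin.val (congrFun h v)
      simpa using this⟩
  unfold homMatrix
  calc (m.descFactorial n : ℝ) = ∑ _f : Fin n ↪ Fin m, (1 : ℝ) := by
        simp [Fintype.card_embedding_eq]
    _ ≤ ∑ f : Fin n ↪ Fin m, ∏ e : Fin n × Fin n with e.1 < e.2 ∧ H.Adj e.1 e.2,
          symMat (cliqueWeight N m p) (g f e.1) (g f e.2) := by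
        refine Finset.sum_le_sum fun f _ => le_of_eq ?_
        symm
        refine Finset.prod_eq_one fun e he => ?_
        have hne : e.1 ≠ e.2 := (Finset.mem_filter.1 he).2.1.ne
        refine hone _ _ ?_ (f e.1).2 (f e.2).2
        intro h
        exact hne (f.injective (Fin.castLE_injective hm h))
    _ = ∑ f ∈ (Finset.univ.map g), ∏ e : Fin n × Fin n with e.1 < e.2 ∧ H.Adj e.1 e.2,
          symMat (cliqueWeight N m p) (f e.1) (f e.2) := by rw [Finset.sum_map]
    _ ≤ _ := by
        refine Finset.sum_le_sum_of_subset_of_nonneg (Finset.subset_univ _) fun f _ _ =>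
          Finset.prod_nonneg fun e _ => hnn _ _

/-- Planting a clique bounds the upper-tail rate. -/
theorem upperRate_le {ℓ N K : ℕ} (hℓ : 3 ≤ ℓ) {p t : ℝ} (hp : 0 < p) (hp1 : p < 1)
    (hNp : 1 ≤ N * p) (hK1 : 1 ≤ K) (hK : t ≤ K) (hpK : (K + ℓ + 1) * p ≤ 1) :
    upperRate (SimpleGraph.cycleGraph ℓ) N p t ≤
      (((K + ℓ + 1) ^ 2 * (N ^ 2 * p ^ 2 * Real.log (1 / p)) : ℝ) : EReal) := by
  -- The extra ℓ gives m + 1 - ℓ ≥ K N p, so that the falling factorial exceeds (K N p)^ℓ ≥ t (N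
  -- p)^ℓ. As Np ≥ 1, the rounding and the ℓ fit into (K + ℓ + 1) N p.
  set m := ⌈(K : ℝ) * (N * p)⌉₊ + ℓ with hm
  have hK1' : (1 : ℝ) ≤ K := by exact_mod_cast hK1
  have hceil := Nat.ceil_lt_add_one (a := (K : ℝ) * (N * p)) (by positivity)
  have hmle : (m : ℝ) ≤ (K + ℓ + 1) * (N * p) := by
    rw [hm]; push_cast
    have : (0 : ℝ) ≤ ℓ := by positivity
    nlinarith
  have hmN : m ≤ N := by
    have h1 : (K + ℓ + 1) * (N * p) ≤ N := by
      have : (0 : ℝ) ≤ N := by positivity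
      calc (K + ℓ + 1) * (N * p) = N * ((K + ℓ + 1) * p) := by ring
        _ ≤ N * 1 := mul_le_mul_of_nonneg_left hpK this
        _ = N := mul_one _
    exact_mod_cast hmle.trans h1
  have hL : 0 ≤ Real.log (1 / p) := Real.log_nonneg (by rw [le_div_iff₀ hp]; linarith)
  have hhom : t * (N : ℝ) ^ ℓ * p ^ (SimpleGraph.cycleGraph ℓ).edgeSet.ncard ≤
      homMatrix (SimpleGraph.cycleGraph ℓ) (symMat (cliqueWeight N m p)) := by
    rw [ncard_edgeSet_cycleGraph hℓ]
    refine le_trans ?_ (descFactorial_le_homMatrix_clique _ hmN hp hp1)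
    have h1 : (m + 1 - ℓ) ^ ℓ ≤ m.descFactorial ℓ := Nat.pow_sub_le_descFactorial m ℓ
    have h2 : ((K : ℝ) * (N * p)) ≤ ((m + 1 - ℓ : ℕ) : ℝ) := by
      have : m + 1 - ℓ = ⌈(K : ℝ) * (N * p)⌉₊ + 1 := by omega
      rw [this]
      push_cast
      linarith [Nat.le_ceil ((K : ℝ) * (N * p))]
    calc t * (N : ℝ) ^ ℓ * p ^ ℓ = t * (N * p) ^ ℓ := by rw [mul_pow]; ring
      _ ≤ (K : ℝ) ^ ℓ * (N * p) ^ ℓ := by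
          refine mul_le_mul_of_nonneg_right (hK.trans ?_) (by positivity)
          exact le_self_pow₀ hK1' (by omega)
      _ = ((K : ℝ) * (N * p)) ^ ℓ := (mul_pow _ _ _).symm
      _ ≤ ((m + 1 - ℓ : ℕ) : ℝ) ^ ℓ := pow_le_pow_left₀ (by positivity) h2 ℓ
      _ ≤ _ := by exact_mod_cast h1
  refine (iInf₂_le (symMat (cliqueWeight N m p)) ⟨symMat_mem (cliqueWeight_mem hp hp1), hhom⟩).trans ?_
  rw [EReal.coe_le_coe_iff]
  refine (relEntropyMatrix_clique_le hp hp1).trans ?_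
  calc (m : ℝ) ^ 2 * Real.log (1 / p) ≤ ((K + ℓ + 1) * (N * p)) ^ 2 * Real.log (1 / p) := by
        gcongr
    _ = _ := by ring

lemma homMatrix_zero {ℓ N : ℕ} (hℓ : 3 ≤ ℓ) :
    homMatrix (SimpleGraph.cycleGraph ℓ) (0 : Matrix (Fin N) (Fin N) ℝ) = 0 := by
  rw [homMatrix_cycleGraph hℓ (by simp [Matrix.IsSymm]), zero_pow (by omega), Matrix.trace_zero]

lemma zero_mem_weightedGraphs (N : ℕ) : (0 : Matrix (Fin N) (Fin N) ℝ) ∈ weightedGraphs N :=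
  ⟨by simp [Matrix.IsSymm], fun i j => by simp, fun i => by simp⟩

lemma lowerRate_le_zero_matrix {ℓ N : ℕ} (hℓ : 3 ≤ ℓ) {p t : ℝ} (hp : 0 < p) (ht : 0 ≤ t) :
    lowerRate (SimpleGraph.cycleGraph ℓ) N p t ≤
      (relEntropyMatrix p (0 : Matrix (Fin N) (Fin N) ℝ) : EReal) := by
  refine iInf₂_le (0 : Matrix (Fin N) (Fin N) ℝ) ⟨zero_mem_weightedGraphs N, ?_⟩
  rw [homMatrix_zero hℓ]
  positivity

/-- The empty graph bounds the lower-tail rate. -/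
theorem lowerRate_le {ℓ N : ℕ} (hℓ : 3 ≤ ℓ) {p t : ℝ} (hp : 0 < p) (hp2 : p ≤ 1 / 2) (ht : 0 ≤ t) :
    lowerRate (SimpleGraph.cycleGraph ℓ) N p t ≤ ((N ^ 2 * p : ℝ) : EReal) := by
  refine (lowerRate_le_zero_matrix hℓ hp ht).trans ?_
  rw [EReal.coe_le_coe_iff]
  have h0 : (0 : Matrix (Fin N) (Fin N) ℝ) = symMat fun _ => 0 := by
    ext i j
    simp [symMat]
  rw [h0, relEntropyMatrix_symMat]
  simp only [relEntropy_zero, Finset.sum_const, Finset.card_univ, nsmul_eq_mul]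
  have hlog : Real.log (1 / (1 - p)) ≤ 2 * p := by
    have h1 := Real.log_le_sub_one_of_pos (x := 1 / (1 - p)) (by
      apply one_div_pos.2; linarith)
    have h2 : 1 / (1 - p) - 1 ≤ 2 * p := by
      rw [div_sub_one (by linarith), div_le_iff₀ (by linarith)]
      nlinarith
    linarith
  have hc := card_edge_le N
  calc (Fintype.card (Edge N) : ℝ) * Real.log (1 / (1 - p)) ≤ ((N : ℝ) ^ 2 / 2) * (2 * p) := by
        refine mul_le_mul hc hlog ?_ (by positivity)
        exact Real.log_nonneg (by rw [le_div_iff₀ (by linarith)]; linarith)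
    _ = _ := by ring

/-! ### The number of edges -/

/-- Chernoff's bound with parameter 1: each edge has exponential moment 1 + (e - 1)p ≤ exp(2p), and
there are at most N²/2 edges. -/
theorem cubeProb_many_edges {N : ℕ} {p : ℝ} (hp : 0 < p) (hp1 : p < 1) :
    cubeProb p (Finset.univ.filter fun ω : Edge N → Bool => 2 * (N ^ 2 * p) ≤ ∑ e, cubePoint ω e) ≤
      Real.exp (-(N ^ 2 * p)) := by
  have hexp : ∑ ω : Edge N → Bool, cubeWeight p ω * Real.exp (∑ e, cubePoint ω e) ≤
      Real.exp (N ^ 2 * p) := by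
    have h1 : ∀ ω : Edge N → Bool, cubeWeight p ω * Real.exp (∑ e, cubePoint ω e) =
        ∏ e, bernWeight p (ω e) * Real.exp (boolVal (ω e)) := by
      intro ω
      rw [Real.exp_sum, cubeWeight, ← Finset.prod_mul_distrib]
      rfl
    simp_rw [h1]
    have h2 := Finset.prod_univ_sum (fun _ : Edge N => (Finset.univ : Finset Bool))
      (fun _ b => bernWeight p b * Real.exp (boolVal b))
    rw [Fintype.piFinset_univ] at h2
    rw [← h2, Finset.prod_const, Finset.card_univ]
    have h3 : ∑ b : Bool, bernWeight p b * Real.exp (boolVal b) ≤ Real.exp (2 * p) := by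
      have he : Real.exp 1 ≤ 3 := by linarith [Real.exp_one_lt_d9]
      have := Real.add_one_le_exp (2 * p)
      simp only [Fintype.univ_bool, Finset.mem_singleton, Bool.true_eq_false, not_false_eq_true,
        Finset.sum_insert, Finset.sum_singleton, bernWeight, boolVal, if_true, Bool.false_eq_true,
        if_false, Real.exp_zero]
      nlinarith
    have h4 : 0 ≤ ∑ b : Bool, bernWeight p b * Real.exp (boolVal b) :=
      Finset.sum_nonneg fun b _ => mul_nonneg (bernWeight_pos hp hp1 b).le (Real.exp_pos _).le
    refine (pow_le_pow_left₀ h4 h3 _).trans ?_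
    rw [← Real.exp_nat_mul]
    refine Real.exp_le_exp.2 ?_
    have := mul_le_mul_of_nonneg_right (card_edge_le N) (by positivity : 0 ≤ 2 * p)
    linarith
  have hE : Real.exp (-(N ^ 2 * p)) = Real.exp (N ^ 2 * p) / Real.exp (2 * (N ^ 2 * p)) := by
    rw [← Real.exp_sub]
    congr 1
    ring
  rw [hE, le_div_iff₀ (Real.exp_pos _)]
  refine le_trans ?_ hexp
  rw [cubeProb, Finset.sum_mul]
  refine (Finset.sum_le_sum fun ω hω => ?_).trans (Finset.sum_le_sum_of_subset_of_nonneg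
    (Finset.filter_subset _ _) fun ω _ _ =>
      mul_nonneg (cubeWeight_pos hp hp1 ω).le (Real.exp_pos _).le)
  exact mul_le_mul_of_nonneg_left (Real.exp_le_exp.2 (Finset.mem_filter.1 hω).2)
    (cubeWeight_pos hp hp1 ω).le

/-- The eigenvalues of a graph with few edges beyond the first `R` are small. -/
lemma sum_tail_le_of_few_edges {ℓ N R : ℕ} (hℓ : 2 ≤ ℓ) (hR : 1 ≤ R) {c : ℝ} (ω : Edge N → Bool)
    (hω : ∑ e, cubePoint ω e ≤ c) {U : Matrix (Fin N) (Fin N) ℝ} {d : Fin N → ℝ}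
    (hU : U * U.transpose = 1) (hA : symMat (cubePoint ω) = specMat U d)
    (hd : Antitone fun k => |d k|) :
    ∑ k, |tailPart R d k| ^ ℓ ≤ √(2 * c / R) ^ (ℓ - 2) * (2 * c) := by
  have hsum : ∑ k, d k ^ 2 ≤ 2 * c := by
    have h1 : ∑ k, d k ^ 2 = frob (symMat (cubePoint ω)) (symMat (cubePoint ω)) := by
      rw [hA, frob_specMat hU]
      simp [sq]
    have h2 : ∀ e, cubePoint ω e ^ 2 = cubePoint ω e := fun e => by
      unfold cubePoint boolVal
      split_ifs <;> simp
    rw [h1, frob_symMat_self]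
    simp_rw [h2]
    linarith
  have hRpos : (0 : ℝ) < R := by exact_mod_cast hR
  -- At least R eigenvalues are as large as a discarded one, and their squares sum to at most 2c.
  have hterm : ∀ k : Fin N, ¬ k.val < R → |d k| ≤ √(2 * c / R) := by
    intro k hk
    refine Real.le_sqrt_of_sq_le ?_
    rw [sq_abs, le_div_iff₀ hRpos]
    refine le_trans ?_ hsum
    have hc : (R : ℝ) ≤ ((Finset.Iic k).card : ℝ) := by
      rw [Fin.card_Iic]
      have : R ≤ k.val + 1 := by omega
      exact_mod_cast this
    calc d k ^ 2 * R ≤ d k ^ 2 * (Finset.Iic k).card :=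
          mul_le_mul_of_nonneg_left hc (sq_nonneg _)
      _ = ∑ l ∈ Finset.Iic k, d k ^ 2 := by rw [Finset.sum_const, nsmul_eq_mul, mul_comm]
      _ ≤ ∑ l ∈ Finset.Iic k, d l ^ 2 := Finset.sum_le_sum fun l hl => by
          rw [sq_le_sq]
          exact hd (Finset.mem_Iic.1 hl)
      _ ≤ _ := Finset.sum_le_sum_of_subset_of_nonneg (Finset.subset_univ _)
          fun _ _ _ => sq_nonneg _
  calc ∑ k, |tailPart R d k| ^ ℓ ≤ ∑ k, √(2 * c / R) ^ (ℓ - 2) * d k ^ 2 := by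
        refine Finset.sum_le_sum fun k _ => ?_
        simp only [tailPart]
        split_ifs with hk
        · rw [abs_zero, zero_pow (by omega)]
          positivity
        · obtain ⟨n, rfl⟩ : ∃ n, ℓ = n + 2 := ⟨ℓ - 2, by omega⟩
          rw [pow_add, sq_abs, Nat.add_sub_cancel]
          exact mul_le_mul_of_nonneg_right (pow_le_pow_left₀ (abs_nonneg _) (hterm k hk) n)
            (sq_nonneg _)
    _ = √(2 * c / R) ^ (ℓ - 2) * ∑ k, d k ^ 2 := by rw [Finset.mul_sum]
    _ ≤ _ := mul_le_mul_of_nonneg_left hsum (by positivity)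

/-! ### Power sums -/

/-- Each term (k+1)^(-3/2) is at most the increment 2/√k - 2/√(k+1), so the sum telescopes. -/
lemma sum_inv_sqrt_cube_le {R : ℕ} (hR : 1 ≤ R) (n : ℕ) :
    ∑ k ∈ Finset.Ico R (R + n), (1 / √(k + 1 : ℝ)) ^ 3 ≤ 2 / √R - 2 / √(R + n : ℝ) := by
  induction n with
  | zero => simp
  | succ n ih =>
    rw [← add_assoc, Finset.sum_Ico_succ_top (by omega)]
    have hpos : (0 : ℝ) < (R : ℝ) + n := by
      have : (1 : ℝ) ≤ R := by exact_mod_cast hR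
      positivity
    set x := √((R : ℝ) + n) with hx
    set y := √((R : ℝ) + n + 1) with hy
    have hx0 : 0 < x := Real.sqrt_pos.2 hpos
    have hxy : x ≤ y := Real.sqrt_le_sqrt (by linarith)
    have hy0 : 0 < y := hx0.trans_le hxy
    have hsq : y ^ 2 - x ^ 2 = 1 := by
      rw [hx, hy, Real.sq_sqrt (by linarith), Real.sq_sqrt hpos.le]; ring
    have key : (1 / y) ^ 3 ≤ 2 / x - 2 / y := by
      rw [div_sub_div _ _ hx0.ne' hy0.ne', div_pow, one_pow, div_le_div_iff₀ (by positivity)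
        (by positivity)]
      have h1 : (y - x) * (y + x) = 1 := by linarith
      have h2 : y - x ≥ 1 / (2 * y) := by
        rw [ge_iff_le, div_le_iff₀ (by positivity)]
        nlinarith
      have h3 : (2 * y - x * 2) * y ^ 3 ≥ (2 * (1 / (2 * y))) * y ^ 3 :=
        mul_le_mul_of_nonneg_right (by linarith) (by positivity)
      have h4 : (2 * (1 / (2 * y))) * y ^ 3 = y ^ 2 := by field_simp
      nlinarith
    push_cast
    rw [← add_assoc, ← hy]
    linarith

lemma sum_inv_sqrt_pow_le {ℓ R : ℕ} (hℓ : 3 ≤ ℓ) (hR : 1 ≤ R) (N : ℕ) :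
    ∑ k ∈ Finset.Ico R N, (1 / √(k + 1 : ℝ)) ^ ℓ ≤ 2 * (1 / √R) ^ (ℓ - 2) := by
  rcases le_total N R with h | h
  · rw [Finset.Ico_eq_empty_of_le h, Finset.sum_empty]
    positivity
  obtain ⟨n, rfl⟩ : ∃ n, N = R + n := ⟨N - R, by omega⟩
  obtain ⟨m, rfl⟩ : ∃ m, ℓ = m + 3 := ⟨ℓ - 3, by omega⟩
  have hRpos : (0 : ℝ) < R := by exact_mod_cast hR
  calc ∑ k ∈ Finset.Ico R (R + n), (1 / √(k + 1 : ℝ)) ^ (m + 3)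
      ≤ ∑ k ∈ Finset.Ico R (R + n), (1 / √R) ^ m * (1 / √(k + 1 : ℝ)) ^ 3 := by
        refine Finset.sum_le_sum fun k hk => ?_
        rw [pow_add]
        refine mul_le_mul_of_nonneg_right (pow_le_pow_left₀ (by positivity) ?_ m) (by positivity)
        refine one_div_le_one_div_of_le (Real.sqrt_pos.2 hRpos) (Real.sqrt_le_sqrt ?_)
        have : (R : ℝ) ≤ k := by exact_mod_cast (Finset.mem_Ico.1 hk).1
        linarith
    _ = (1 / √R) ^ m * ∑ k ∈ Finset.Ico R (R + n), (1 / √(k + 1 : ℝ)) ^ 3 := by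
        rw [Finset.mul_sum]
    _ ≤ (1 / √R) ^ m * (2 / √R) := by
        refine mul_le_mul_of_nonneg_left ((sum_inv_sqrt_cube_le hR n).trans ?_) (by positivity)
        have : 0 ≤ 2 / √(R + n : ℝ) := by positivity
        linarith
    _ = _ := by
        have : m + 3 - 2 = m + 1 := by omega
        rw [this, pow_succ]
        ring

/-- A bound for the partial sums of `k ^ (-ℓ / 4)`. -/
noncomputable def quarticSum (ℓ N : ℕ) : ℝ := if ℓ = 3 then 4 * √(√N) else 1 + Real.log N

lemma sqrt_sqrt_pow_four {x : ℝ} (hx : 0 ≤ x) : √(√x) ^ 4 = x := by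
  calc √(√x) ^ 4 = (√(√x) ^ 2) ^ 2 := by ring
    _ = x := by rw [Real.sq_sqrt (Real.sqrt_nonneg _), Real.sq_sqrt hx]

/-- Telescoping against 4 k^(1/4), via y⁴ - x⁴ = (y - x)(y + x)(y² + x²) for consecutive fourth
roots. -/
lemma sum_inv_fourthRoot_cube_le (N : ℕ) :
    ∑ k ∈ Finset.range N, (1 / √(√(k + 1 : ℝ))) ^ 3 ≤ 4 * √(√N) := by
  induction N with
  | zero => simp
  | succ n ih =>
    rw [Finset.sum_range_succ]
    push_cast
    set x := √(√(n : ℝ)) with hx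
    set y := √(√((n : ℝ) + 1)) with hy
    have hx0 : 0 ≤ x := Real.sqrt_nonneg _
    have hy0 : 0 < y := Real.sqrt_pos.2 (Real.sqrt_pos.2 (by positivity))
    have hxy : x ≤ y := Real.sqrt_le_sqrt (Real.sqrt_le_sqrt (by linarith))
    have hx4 : x ^ 4 = n := sqrt_sqrt_pow_four (by positivity)
    have hy4 : y ^ 4 = n + 1 := sqrt_sqrt_pow_four (by positivity)
    have key : (1 / y) ^ 3 ≤ 4 * y - 4 * x := by
      rw [div_pow, one_pow, div_le_iff₀ (by positivity)]
      have h1 : (y - x) * ((y + x) * (y ^ 2 + x ^ 2)) = 1 := by nlinarith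
      have h2 : (y + x) * (y ^ 2 + x ^ 2) ≤ (2 * y) * (2 * y ^ 2) := by
        refine mul_le_mul (by linarith) ?_ (by positivity) (by positivity)
        nlinarith
      have h3 := mul_le_mul_of_nonneg_left h2 (sub_nonneg.2 hxy)
      nlinarith
    linarith

/-- For ℓ ≥ 4 every term is at most 1/(k+1), which leaves a harmonic sum; ℓ = 3 is the only case
with polynomial growth. -/
lemma sum_inv_fourthRoot_le {ℓ : ℕ} (hℓ : 3 ≤ ℓ) (N : ℕ) :
    ∑ k ∈ Finset.range N, (1 / √(√(k + 1 : ℝ))) ^ ℓ ≤ quarticSum ℓ N := by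
  unfold quarticSum
  split_ifs with h
  · subst h
    exact sum_inv_fourthRoot_cube_le N
  · have hharm : ((harmonic N : ℚ) : ℝ) ≤ 1 + Real.log N := harmonic_le_one_add_log N
    refine le_trans ?_ hharm
    rw [harmonic]
    push_cast
    refine Finset.sum_le_sum fun k _ => ?_
    have h1 : (1 : ℝ) ≤ √(√(k + 1 : ℝ)) := by
      rw [Real.one_le_sqrt, Real.one_le_sqrt]
      have : (0 : ℝ) ≤ k := by positivity
      linarith
    calc (1 / √(√(k + 1 : ℝ))) ^ ℓ ≤ (1 / √(√(k + 1 : ℝ))) ^ 4 := by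
          refine pow_le_pow_of_le_one (by positivity) ?_ (by omega)
          rw [div_le_one (by linarith)]
          exact h1
      _ = ((k : ℝ) + 1)⁻¹ := by
          rw [div_pow, one_pow, sqrt_sqrt_pow_four (by positivity), one_div]

/-- Summation of the eigenvalue bound over all indices from `R` on. -/
lemma sum_tail_le_of_eigenvalue_bound {ℓ N R : ℕ} (hℓ : 3 ≤ ℓ) (hR : 1 ≤ R) {a b : ℝ} (ha : 0 ≤ a)
    (hb : 0 ≤ b) {d : Fin N → ℝ}
    (hd : ∀ k : Fin N, |d k| * √(k.val + 1 : ℝ) ≤ a + √(√(k.val + 1 : ℝ)) * b) :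
    ∑ k, |tailPart R d k| ^ ℓ ≤
      2 ^ ℓ * (a ^ ℓ * (2 * (1 / √R) ^ (ℓ - 2)) + b ^ ℓ * quarticSum ℓ N) := by
  have hk : ∀ k : Fin N, |d k| ≤ a * (1 / √(k.val + 1 : ℝ)) + b * (1 / √(√(k.val + 1 : ℝ))) := by
    intro k
    have hpos : 0 < √(√(k.val + 1 : ℝ)) := Real.sqrt_pos.2 (Real.sqrt_pos.2 (by positivity))
    set x := √(√(k.val + 1 : ℝ)) with hx
    have hx2 : √(k.val + 1 : ℝ) = x ^ 2 := by rw [hx, Real.sq_sqrt (Real.sqrt_nonneg _)]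
    have h1 : |d k| * √(k.val + 1 : ℝ) ≤ a + x * b := hd k
    rw [hx2] at h1 ⊢
    have e : a * (1 / x ^ 2) + b * (1 / x) = (a + x * b) / x ^ 2 := by field_simp
    rw [e, le_div_iff₀ (by positivity)]
    exact h1
  have hpow : ∀ k : Fin N, |d k| ^ ℓ ≤
      2 ^ ℓ * (a ^ ℓ * (1 / √(k.val + 1 : ℝ)) ^ ℓ + b ^ ℓ * (1 / √(√(k.val + 1 : ℝ))) ^ ℓ) := by
    intro k
    refine (pow_le_pow_left₀ (abs_nonneg _) (hk k) ℓ).trans ?_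
    refine (add_pow_le (by positivity) (by positivity) ℓ).trans ?_
    rw [mul_pow, mul_pow]
    refine mul_le_mul_of_nonneg_right ?_ (by positivity)
    exact pow_le_pow_right₀ (by norm_num) (by omega)
  have hfin : ∀ f : ℕ → ℝ, ∑ k : Fin N, f k.val = ∑ k ∈ Finset.range N, f k :=
    fun f => Fin.sum_univ_eq_sum_range f N
  -- The cutoff at R is kept only for the `a` term. The `b` term is summed over all indices, since
  -- its full sum is already affordable.
  calc ∑ k, |tailPart R d k| ^ ℓ
      ≤ ∑ k : Fin N, 2 ^ ℓ * (a ^ ℓ * (if R ≤ k.val then (1 / √(k.val + 1 : ℝ)) ^ ℓ else 0) +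
          b ^ ℓ * (1 / √(√(k.val + 1 : ℝ))) ^ ℓ) := by
        refine Finset.sum_le_sum fun k _ => ?_
        simp only [tailPart]
        by_cases h : k.val < R
        · rw [if_pos h, if_neg (by omega), abs_zero, zero_pow (by omega)]
          positivity
        · rw [if_neg h, if_pos (by omega)]
          exact hpow k
    _ = 2 ^ ℓ * (a ^ ℓ * ∑ k ∈ Finset.Ico R N, (1 / √(k + 1 : ℝ)) ^ ℓ +
          b ^ ℓ * ∑ k ∈ Finset.range N, (1 / √(√(k + 1 : ℝ))) ^ ℓ) := by
        rw [← Finset.mul_sum, Finset.sum_add_distrib, ← Finset.mul_sum, ← Finset.mul_sum,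
          hfin fun k => if R ≤ k then (1 / √(k + 1 : ℝ)) ^ ℓ else 0,
          hfin fun k => (1 / √(√(k + 1 : ℝ))) ^ ℓ, ← Finset.sum_filter]
        congr 4
        ext k
        simp only [Finset.mem_filter, Finset.mem_range, Finset.mem_Ico]
        tauto
    _ ≤ _ := by
        have h1 := sum_inv_sqrt_pow_le hℓ hR N
        have h2 := sum_inv_fourthRoot_le hℓ N
        gcongr

/-! ### Choice of the error sequences -/

lemma exists_seq_tendsto_zero_of_forall_eventually {Q : ℝ → ℕ → Prop}
    (hmono : ∀ N δ δ', δ ≤ δ' → Q δ N → Q δ' N) (h : ∀ δ > 0, ∀ᶠ N in atTop, Q δ N) :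
    ∃ δ : ℕ → ℝ, Tendsto δ atTop (𝓝 0) ∧ ∀ᶠ N in atTop, Q (δ N) N := by
  set S : ℕ → Set ℝ := fun N => {δ | 0 < δ ∧ Q δ N} with hS
  have hbdd : ∀ N, BddBelow (S N) := fun N => ⟨0, fun x hx => hx.1.le⟩
  have hnn : ∀ N, 0 ≤ sInf (S N) := fun N => Real.sInf_nonneg fun x hx => hx.1.le
  -- The infimum of the admissible constants tends to zero but need not be attained; the positive
  -- increment makes the choice admissible by monotonicity.
  refine ⟨fun N => sInf (S N) + 1 / ((N : ℝ) + 1), ?_, ?_⟩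
  · have h1 : Tendsto (fun N => sInf (S N)) atTop (𝓝 0) := by
      rw [Metric.tendsto_atTop']
      intro ε hε
      obtain ⟨M, hM⟩ := eventually_atTop.1 (h (ε / 2) (by linarith))
      refine ⟨M, fun N hN => ?_⟩
      rw [Real.dist_eq, sub_zero, abs_of_nonneg (hnn N)]
      have : sInf (S N) ≤ ε / 2 := csInf_le (hbdd N) ⟨by linarith, hM N hN.le⟩
      linarith
    simpa using h1.add tendsto_one_div_add_atTop_nhds_zero_nat
  · filter_upwards [h 1 one_pos] with N hN
    have hne : (S N).Nonempty := ⟨1, one_pos, hN⟩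
    have hlt : sInf (S N) < sInf (S N) + 1 / ((N : ℝ) + 1) := by
      have : 0 < 1 / ((N : ℝ) + 1) := by positivity
      linarith
    obtain ⟨x, hx, hxlt⟩ := exists_lt_of_csInf_lt hne hlt
    exact hmono N x _ hxlt.le hx.2

lemma one_le_exp_neg_add {φ : EReal} {c : ℝ} (h : φ ≤ (c : EReal)) :
    1 ≤ EReal.exp (-φ + (c : EReal)) := by
  rw [EReal.exp_add]
  have h1 : EReal.exp (((-c : ℝ)) : EReal) ≤ EReal.exp (-φ) := by
    refine EReal.exp_monotone ?_
    rw [EReal.coe_neg]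
    exact EReal.neg_le_neg_iff.2 h
  calc (1 : ENNReal) = EReal.exp ((-c : ℝ) : EReal) * EReal.exp (c : EReal) := by
        rw [← EReal.exp_add, ← EReal.coe_add]
        simp
    _ ≤ _ := mul_le_mul_left h1 _

/-- Passage from bounds with arbitrarily small constants to bounds with vanishing sequences. -/
theorem exists_error_sequences {P : ℕ → ENNReal} (hP : ∀ N, P N ≤ 1) {rate : ℝ → ℕ → EReal}
    (hanti : ∀ N δ δ', δ ≤ δ' → rate δ' N ≤ rate δ N) {v : ℕ → ℝ} (hv : ∀ N, 0 ≤ v N)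
    (hfallback : ∀ N, ∃ δ c : ℝ, rate δ N ≤ (c : EReal))
    (h : ∀ δ > 0, ∀ᶠ N in atTop, P N ≤ EReal.exp (-rate δ N + ((δ * v N : ℝ) : EReal))) :
    ∃ ε E : ℕ → ℝ, Tendsto ε atTop (𝓝 0) ∧ E =o[atTop] v ∧
      ∀ N, P N ≤ EReal.exp (-rate (ε N) N + (E N : EReal)) := by
  classical
  obtain ⟨δ, hδ, hQ⟩ := exists_seq_tendsto_zero_of_forall_eventually
    (Q := fun δ N => P N ≤ EReal.exp (-rate δ N + ((δ * v N : ℝ) : EReal)))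
    (fun N δ δ' hle hQ => hQ.trans (EReal.exp_monotone (add_le_add
      (EReal.neg_le_neg_iff.2 (hanti N δ δ' hle))
      (EReal.coe_le_coe_iff.2 (mul_le_mul_of_nonneg_right hle (hv N)))))) h
  -- At those N where the diagonal choice fails, a shift with finite rate bound c is used with error
  -- c: the right-hand side is then at least 1. Eventually this does not occur, so the asymptotics
  -- are unaffected.
  choose δ' c hc using hfallback
  refine ⟨fun N => if P N ≤ EReal.exp (-rate (δ N) N + ((δ N * v N : ℝ) : EReal)) then δ N else δ' N,
    fun N => if P N ≤ EReal.exp (-rate (δ N) N + ((δ N * v N : ℝ) : EReal)) then δ N * v N else c N,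
    ?_, ?_, ?_⟩
  · refine hδ.congr' ?_
    filter_upwards [hQ] with N hN
    rw [if_pos hN]
  · have h1 : (fun N => δ N * v N) =o[atTop] v := by
      have := ((isLittleO_one_iff ℝ).2 hδ).mul_isBigO (isBigO_refl v atTop)
      simpa using this
    refine h1.congr' ?_ EventuallyEq.rfl
    filter_upwards [hQ] with N hN
    rw [if_pos hN]
  · intro N
    dsimp only
    split_ifs with hN
    · exact hN
    · exact (hP N).trans (one_le_exp_neg_add (hc N))

lemma tendsto_zero_of_pow {f : ℕ → ℝ} {k : ℕ} (h : Tendsto (fun N => f N ^ k) atTop (𝓝 0)) :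
    Tendsto f atTop (𝓝 0) := by
  rw [Metric.tendsto_atTop'] at h ⊢
  intro ε hε
  obtain ⟨M, hM⟩ := h (ε ^ k) (by positivity)
  refine ⟨M, fun N hN => ?_⟩
  have := hM N hN
  rw [Real.dist_eq, sub_zero] at this ⊢
  rw [abs_pow] at this
  exact lt_of_pow_lt_pow_left₀ k hε.le this

lemma tendsto_log_natCast_atTop : Tendsto (fun N : ℕ => Real.log N) atTop atTop :=
  Real.tendsto_log_atTop.comp tendsto_natCast_atTop_atTop

lemma half_le_natFloor {y : ℝ} (hy : 1 ≤ y) : y / 2 ≤ (⌊y⌋₊ : ℝ) := by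
  have h1 := Nat.lt_floor_add_one y
  have h2 : (1 : ℝ) ≤ (⌊y⌋₊ : ℝ) := by
    exact_mod_cast Nat.le_floor (by simpa using hy)
  linarith

/-! ### Consequences of the hypotheses on the density -/

section Density

variable {ℓ : ℕ} {p : ℕ → ℝ}

/-- The two parts of the maximum are raised to the powers ℓ and 2(ℓ - 2), which clears the real
exponents. -/
lemma tendsto_of_upper_density (hℓ : 3 ≤ ℓ) (hp : ∀ N, 0 < p N)
    (h : (fun N : ℕ => max ((N : ℝ) ^ ((2 : ℝ) / ℓ - 1))
          (Real.log N ^ ((ℓ : ℝ) / (2 * ℓ - 4)) / √(N : ℝ))) =o[atTop] p) :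
    Tendsto (fun N : ℕ => 1 / ((N : ℝ) ^ (ℓ - 2) * p N ^ ℓ)) atTop (𝓝 0) ∧
      Tendsto (fun N : ℕ => Real.log N ^ ℓ / (N * p N ^ 2) ^ (ℓ - 2)) atTop (𝓝 0) := by
  have h0 := h.tendsto_div_nhds_zero
  obtain ⟨n, rfl⟩ : ∃ n, ℓ = n + 2 := ⟨ℓ - 2, by omega⟩
  have hn : (0 : ℝ) < n := by
    have : 1 ≤ n := by omega
    exact_mod_cast this
  constructor
  · have h1 : Tendsto (fun N : ℕ => (N : ℝ) ^ ((2 : ℝ) / (n + 2 : ℕ) - 1) / p N) atTop (𝓝 0) := by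
      refine squeeze_zero (fun N => ?_) (fun N => ?_) h0
      · have := hp N
        positivity
      · exact div_le_div_of_nonneg_right (le_max_left _ _) (hp N).le
    have h2 := h1.pow (n + 2)
    rw [zero_pow (by omega)] at h2
    refine h2.congr' ?_
    filter_upwards [eventually_gt_atTop 0] with N hN
    have hN' : (0 : ℝ) < N := by exact_mod_cast hN
    rw [div_pow, ← Real.rpow_natCast ((N : ℝ) ^ _), ← Real.rpow_mul hN'.le]
    have e : ((2 : ℝ) / (n + 2 : ℕ) - 1) * (n + 2 : ℕ) = -(n : ℝ) := by
      push_cast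
      field_simp
      ring
    rw [e, Real.rpow_neg hN'.le, Real.rpow_natCast, Nat.add_sub_cancel]
    have := hp N
    field_simp
  · have h1 : Tendsto (fun N : ℕ => Real.log N ^ (((n + 2 : ℕ) : ℝ) / (2 * (n + 2 : ℕ) - 4)) / √(N : ℝ)
        / p N) atTop (𝓝 0) := by
      refine squeeze_zero (fun N => ?_) (fun N => ?_) h0
      · have := hp N
        have := Real.log_natCast_nonneg N
        positivity
      · exact div_le_div_of_nonneg_right (le_max_right _ _) (hp N).le
    have h2 := h1.pow (2 * n)
    rw [zero_pow (by omega)] at h2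
    refine h2.congr' ?_
    filter_upwards [eventually_gt_atTop 0] with N hN
    have hN' : (0 : ℝ) < N := by exact_mod_cast hN
    have hlog := Real.log_natCast_nonneg N
    rw [div_pow, div_pow, ← Real.rpow_natCast (Real.log N ^ _), ← Real.rpow_mul hlog]
    have e : (((n + 2 : ℕ) : ℝ) / (2 * (n + 2 : ℕ) - 4)) * (2 * n : ℕ) = ((n + 2 : ℕ) : ℝ) := by
      have : (2 * ((n + 2 : ℕ) : ℝ) - 4) = 2 * n := by push_cast; ring
      rw [this]
      push_cast
      field_simp
    rw [e, Real.rpow_natCast, Nat.add_sub_cancel, pow_mul √(N : ℝ), Real.sq_sqrt hN'.le,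
      pow_mul (p N), mul_pow]
    rw [div_div]

lemma tendsto_log_div {n : ℕ} {p : ℕ → ℝ} (hp : ∀ N, 0 < p N)
    (hA : Tendsto (fun N : ℕ => Real.log N ^ (n + 2) / (N * p N ^ 2) ^ n) atTop (𝓝 0)) :
    Tendsto (fun N : ℕ => Real.log N / (N * p N ^ 2)) atTop (𝓝 0) := by
  refine tendsto_zero_of_pow (k := n) ?_
  refine squeeze_zero' (Eventually.of_forall fun N => ?_) ?_ hA
  · have := Real.log_natCast_nonneg N
    have := hp N
    positivity
  · filter_upwards [tendsto_log_natCast_atTop.eventually_ge_atTop 1] with N hN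
    have := hp N
    rw [div_pow]
    refine div_le_div_of_nonneg_right ?_ (by positivity)
    exact pow_le_pow_right₀ hN (by omega)

/-- The ratio has fourth power 8/(Np²). For ℓ = 3 the fourth power of the whole term is a constant
times 1/(Np³)²; for ℓ ≥ 4 the term is at most a constant times log N/(Np²). -/
lemma tendsto_fourthRoot_term (hℓ : 3 ≤ ℓ) (hp : ∀ N, 0 < p N)
    (hB : Tendsto (fun N : ℕ => 1 / ((N : ℝ) ^ (ℓ - 2) * p N ^ ℓ)) atTop (𝓝 0))
    (hC : Tendsto (fun N : ℕ => Real.log N / (N * p N ^ 2)) atTop (𝓝 0)) :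
    Tendsto (fun N : ℕ => (√(√(8 * N ^ 3 * p N ^ 2)) / (N * p N)) ^ ℓ * quarticSum ℓ N)
      atTop (𝓝 0) := by
  have hg4 : ∀ N : ℕ, 0 < N → (√(√(8 * N ^ 3 * p N ^ 2)) / (N * p N)) ^ 4 = 8 / (N * p N ^ 2) := by
    intro N hN
    have hN' : (0 : ℝ) < N := by exact_mod_cast hN
    have := hp N
    rw [div_pow, sqrt_sqrt_pow_four (by positivity)]
    field_simp
  by_cases h3 : ℓ = 3
  · subst h3
    refine tendsto_zero_of_pow (k := 4) ?_
    have h1 := (hB.pow 2).const_mul (8 ^ 3 * 4 ^ 4 : ℝ)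
    rw [zero_pow (by norm_num), mul_zero] at h1
    refine h1.congr' ?_
    filter_upwards [eventually_gt_atTop 0] with N hN
    have hN' : (0 : ℝ) < N := by exact_mod_cast hN
    have := hp N
    have e : ((√(√(8 * N ^ 3 * p N ^ 2)) / (N * p N)) ^ 3 * quarticSum 3 N) ^ 4 =
        ((√(√(8 * N ^ 3 * p N ^ 2)) / (N * p N)) ^ 4) ^ 3 * (4 ^ 4 * √(√N) ^ 4) := by
      rw [quarticSum, if_pos rfl]
      ring
    rw [e, hg4 N hN, sqrt_sqrt_pow_four hN'.le, show 3 - 2 = 1 from rfl, pow_one]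
    field_simp
  · have h1 := hC.const_mul (16 : ℝ)
    rw [mul_zero] at h1
    refine squeeze_zero' (Eventually.of_forall fun N => ?_) ?_ h1
    · have := Real.log_natCast_nonneg N
      have := hp N
      rw [quarticSum, if_neg h3]
      positivity
    · filter_upwards [eventually_gt_atTop 0, tendsto_log_natCast_atTop.eventually_ge_atTop 1,
        hC.eventually (ge_mem_nhds (show (0 : ℝ) < 1 / 8 by norm_num))] with N hN hlog hc
      have hN' : (0 : ℝ) < N := by exact_mod_cast hN
      have hpN := hp N
      have hx : 0 < (N : ℝ) * p N ^ 2 := by positivity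
      set g := √(√(8 * N ^ 3 * p N ^ 2)) / (N * p N) with hg
      have hg0 : 0 ≤ g := by positivity
      have hx8 : 8 / (N * p N ^ 2) ≤ 1 := by
        rw [div_le_one hx]
        rw [div_le_iff₀ hx] at hc
        linarith
      have hg1 : g ≤ 1 := by
        have : g ^ 4 ≤ 1 := by rw [hg4 N hN]; exact hx8
        exact (pow_le_one_iff_of_nonneg hg0 (by norm_num)).1 this
      have h4 : g ^ ℓ ≤ 8 / (N * p N ^ 2) := by
        rw [← hg4 N hN]
        exact pow_le_pow_of_le_one hg0 hg1 (by omega)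
      rw [quarticSum, if_neg h3]
      calc g ^ ℓ * (1 + Real.log N) ≤ 8 / (N * p N ^ 2) * (2 * Real.log N) := by
            refine mul_le_mul h4 (by linarith) (by linarith) (by positivity)
        _ = 16 * (Real.log N / (N * p N ^ 2)) := by ring

/-- The rank of the spectral truncation in the upper-tail problem. -/
noncomputable def upperRank (δ : ℝ) (p : ℕ → ℝ) (N : ℕ) : ℕ :=
  ⌊δ * (N * p N ^ 2) * Real.log (1 / p N) / Real.log N⌋₊

lemma eventually_log_inv_ge {p : ℕ → ℝ} (hp : ∀ N, 0 < p N) (hp0 : Tendsto p atTop (𝓝 0)) (c : ℝ) :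
    ∀ᶠ N in atTop, c ≤ Real.log (1 / p N) := by
  filter_upwards [hp0.eventually (ge_mem_nhds (Real.exp_pos (-c)))] with N hN
  rw [one_div, Real.log_inv, le_neg]
  exact (Real.log_le_iff_le_exp (hp N)).2 hN

/-- Elementary properties of the parameters that hold for large `N` in the upper-tail problem. -/
lemma eventually_upper_parameters {δ : ℝ} (hδ : 0 < δ) (hδ1 : δ ≤ 1)
    (hp : ∀ N, 0 < p N ∧ p N < 1) (hp0 : Tendsto p atTop (𝓝 0))
    (hC : Tendsto (fun N : ℕ => Real.log N / (N * p N ^ 2)) atTop (𝓝 0)) :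
    ∀ᶠ N : ℕ in atTop, 2 ≤ N ∧ 1 ≤ Real.log N ∧ 1 ≤ Real.log (1 / p N) ∧
      Real.log (1 / p N) ≤ Real.log N ∧ 1 ≤ N * p N ^ 2 ∧ 1 ≤ N * p N ∧
      1 ≤ δ * (N * p N ^ 2) * Real.log (1 / p N) / Real.log N ∧ upperRank δ p N ≤ N := by
  filter_upwards [eventually_ge_atTop 2, tendsto_log_natCast_atTop.eventually_ge_atTop 1,
    eventually_log_inv_ge (fun N => (hp N).1) hp0 1,
    hC.eventually (ge_mem_nhds (show (0 : ℝ) < δ from hδ))] with N hN hlog hL hc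
  obtain ⟨hpN, hpN1⟩ := hp N
  have hN' : (2 : ℝ) ≤ N := by exact_mod_cast hN
  have hx : 0 < (N : ℝ) * p N ^ 2 := by positivity
  have hx' : Real.log N ≤ δ * (N * p N ^ 2) := (div_le_iff₀ hx).1 hc
  have hx1 : 1 ≤ (N : ℝ) * p N ^ 2 := by nlinarith
  have hNp : 1 ≤ (N : ℝ) * p N := by
    refine hx1.trans (mul_le_mul_of_nonneg_left ?_ (by positivity))
    nlinarith
  have hLlog : Real.log (1 / p N) ≤ Real.log N := by
    refine Real.log_le_log (by positivity) ?_
    rw [div_le_iff₀ hpN]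
    exact hNp
  refine ⟨hN, hlog, hL, hLlog, hx1, hNp, ?_, ?_⟩
  · rw [le_div_iff₀ (by linarith), one_mul]
    nlinarith
  · refine Nat.floor_le_of_le ?_
    rw [div_le_iff₀ (by linarith)]
    have h1 : δ * (N * p N ^ 2) ≤ N := by
      have : p N ^ 2 ≤ 1 := by nlinarith
      calc δ * (N * p N ^ 2) ≤ 1 * (N * 1) := by gcongr
        _ = N := by ring
    exact mul_le_mul h1 hLlog (by linarith) (by positivity)

/-- The rank is at least half of its value before rounding. Substituting this in the square leaves
(2/δ)^n L² (log N)^n / (Np²)^n with L = log(1/p), and L ≤ log N. -/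
lemma tendsto_upper_rank_term {n : ℕ} {δ : ℝ} (hδ : 0 < δ) (hδ1 : δ ≤ 1)
    (hp : ∀ N, 0 < p N ∧ p N < 1) (hp0 : Tendsto p atTop (𝓝 0))
    (hA : Tendsto (fun N : ℕ => Real.log N ^ (n + 2) / (N * p N ^ 2) ^ n) atTop (𝓝 0))
    (hC : Tendsto (fun N : ℕ => Real.log N / (N * p N ^ 2)) atTop (𝓝 0)) :
    Tendsto (fun N : ℕ => √(Real.log (1 / p N)) ^ (n + 2) * (1 / √(upperRank δ p N)) ^ n)
      atTop (𝓝 0) := by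
  refine tendsto_zero_of_pow (k := 2) ?_
  have h1 := hA.const_mul ((2 / δ) ^ n)
  rw [mul_zero] at h1
  refine squeeze_zero' (Eventually.of_forall fun N => sq_nonneg _) ?_ h1
  filter_upwards [eventually_upper_parameters hδ hδ1 hp hp0 hC] with N
    ⟨hN, hlog, hL, hLlog, hx1, hNp, hy, _⟩
  set L := Real.log (1 / p N)
  set x := (N : ℝ) * p N ^ 2
  set R : ℝ := (upperRank δ p N : ℝ) with hR
  have hRy : δ * x * L / Real.log N / 2 ≤ R := half_le_natFloor hy
  have hlpos : 0 < Real.log N := by linarith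
  have hLpos : 0 < L := by linarith
  have hxpos : 0 < x := by linarith
  have hypos : 0 < δ * x * L / Real.log N / 2 := by positivity
  have hRpos : 0 < R := hypos.trans_le hRy
  have e : (√L ^ (n + 2) * (1 / √R) ^ n) ^ 2 = L ^ (n + 2) * (1 / R) ^ n := by
    rw [mul_pow, ← pow_mul, mul_comm (n + 2) 2, pow_mul, Real.sq_sqrt hLpos.le, ← pow_mul,
      mul_comm n 2, pow_mul, div_pow, Real.sq_sqrt hRpos.le, one_pow]
  rw [e]
  calc L ^ (n + 2) * (1 / R) ^ n ≤ L ^ (n + 2) * (1 / (δ * x * L / Real.log N / 2)) ^ n := by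
        refine mul_le_mul_of_nonneg_left (pow_le_pow_left₀ (by positivity) ?_ n) (by positivity)
        exact one_div_le_one_div_of_le hypos hRy
    _ = (2 / δ) ^ n * (L ^ 2 * Real.log N ^ n / x ^ n) := by
        have : 1 / (δ * x * L / Real.log N / 2) = (2 / δ) * Real.log N / (x * L) := by
          field_simp
        rw [this, div_pow, mul_pow, mul_pow, pow_add]
        field_simp
    _ ≤ (2 / δ) ^ n * (Real.log N ^ (n + 2) / x ^ n) := by
        refine mul_le_mul_of_nonneg_left (div_le_div_of_nonneg_right ?_ (by positivity))
          (by positivity)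
        rw [pow_add, mul_comm]
        exact mul_le_mul_of_nonneg_left (pow_le_pow_left₀ hLpos.le hLlog 2) (by positivity)

end Density

/-- The factor for the number of pieces of the partition is absorbed by an exponential. -/
lemma pow_add_two_le_exp {N k : ℕ} (hN : 1 ≤ N) {c : ℝ} (h : k * Real.log N ≤ c / 2) (hc : 4 ≤ c) :
    (N : ℝ) ^ k + 2 ≤ Real.exp c := by
  have hN' : (0 : ℝ) < N := by exact_mod_cast hN
  have h1 : (N : ℝ) ^ k = Real.exp (k * Real.log N) := by
    rw [mul_comm, Real.exp_mul, Real.exp_log hN', Real.rpow_natCast]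
  have h2 : 1 ≤ Real.exp (c / 2) := Real.one_le_exp (by linarith)
  have h3 : (3 : ℝ) ≤ Real.exp (c / 2) := by linarith [Real.add_one_le_exp (c / 2)]
  calc (N : ℝ) ^ k + 2 ≤ Real.exp (c / 2) + 2 := by
        rw [h1]; linarith [Real.exp_le_exp.2 h]
    _ ≤ Real.exp (c / 2) * Real.exp (c / 2) := by nlinarith
    _ = Real.exp c := by rw [← Real.exp_add]; congr 1; ring

lemma homGraph_cycle_cubeGraph {ℓ N : ℕ} (hℓ : 3 ≤ ℓ) (ω : Edge N → Bool) :
    homGraph (SimpleGraph.cycleGraph ℓ) (cubeGraph ω) = (symMat (cubePoint ω) ^ ℓ).trace := by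
  rw [homGraph_cubeGraph, homMatrix_cycleGraph hℓ (symMat_isSymm _)]

/-! ### The upper tail -/

/-- Division by (Np)^ℓ reduces the tail to the two vanishing terms above. Half of η pays for the
tail and half for the additive 1. -/
lemma eventually_upper_tail_small {ℓ : ℕ} (hℓ : 3 ≤ ℓ) {p : ℕ → ℝ}
    (hp : ∀ N, 0 < p N ∧ p N < 1) (hp0 : Tendsto p atTop (𝓝 0)) {δ η C : ℝ} (hδ : 0 < δ)
    (hδ1 : δ ≤ 1) (hη : 0 < η)
    (hA : Tendsto (fun N : ℕ => Real.log N ^ ℓ / (N * p N ^ 2) ^ (ℓ - 2)) atTop (𝓝 0))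
    (hB : Tendsto (fun N : ℕ => 1 / ((N : ℝ) ^ (ℓ - 2) * p N ^ ℓ)) atTop (𝓝 0))
    (hC : Tendsto (fun N : ℕ => Real.log N / (N * p N ^ 2)) atTop (𝓝 0)) :
    ∀ᶠ N : ℕ in atTop, 2 * (2 ^ ℓ * ((√(32 * (C * (N ^ 2 * p N ^ 2 * Real.log (1 / p N)))) +
      p N * N) ^ ℓ * (2 * (1 / √(upperRank δ p N)) ^ (ℓ - 2)) +
      √(√(8 * N ^ 3 * p N ^ 2)) ^ ℓ * quarticSum ℓ N)) + 1 ≤ η * (N : ℝ) ^ ℓ * p N ^ ℓ := by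
  obtain ⟨n, rfl⟩ : ∃ n, ℓ = n + 2 := ⟨ℓ - 2, by omega⟩
  rw [Nat.add_sub_cancel] at hA
  have hα := tendsto_upper_rank_term hδ hδ1 hp hp0 hA hC
  have hβ := tendsto_fourthRoot_term hℓ (fun N => (hp N).1) hB hC
  set c : ℝ := √(32 * C) + 1 with hc
  have hlim : Tendsto (fun N : ℕ => 2 * 2 ^ (n + 2) * (2 * c ^ (n + 2) *
      (√(Real.log (1 / p N)) ^ (n + 2) * (1 / √(upperRank δ p N)) ^ n) +
      (√(√(8 * N ^ 3 * p N ^ 2)) / (N * p N)) ^ (n + 2) * quarticSum (n + 2) N)) atTop (𝓝 0) := by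
    have := ((hα.const_mul (2 * c ^ (n + 2))).add hβ).const_mul (2 * 2 ^ (n + 2) : ℝ)
    simpa using this
  filter_upwards [hlim.eventually (ge_mem_nhds (show (0 : ℝ) < η / 2 by positivity)),
    eventually_upper_parameters hδ hδ1 hp hp0 hC,
    (tendsto_natCast_atTop_atTop (R := ℝ)).eventually_ge_atTop (2 / η)] with N hsmall hpar hNη
  obtain ⟨hN, hlog, hL, hLlog, hx1, hNp, hy, hRN⟩ := hpar
  obtain ⟨hpN, hpN1⟩ := hp N
  rw [Nat.add_sub_cancel]
  set L := Real.log (1 / p N) with hLdef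
  set b := √(√(8 * N ^ 3 * p N ^ 2)) with hb
  set r := (1 / √(upperRank δ p N)) ^ n with hr
  have hr0 : 0 ≤ r := by positivity
  set y := (N : ℝ) * p N with hydef
  have hy0 : 0 < y := by linarith
  have hN0 : (0 : ℝ) ≤ N := by positivity
  have hsqrtL : 1 ≤ √L := by rw [Real.one_le_sqrt]; exact hL
  have ha : √(32 * (C * (N ^ 2 * p N ^ 2 * L))) + p N * N ≤ c * √L * y := by
    have e : 32 * (C * (N ^ 2 * p N ^ 2 * L)) = y ^ 2 * L * (32 * C) := by rw [hydef]; ring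
    rw [e, Real.sqrt_mul (by positivity), Real.sqrt_mul (by positivity), Real.sqrt_sq hy0.le, hc]
    have : p N * N ≤ √L * y := by
      rw [mul_comm, ← hydef]
      exact le_mul_of_one_le_left hy0.le hsqrtL
    nlinarith
  have hbpow : b ^ (n + 2) = (b / y) ^ (n + 2) * y ^ (n + 2) := by
    rw [← mul_pow, div_mul_cancel₀ _ hy0.ne']
  have hapow : (√(32 * (C * (N ^ 2 * p N ^ 2 * L))) + p N * N) ^ (n + 2) ≤
      c ^ (n + 2) * √L ^ (n + 2) * y ^ (n + 2) := by
    have := pow_le_pow_left₀ (by positivity) ha (n + 2)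
    rwa [mul_pow, mul_pow] at this
  have hmain : 2 ^ (n + 2) * ((√(32 * (C * (N ^ 2 * p N ^ 2 * L))) + p N * N) ^ (n + 2) * (2 * r) +
      b ^ (n + 2) * quarticSum (n + 2) N) ≤ η / 4 * y ^ (n + 2) := by
    calc _ ≤ 2 ^ (n + 2) * ((c ^ (n + 2) * √L ^ (n + 2) * y ^ (n + 2)) * (2 * r) +
          ((b / y) ^ (n + 2) * y ^ (n + 2)) * quarticSum (n + 2) N) := by
          rw [hbpow]
          gcongr
      _ = (2 * 2 ^ (n + 2) * (2 * c ^ (n + 2) * (√L ^ (n + 2) * r) +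
          (b / y) ^ (n + 2) * quarticSum (n + 2) N)) * (y ^ (n + 2) / 2) := by ring
      _ ≤ (η / 2) * (y ^ (n + 2) / 2) := mul_le_mul_of_nonneg_right hsmall (by positivity)
      _ = _ := by ring
  have hone : 1 ≤ η / 2 * y ^ (n + 2) := by
    have h1 : (N : ℝ) ≤ y ^ 2 := by
      have : y ^ 2 = N * (N * p N ^ 2) := by rw [hydef]; ring
      rw [this]
      exact le_mul_of_one_le_right hN0 hx1
    have h2 : y ^ 2 ≤ y ^ (n + 2) := pow_le_pow_right₀ hNp (by omega)
    rw [div_le_iff₀ hη] at hNη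
    nlinarith
  have hfin : η * (N : ℝ) ^ (n + 2) * p N ^ (n + 2) = η * y ^ (n + 2) := by
    rw [hydef, mul_pow]; ring
  rw [hfin]
  linarith

/-- The exceptional level is set equal to the clique bound for the rate, so the exceptional set is
never the dominant contribution. -/
theorem eventually_upper_bound {ℓ : ℕ} (hℓ : 3 ≤ ℓ) {p : ℕ → unitInterval}
    (hp : ∀ N, 0 < (p N : ℝ) ∧ (p N : ℝ) < 1)
    (hp0 : Tendsto (fun N => (p N : ℝ)) atTop (𝓝 0))
    (h : (fun N : ℕ => max ((N : ℝ) ^ ((2 : ℝ) / ℓ - 1))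
          (Real.log N ^ ((ℓ : ℝ) / (2 * ℓ - 4)) / √(N : ℝ))) =o[atTop] (fun N => (p N : ℝ)))
    (t : ℝ) {δ : ℝ} (hδ : 0 < δ) :
    ∀ᶠ N : ℕ in atTop, SimpleGraph.binomialRandom (Fin N) (p N)
        {G | t * (N : ℝ) ^ ℓ * (p N : ℝ) ^ ℓ ≤ homGraph (SimpleGraph.cycleGraph ℓ) G} ≤
      EReal.exp (-upperRate (SimpleGraph.cycleGraph ℓ) N (p N) (t - δ) +
        ((δ * (N ^ 2 * (p N : ℝ) ^ 2 * Real.log (1 / (p N : ℝ))) : ℝ) : EReal)) := by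
  obtain ⟨hB, hA⟩ := tendsto_of_upper_density hℓ (fun N => (hp N).1) h
  have hC : Tendsto (fun N : ℕ => Real.log N / (N * (p N : ℝ) ^ 2)) atTop (𝓝 0) := by
    obtain ⟨n, rfl⟩ : ∃ n, ℓ = n + 2 := ⟨ℓ - 2, by omega⟩
    exact tendsto_log_div (fun N => (hp N).1) hA
  set M : ℝ := ((meshExp ℓ + 3 : ℕ) : ℝ) with hM
  have hMpos : 0 < M := by rw [hM]; positivity
  -- The number of pieces has logarithm at most M (N + 1) R log N ≤ 2M δ' v, and δ' is chosen to
  -- make this at most δ v / 2.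
  set δ' := min 1 (δ / (4 * M)) with hδ'
  have hδ'0 : 0 < δ' := lt_min one_pos (by positivity)
  have hδ'1 : δ' ≤ 1 := min_le_left _ _
  have hδ'M : δ' * (4 * M) ≤ δ := by
    rw [← le_div_iff₀ (by positivity)]
    exact min_le_right _ _
  set K := max ⌈t⌉₊ 1 with hK
  have hKt : t ≤ K := (Nat.le_ceil t).trans (by exact_mod_cast le_max_left _ _)
  set C : ℝ := ((K : ℝ) + ℓ + 1) ^ 2 with hCdef
  filter_upwards [eventually_upper_tail_small hℓ hp hp0 (C := C) hδ'0 hδ'1 hδ hA hB hC,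
    eventually_upper_parameters hδ'0 hδ'1 hp hp0 hC,
    hp0.eventually (ge_mem_nhds (show (0 : ℝ) < 1 / ((K : ℝ) + ℓ + 1) by positivity)),
    (tendsto_natCast_atTop_atTop (R := ℝ)).eventually_ge_atTop (4 / δ)] with N hτ hpar hpK hNδ
  obtain ⟨hN, hlog, hL, hLlog, hx1, hNp, hy, hRN⟩ := hpar
  obtain ⟨hpN, hpN1⟩ := hp N
  set q : ℝ := (p N : ℝ) with hq
  set L := Real.log (1 / q) with hLdef
  set v := (N : ℝ) ^ 2 * q ^ 2 * L with hv
  have hN2 : (2 : ℝ) ≤ N := by exact_mod_cast hN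
  have hlpos : 0 < Real.log N := by linarith
  obtain ⟨B, hBprob, hBeig⟩ := exists_eigenvalue_bound (N := N) hpN hpN1 hNp (h := C * v)
  have hR1 : 1 ≤ upperRank δ' (fun N => (p N : ℝ)) N :=
    Nat.le_floor (by rw [Nat.cast_one]; exact hy)
  have hvN : (N : ℝ) ≤ v := by
    have : v = N * (N * q ^ 2 * L) := by rw [hv]; ring
    rw [this]
    refine le_mul_of_one_le_right (by linarith) ?_
    nlinarith
  refine binomialRandom_le_exp (ℓ := ℓ) (by omega) hN hRN hpN hpN1 _ _ B hBprob ?_ ?_ ?_ ?_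
    (τ := 2 ^ ℓ * ((√(32 * (C * v)) + q * N) ^ ℓ *
      (2 * (1 / √(upperRank δ' (fun N => (p N : ℝ)) N)) ^ (ℓ - 2)) +
      √(√(8 * N ^ 3 * q ^ 2)) ^ ℓ * quarticSum ℓ N))
  · refine upperRate_le hℓ hpN hpN1 hNp (le_max_right _ _) (by linarith) ?_
    rw [le_div_iff₀ (by positivity)] at hpK
    linarith
  · intro ω hω
    obtain ⟨U, d, hU, hA', hd⟩ := exists_specMat (symMat_isSymm (cubePoint ω))
    exact ⟨U, d, hU, hA', sum_tail_le_of_eigenvalue_bound hℓ hR1 (by positivity) (by positivity)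
      (hBeig ω hω U d hU hA' hd)⟩
  · intro X hX ω hω hdist
    refine iInf₂_le X ⟨hX, ?_⟩
    rw [ncard_edgeSet_cycleGraph hℓ, homMatrix_cycleGraph hℓ hX.1]
    have h1 : t * (N : ℝ) ^ ℓ * q ^ ℓ ≤ (symMat (cubePoint ω) ^ ℓ).trace := by
      rw [← homGraph_cycle_cubeGraph hℓ]
      exact hω
    have h2 := (abs_le.1 (hdist.trans hτ)).1
    have e : (t - δ) * (N : ℝ) ^ ℓ * q ^ ℓ = t * (N : ℝ) ^ ℓ * q ^ ℓ - δ * (N : ℝ) ^ ℓ * q ^ ℓ := by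
      ring
    rw [e]
    linarith
  · refine pow_add_two_le_exp (by omega) ?_ ?_
    · push_cast
      have hfloor : (upperRank δ' (fun N => (p N : ℝ)) N : ℝ) * Real.log N ≤
          δ' * (N * q ^ 2) * L := by
        rw [← le_div_iff₀ hlpos]
        exact Nat.floor_le (by linarith)
      have hM' : (meshExp ℓ + 3 : ℝ) = M := by rw [hM]; push_cast; ring
      rw [hM']
      calc M * (N + 1) * (upperRank δ' (fun N => (p N : ℝ)) N : ℝ) * Real.log N
          = M * (N + 1) * ((upperRank δ' (fun N => (p N : ℝ)) N : ℝ) * Real.log N) := by ring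
        _ ≤ M * (2 * N) * (δ' * (N * q ^ 2) * L) := by
            refine mul_le_mul (mul_le_mul_of_nonneg_left (by linarith) hMpos.le) hfloor
              (by positivity) (by positivity)
        _ = (δ' * (4 * M)) * v / 2 := by rw [hv]; ring
        _ ≤ δ * v / 2 := by
            have : 0 ≤ v := by linarith
            gcongr
    · rw [div_le_iff₀ hδ] at hNδ
      nlinarith

/-! ### The lower tail -/

/-- The power 2(ℓ - 1) clears the real exponent. -/
lemma tendsto_of_lower_density {ℓ : ℕ} (hℓ : 3 ≤ ℓ) {p : ℕ → ℝ}
    (h : (fun N : ℕ => (Real.log N / N) ^ (((ℓ : ℝ) - 2) / (2 * ℓ - 2))) =o[atTop] p) :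
    Tendsto (fun N : ℕ => (Real.log N / N) ^ (ℓ - 2) / p N ^ (2 * (ℓ - 1))) atTop (𝓝 0) := by
  have h2 := h.tendsto_div_nhds_zero.pow (2 * (ℓ - 1))
  rw [zero_pow (by omega)] at h2
  refine h2.congr fun N => ?_
  have hlog : 0 ≤ Real.log N / N := div_nonneg (Real.log_natCast_nonneg N) (by positivity)
  obtain ⟨n, rfl⟩ : ∃ n, ℓ = n + 2 := ⟨ℓ - 2, by omega⟩
  rw [div_pow, ← Real.rpow_natCast ((Real.log N / N) ^ _), ← Real.rpow_mul hlog]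
  have e : ((((n + 2 : ℕ) : ℝ) - 2) / (2 * (n + 2 : ℕ) - 2)) * ((2 * (n + 2 - 1) : ℕ) : ℝ) =
      (n : ℝ) := by
    have h1 : n + 2 - 1 = n + 1 := by omega
    rw [h1]
    push_cast
    have : (2 * ((n : ℝ) + 2) - 2) = 2 * (n + 1) := by ring
    rw [this]
    field_simp
    ring
  rw [e, Real.rpow_natCast, Nat.add_sub_cancel]

/-- The rank of the spectral truncation in the lower-tail problem. -/
noncomputable def lowerRank (δ : ℝ) (p : ℕ → ℝ) (N : ℕ) : ℕ := ⌊δ * (N * p N) / Real.log N⌋₊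

lemma eventually_lower_parameters {ℓ : ℕ} (hℓ : 3 ≤ ℓ) {p : ℕ → ℝ}
    (hp : ∀ N, 0 < p N ∧ p N < 1) {δ : ℝ} (hδ : 0 < δ) (hδ1 : δ ≤ 1)
    (hD : Tendsto (fun N : ℕ => (Real.log N / N) ^ (ℓ - 2) / p N ^ (2 * (ℓ - 1))) atTop (𝓝 0)) :
    ∀ᶠ N : ℕ in atTop, 2 ≤ N ∧ 1 ≤ Real.log N ∧ 1 ≤ N * p N ∧
      1 ≤ δ * (N * p N) / Real.log N ∧ lowerRank δ p N ≤ N := by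
  obtain ⟨n, rfl⟩ : ∃ n, ℓ = n + 2 := ⟨ℓ - 2, by omega⟩
  have hlim : Tendsto (fun N : ℕ => Real.log N / (N * p N)) atTop (𝓝 0) := by
    refine tendsto_zero_of_pow (k := n) ?_
    refine squeeze_zero (fun N => ?_) (fun N => ?_) hD
    · have := Real.log_natCast_nonneg N
      have := (hp N).1
      positivity
    · have h1 := Real.log_natCast_nonneg N
      obtain ⟨hpN, hpN1⟩ := hp N
      rw [Nat.add_sub_cancel, ← div_div, div_pow]
      refine div_le_div_of_nonneg_left (by positivity) (by positivity) ?_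
      exact pow_le_pow_of_le_one hpN.le hpN1.le (by omega)
  filter_upwards [eventually_ge_atTop 2, tendsto_log_natCast_atTop.eventually_ge_atTop 1,
    hlim.eventually (ge_mem_nhds (show (0 : ℝ) < δ from hδ))] with N hN hlog hc
  obtain ⟨hpN, hpN1⟩ := hp N
  have hN' : (2 : ℝ) ≤ N := by exact_mod_cast hN
  have hx : 0 < (N : ℝ) * p N := by positivity
  have hx' : Real.log N ≤ δ * (N * p N) := (div_le_iff₀ hx).1 hc
  refine ⟨hN, hlog, by nlinarith, ?_, ?_⟩
  · rw [le_div_iff₀ (by linarith), one_mul]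
    exact hx'
  · refine Nat.floor_le_of_le ?_
    rw [div_le_iff₀ (by linarith)]
    have h1 : δ * (N * p N) ≤ 1 * (N * 1) := by gcongr
    nlinarith

/-- After division by (Np)^ℓ and squaring, the tail is at most a constant times (log N / N)^(ℓ-2) /
p^(2(ℓ-1)), the quantity that the density hypothesis sends to zero. -/
lemma eventually_lower_tail_small {ℓ : ℕ} (hℓ : 3 ≤ ℓ) {p : ℕ → ℝ}
    (hp : ∀ N, 0 < p N ∧ p N < 1) {δ η : ℝ} (hδ : 0 < δ) (hδ1 : δ ≤ 1) (hη : 0 < η)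
    (hD : Tendsto (fun N : ℕ => (Real.log N / N) ^ (ℓ - 2) / p N ^ (2 * (ℓ - 1))) atTop (𝓝 0)) :
    ∀ᶠ N : ℕ in atTop,
      2 * (√(2 * (2 * (N ^ 2 * p N)) / lowerRank δ p N) ^ (ℓ - 2) * (2 * (2 * (N ^ 2 * p N)))) + 1 ≤
        η * (N : ℝ) ^ ℓ * p N ^ ℓ := by
  obtain ⟨n, rfl⟩ : ∃ n, ℓ = n + 2 := ⟨ℓ - 2, by omega⟩
  have hpar := eventually_lower_parameters hℓ hp hδ hδ1 hD
  have hn2 : n + 2 - 1 = n + 1 := by omega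
  rw [Nat.add_sub_cancel, hn2] at hD
  rw [Nat.add_sub_cancel]
  have hlim : Tendsto (fun N : ℕ => √(2 * (2 * (N ^ 2 * p N)) / lowerRank δ p N) ^ n *
      (2 * (2 * (N ^ 2 * p N))) / (N * p N) ^ (n + 2)) atTop (𝓝 0) := by
    refine tendsto_zero_of_pow (k := 2) ?_
    have h1 := hD.const_mul (16 * (8 / δ) ^ n)
    rw [mul_zero] at h1
    refine squeeze_zero' (Eventually.of_forall fun N => sq_nonneg _) ?_ h1
    filter_upwards [hpar] with N ⟨hN, hlog, hNp, hy, _⟩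
    obtain ⟨hpN, hpN1⟩ := hp N
    have hN' : (0 : ℝ) < N := by
      have : 0 < N := by omega
      exact_mod_cast this
    have hlpos : 0 < Real.log N := by linarith
    set R : ℝ := (lowerRank δ p N : ℝ) with hR
    have hRy : δ * (N * p N) / Real.log N / 2 ≤ R := half_le_natFloor hy
    have hypos : 0 < δ * (N * p N) / Real.log N / 2 := by positivity
    have hRpos : 0 < R := hypos.trans_le hRy
    have hquot : 2 * (2 * (N ^ 2 * p N)) / R ≤ 8 / δ * (N * Real.log N) := by
      calc 2 * (2 * (N ^ 2 * p N)) / R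
          ≤ 2 * (2 * (N ^ 2 * p N)) / (δ * (N * p N) / Real.log N / 2) :=
            div_le_div_of_nonneg_left (by positivity) hypos hRy
        _ = _ := by field_simp; ring
    calc (√(2 * (2 * (N ^ 2 * p N)) / R) ^ n * (2 * (2 * (N ^ 2 * p N))) / (N * p N) ^ (n + 2)) ^ 2
        = (2 * (2 * (N ^ 2 * p N)) / R) ^ n * (16 * (N ^ 2 * p N) ^ 2) /
            ((N * p N) ^ (n + 2)) ^ 2 := by
          rw [div_pow, mul_pow, ← pow_mul, mul_comm n 2, pow_mul,
            Real.sq_sqrt (by positivity)]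
          ring
      _ ≤ (8 / δ * (N * Real.log N)) ^ n * (16 * (N ^ 2 * p N) ^ 2) /
            ((N * p N) ^ (n + 2)) ^ 2 := by gcongr
      _ = 16 * (8 / δ) ^ n * ((Real.log N / N) ^ n / p N ^ (2 * (n + 1))) := by
          rw [mul_pow, mul_pow, div_pow (Real.log N), mul_pow (N : ℝ) (p N)]
          field_simp
          ring
  filter_upwards [hlim.eventually (ge_mem_nhds (show (0 : ℝ) < η / 4 by positivity)), hpar,
    (tendsto_log_natCast_atTop).eventually_ge_atTop (2 / η)] with N hsmall hpar hNη
  obtain ⟨hN, hlog, hNp, hy, -⟩ := hpar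
  set y := (N : ℝ) * p N with hydef
  have hy0 : 0 < y := by linarith
  have hlogy : Real.log N ≤ y := by
    rw [le_div_iff₀ (by linarith), one_mul] at hy
    nlinarith
  have hone : 1 ≤ η / 2 * y ^ (n + 2) := by
    have h2 : y ≤ y ^ (n + 2) := le_self_pow₀ hNp (by omega)
    rw [div_le_iff₀ hη] at hNη
    nlinarith
  rw [div_le_iff₀ (by positivity)] at hsmall
  have hfin : η * (N : ℝ) ^ (n + 2) * p N ^ (n + 2) = η * y ^ (n + 2) := by
    rw [hydef, mul_pow]; ring
  rw [hfin]
  linarith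

/-- The exceptional set consists of the graphs with at least 2N²p edges; its exponent N²p matches
the rate bound given by the empty graph. -/
theorem eventually_lower_bound {ℓ : ℕ} (hℓ : 3 ≤ ℓ) {p : ℕ → unitInterval}
    (hp : ∀ N, 0 < (p N : ℝ) ∧ (p N : ℝ) < 1)
    (hp0 : Tendsto (fun N => (p N : ℝ)) atTop (𝓝 0))
    (h : (fun N : ℕ => (Real.log N / N) ^ (((ℓ : ℝ) - 2) / (2 * ℓ - 2)))
      =o[atTop] (fun N => (p N : ℝ)))
    {t : ℝ} (ht : 0 ≤ t) {δ : ℝ} (hδ : 0 < δ) :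
    ∀ᶠ N : ℕ in atTop, SimpleGraph.binomialRandom (Fin N) (p N)
        {G | homGraph (SimpleGraph.cycleGraph ℓ) G ≤ t * (N : ℝ) ^ ℓ * (p N : ℝ) ^ ℓ} ≤
      EReal.exp (-lowerRate (SimpleGraph.cycleGraph ℓ) N (p N) (t + δ) +
        ((δ * (N ^ 2 * (p N : ℝ)) : ℝ) : EReal)) := by
  have hD := tendsto_of_lower_density hℓ h
  set M : ℝ := ((meshExp ℓ + 3 : ℕ) : ℝ) with hM
  have hMpos : 0 < M := by rw [hM]; positivity
  set δ' := min 1 (δ / (4 * M)) with hδ'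
  have hδ'0 : 0 < δ' := lt_min one_pos (by positivity)
  have hδ'1 : δ' ≤ 1 := min_le_left _ _
  have hδ'M : δ' * (4 * M) ≤ δ := by
    rw [← le_div_iff₀ (by positivity)]
    exact min_le_right _ _
  filter_upwards [eventually_lower_tail_small hℓ hp hδ'0 hδ'1 hδ hD,
    eventually_lower_parameters hℓ hp hδ'0 hδ'1 hD,
    hp0.eventually (ge_mem_nhds (show (0 : ℝ) < 1 / 2 by norm_num)),
    (tendsto_natCast_atTop_atTop (R := ℝ)).eventually_ge_atTop (4 / δ)] with N hτ hpar hp2 hNδ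
  obtain ⟨hN, hlog, hNp, hy, hRN⟩ := hpar
  obtain ⟨hpN, hpN1⟩ := hp N
  set q : ℝ := (p N : ℝ) with hq
  set v := (N : ℝ) ^ 2 * q with hv
  have hN2 : (2 : ℝ) ≤ N := by exact_mod_cast hN
  have hlpos : 0 < Real.log N := by linarith
  have hR1 : 1 ≤ lowerRank δ' (fun N => (p N : ℝ)) N :=
    Nat.le_floor (by rw [Nat.cast_one]; exact hy)
  have hvN : (N : ℝ) ≤ v := by
    have : v = N * (N * q) := by rw [hv]; ring
    rw [this]
    exact le_mul_of_one_le_right (by linarith) hNp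
  refine binomialRandom_le_exp (ℓ := ℓ) (by omega) hN hRN hpN hpN1 _ _ (Finset.univ.filter
    fun ω : Edge N → Bool => 2 * (N ^ 2 * q) ≤ ∑ e, cubePoint ω e) (h := v) ?_ ?_ ?_ ?_ ?_
    (τ := √(2 * (2 * v) / lowerRank δ' (fun N => (p N : ℝ)) N) ^ (ℓ - 2) * (2 * (2 * v)))
  · refine (cubeProb_many_edges hpN hpN1).trans ?_
    rw [← hv]
    linarith [Real.exp_pos (-v)]
  · exact lowerRate_le hℓ hpN hp2 (by linarith)
  · intro ω hω
    obtain ⟨U, d, hU, hA', hd⟩ := exists_specMat (symMat_isSymm (cubePoint ω))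
    refine ⟨U, d, hU, hA', sum_tail_le_of_few_edges (ℓ := ℓ) (by omega) hR1 ω ?_ hU hA' hd⟩
    rw [Finset.mem_filter] at hω
    push Not at hω
    exact (hω (Finset.mem_univ _)).le
  · intro X hX ω hω hdist
    refine iInf₂_le X ⟨hX, ?_⟩
    rw [ncard_edgeSet_cycleGraph hℓ, homMatrix_cycleGraph hℓ hX.1]
    have h1 : (symMat (cubePoint ω) ^ ℓ).trace ≤ t * (N : ℝ) ^ ℓ * q ^ ℓ := by
      rw [← homGraph_cycle_cubeGraph hℓ]
      exact hω
    have h2 := (abs_le.1 (hdist.trans hτ)).2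
    have e : (t + δ) * (N : ℝ) ^ ℓ * q ^ ℓ = t * (N : ℝ) ^ ℓ * q ^ ℓ + δ * (N : ℝ) ^ ℓ * q ^ ℓ := by
      ring
    rw [e]
    linarith
  · refine pow_add_two_le_exp (by omega) ?_ ?_
    · push_cast
      have hfloor : (lowerRank δ' (fun N => (p N : ℝ)) N : ℝ) * Real.log N ≤ δ' * (N * q) := by
        rw [← le_div_iff₀ hlpos]
        exact Nat.floor_le (by linarith)
      have hM' : (meshExp ℓ + 3 : ℝ) = M := by rw [hM]; push_cast; ring
      rw [hM']
      calc M * (N + 1) * (lowerRank δ' (fun N => (p N : ℝ)) N : ℝ) * Real.log N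
          = M * (N + 1) * ((lowerRank δ' (fun N => (p N : ℝ)) N : ℝ) * Real.log N) := by ring
        _ ≤ M * (2 * N) * (δ' * (N * q)) := by
            refine mul_le_mul (mul_le_mul_of_nonneg_left (by linarith) hMpos.le) hfloor
              (by positivity) (by positivity)
        _ = (δ' * (4 * M)) * v / 2 := by rw [hv]; ring
        _ ≤ δ * v / 2 := by
            have : 0 ≤ v := by linarith
            gcongr
    · rw [div_le_iff₀ hδ] at hNδ
      nlinarith

/-! ### Monotonicity of the rates and the final assembly -/

lemma upperRate_anti {n : ℕ} (H : SimpleGraph (Fin n)) (N : ℕ) {p : ℝ} (hp : 0 ≤ p) {s t : ℝ}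
    (hst : s ≤ t) : upperRate H N p s ≤ upperRate H N p t := by
  refine le_iInf₂ fun X hX => iInf₂_le X ⟨hX.1, le_trans ?_ hX.2⟩
  gcongr

lemma lowerRate_anti {n : ℕ} (H : SimpleGraph (Fin n)) (N : ℕ) {p : ℝ} (hp : 0 ≤ p) {s t : ℝ}
    (hst : s ≤ t) : lowerRate H N p t ≤ lowerRate H N p s := by
  refine le_iInf₂ fun X hX => iInf₂_le X ⟨hX.1, hX.2.trans ?_⟩
  gcongr

/-- The constant weight p has zero entropy and a nonnegative count. This is the fallback for small
N, where no clique need fit. -/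
lemma upperRate_zero_le {n : ℕ} (H : SimpleGraph (Fin n)) (N : ℕ) {p : ℝ} (hp : 0 < p)
    (hp1 : p < 1) : upperRate H N p 0 ≤ ((0 : ℝ) : EReal) := by
  have hmem : symMat (fun _ : Edge N => p) ∈ weightedGraphs N :=
    symMat_mem fun _ => ⟨hp.le, hp1.le⟩
  refine (iInf₂_le (symMat fun _ => p) ⟨hmem, ?_⟩).trans ?_
  · rw [relEntropyMatrix_symMat]
    simp [relEntropy_self hp hp1]
  · rw [zero_mul, zero_mul]
    exact Finset.sum_nonneg fun f _ => Finset.prod_nonneg fun e _ => (hmem.2.1 _ _).1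

end SubgraphLD

theorem theorem1p2 (ℓ : ℕ) (hℓ : 3 ≤ ℓ) (p : ℕ → unitInterval)
    (hp : ∀ N, 0 < (p N : ℝ) ∧ (p N : ℝ) < 1)
    (hp0 : Tendsto (fun N => (p N : ℝ)) atTop (𝓝 0)) :
    ((fun N : ℕ => max ((N : ℝ) ^ ((2 : ℝ) / ℓ - 1))
          (Real.log N ^ ((ℓ : ℝ) / (2 * ℓ - 4)) / √(N : ℝ)))
        =o[atTop] (fun N => (p N : ℝ)) →
      ∀ t : ℝ, 1 < t →
        ∃ ε E : ℕ → ℝ, Tendsto ε atTop (𝓝 0) ∧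
          E =o[atTop] (fun N : ℕ => (N : ℝ) ^ 2 * (p N : ℝ) ^ 2 * Real.log (1 / (p N : ℝ))) ∧
          ∀ N : ℕ, 2 ≤ N →
            SimpleGraph.binomialRandom (Fin N) (p N)
                {G | t * (N : ℝ) ^ ℓ * (p N : ℝ) ^ ℓ ≤
                  SubgraphLD.homGraph (SimpleGraph.cycleGraph ℓ) G} ≤
              EReal.exp (-SubgraphLD.upperRate (SimpleGraph.cycleGraph ℓ) N (p N) (t - ε N)
                + (E N : EReal))) ∧
    ((fun N : ℕ => (Real.log N / N) ^ (((ℓ : ℝ) - 2) / (2 * ℓ - 2)))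
        =o[atTop] (fun N => (p N : ℝ)) →
      ∀ t : ℝ, 0 ≤ t → t < 1 →
        ∃ ε E : ℕ → ℝ, Tendsto ε atTop (𝓝 0) ∧
          E =o[atTop] (fun N : ℕ => (N : ℝ) ^ 2 * (p N : ℝ)) ∧
          ∀ N : ℕ, 2 ≤ N →
            SimpleGraph.binomialRandom (Fin N) (p N)
                {G | SubgraphLD.homGraph (SimpleGraph.cycleGraph ℓ) G ≤
                  t * (N : ℝ) ^ ℓ * (p N : ℝ) ^ ℓ} ≤
              EReal.exp (-SubgraphLD.lowerRate (SimpleGraph.cycleGraph ℓ) N (p N) (t + ε N)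
                + (E N : EReal))) := by
  constructor
  · intro h t _
    obtain ⟨ε, E, hε, hE, hbound⟩ := SubgraphLD.exists_error_sequences
      (P := fun N => SimpleGraph.binomialRandom (Fin N) (p N)
        {G | t * (N : ℝ) ^ ℓ * (p N : ℝ) ^ ℓ ≤
          SubgraphLD.homGraph (SimpleGraph.cycleGraph ℓ) G})
      (fun N => prob_le_one)
      (rate := fun δ N => SubgraphLD.upperRate (SimpleGraph.cycleGraph ℓ) N (p N) (t - δ))
      (fun N δ δ' hle => SubgraphLD.upperRate_anti _ N (hp N).1.le (by linarith))
      (v := fun N : ℕ => (N : ℝ) ^ 2 * (p N : ℝ) ^ 2 * Real.log (1 / (p N : ℝ)))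
      (fun N => mul_nonneg (by positivity) (Real.log_nonneg (by
        rw [le_div_iff₀ (hp N).1]; linarith [(hp N).2])))
      -- The shift by t lowers the threshold to zero, where the rate is at most 0.
      (fun N => ⟨t, 0, by
        rw [sub_self]; exact SubgraphLD.upperRate_zero_le _ N (hp N).1 (hp N).2⟩)
      (fun δ hδ => SubgraphLD.eventually_upper_bound hℓ hp hp0 h t hδ)
    exact ⟨ε, E, hε, hE, fun N _ => hbound N⟩
  · intro h t ht _
    obtain ⟨ε, E, hε, hE, hbound⟩ := SubgraphLD.exists_error_sequences
      (P := fun N => SimpleGraph.binomialRandom (Fin N) (p N)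
        {G | SubgraphLD.homGraph (SimpleGraph.cycleGraph ℓ) G ≤
          t * (N : ℝ) ^ ℓ * (p N : ℝ) ^ ℓ})
      (fun N => prob_le_one)
      (rate := fun δ N => SubgraphLD.lowerRate (SimpleGraph.cycleGraph ℓ) N (p N) (t + δ))
      (fun N δ δ' hle => SubgraphLD.lowerRate_anti _ N (hp N).1.le (by linarith))
      (v := fun N : ℕ => (N : ℝ) ^ 2 * (p N : ℝ))
      (fun N => mul_nonneg (by positivity) (hp N).1.le)
      (fun N => ⟨0, _, SubgraphLD.lowerRate_le_zero_matrix hℓ (hp N).1 (by linarith)⟩)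
      (fun δ hδ => SubgraphLD.eventually_lower_bound hℓ hp hp0 h ht hδ)
    exact ⟨ε, E, hε, hE, fun N _ => hbound N⟩
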